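/- Let $\mathbb K$ be an algebraically closed field of characteristic zero, $T=(\mathbb K^*)^n$ with character lattice $M=\mathbb Z^n$, and $\hat T=\mathbb K^*\times T$ with character lattice $\hat M=\mathbb Z\oplus M$. Let $P\subseteq M_{\mathbb R}=\mathbb R^n$ be a full dimensional normal lattice polytope (normal: for every $k\ge 0$, every lattice point of $kP$ is a sum of $k$ lattice points of $P$), $\Lambda=P\cap M$, $V=\mathbb K^{\Lambda}$ with standard basis $(e_\chi)_{\chi\in\Lambda}$, and let $X_P\subseteq\mathbb P(V)$ be the Zariski closure of $\{[\sum_{\chi\in\Lambda}\chi(t)e_\chi] : t\in T\}$, with affine cone $\hat X_P\subseteq V$ and homogeneous coordinate ring $\mathbb K[\hat X_P]$. The torus $\hat T$ acts on $V$ by $(c,t)\cdot e_\chi=c\,\chi(t)e_\chi$ and on $\mathbb K[\hat X_P]$ by $(\hat t\cdot g)(x)=g(\hat t^{-1}x)$. Let $A$ be the set of nonempty faces of $P$ (including $P$), ordered by inclusion. For $\sigma\in A$ let $X_\sigma$ be the Zariski closure of the $T$-orbit $O_\sigma=\{[\sum_{\chi\in\Lambda\cap\sigma}\chi(t)e_\chi]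 : t\in T\}$. A family of projective subvarieties (irreducible and Zariski closed) $Y_p\subseteq X$ and of homogeneous functions $f_p\in\mathbb K[\hat X]$ of positive degree, indexed by a finite poset $A$ with $q\le p\Leftrightarrow Y_q\subseteq Y_p$ and having a largest element $p_{\max}$ with $Y_{p_{\max}}=X$, is a Seshadri stratification on $X\subseteq\mathbb P(V)$ if: (S1) every $Y_p$ is smooth in codimension one (its singular locus has codimension at least $2$), and $Y_q$ has codimension one in $Y_p$ whenever $q$ is covered by $p$; (S2) $f_q$ vanishes on $Y_p$ whenever $q\not\le p$; (S3) $\{x\in Y_p : f_p(x)=0\}=\bigcup_{q \text{ covered by } p}Y_q$ as sets, for every $p\in A$. A Seshadri stratification on $X_P$ is $T$-equivariant if its subvarieties are the orbit closures $X_\sigma$, $\sigma\in A$, and its functions $f_\sigma$ are $T$-eigenfunctions. **Theorem.** For every $\sigma\in A$ let $f_\sigma\in\mathbb K[\hat X_P]\setminus\{0\}$ be a $\hat T$-eigenfunction of weight $\mu_\sigma\in\hat M$, homogeneous of degree $\deg f_\sigma\ge 1$. The following are equivalent: (i) $(X_\sigma,f_\sigma)_{\sigma\in A}$ is a $T$-equivariant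 Seshadri stratification on $X_P$; (ii) $(X_\sigma,f_\sigma)_{\sigma\in A}$ is a combinatorial Seshadri stratification on $X_P$, i.e. for every $\sigma\in A$ the point $-\mu_\sigma/\deg f_\sigma$ lies in the relative interior of $\{1\}\times\sigma\subseteq\mathbb R\oplus M_{\mathbb R}$. -/

import Mathlib

open scoped LinearAlgebra.Projectivization

noncomputable section

namespace ToricSeshadri

/-! ### Projective varieties in `ℙ(K^ι)` -/

section Projective

variable {K : Type*} [Field K] {ι : Type*}

/-- The common zeros in `ℙ(K^ι)` of a set of (homogeneous) polynomials. -/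
def projZeros (S : Set (MvPolynomial ι K)) : Set (ℙ K (ι → K)) :=
  {p | ∀ F ∈ S, MvPolynomial.eval p.rep F = 0}

/-- Every member of `S` is a homogeneous polynomial (of some degree). -/
def AllHomogeneous (S : Set (MvPolynomial ι K)) : Prop :=
  ∀ F ∈ S, ∃ d : ℕ, F.IsHomogeneous d

/-- The Zariski topology on `ℙ(K^ι)`: the closed sets are the zero sets of families of
homogeneous polynomials. -/
instance zariskiTopology : TopologicalSpace (ℙ K (ι → K)) :=
  TopologicalSpace.ofClosed {C | ∃ S, AllHomogeneous S ∧ C = projZeros S}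
    ⟨{1}, by
      rintro F rfl
      exact ⟨0, MvPolynomial.isHomogeneous_one _ _⟩, by
      ext p; simp [projZeros]⟩
    (by
      intro 𝒞 h𝒞
      refine ⟨{F | ∃ S, AllHomogeneous S ∧ projZeros S ∈ 𝒞 ∧ F ∈ S}, ?_, ?_⟩
      · rintro F ⟨S, hS, -, hF⟩
        exact hS F hF
      · ext p
        constructor
        · rintro hp F ⟨S, -, hSC, hF⟩
          exact hp _ hSC F hF
        · intro hp C hC
          obtain ⟨S, hS, rfl⟩ := h𝒞 hC
          exact fun F hF => hp F ⟨S, hS, hC, hF⟩)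
    (by
      rintro _ ⟨S, hS, rfl⟩ _ ⟨S', hS', rfl⟩
      refine ⟨{F | ∃ G ∈ S, ∃ H ∈ S', F = G * H}, ?_, ?_⟩
      · rintro F ⟨G, hG, H, hH, rfl⟩
        obtain ⟨d, hd⟩ := hS G hG
        obtain ⟨e, he⟩ := hS' H hH
        exact ⟨d + e, hd.mul he⟩
      · ext p
        constructor
        · rintro (hp | hp) F ⟨G, hG, H, hH, rfl⟩
          · simp [hp G hG]
          · simp [hp H hH]
        · intro hp
          by_contra hcon
          simp only [Set.mem_union, not_or, projZeros, Set.mem_ofPred_eq, not_forall] at hcon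
          obtain ⟨⟨G, hG, hG0⟩, ⟨H, hH, hH0⟩⟩ := hcon
          have := hp (G * H) ⟨G, hG, H, hH, rfl⟩
          rw [map_mul] at this
          exact (mul_ne_zero hG0 hH0) this)

theorem isClosed_iff {C : Set (ℙ K (ι → K))} :
    IsClosed C ↔ ∃ S, AllHomogeneous S ∧ C = projZeros S := by
  rw [← isOpen_compl_iff]
  change Cᶜᶜ ∈ {C : Set (ℙ K (ι → K)) | ∃ S, AllHomogeneous S ∧ C = projZeros S} ↔ _
  rw [compl_compl]
  exact Iff.rfl

/-- The affine cone `X̂ ⊆ K^ι` over `X ⊆ ℙ(K^ι)` (it contains the origin). -/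
def affineCone (X : Set (ℙ K (ι → K))) : Set (ι → K) :=
  {v | ∀ h : v ≠ 0, Projectivization.mk K v h ∈ X}

/-- The homogeneous coordinate ring of `X`, i.e. the coordinate ring `K[X̂]` of its affine cone. -/
abbrev CoordRing (X : Set (ℙ K (ι → K))) : Type _ :=
  MvPolynomial ι K ⧸ MvPolynomial.vanishingIdeal K (affineCone X)

/-- The value of a regular function `f ∈ K[X̂]` at a point of the cone `X̂`. -/
def evalAt {X : Set (ℙ K (ι → K))} (x : affineCone X) : CoordRing X →ₐ[K] K :=
  Ideal.Quotient.liftₐ _ (MvPolynomial.aeval (x : ι → K)) fun _ hF => hF x x.2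

/-- `f ∈ K[X̂]` is homogeneous of degree `m`. -/
def IsHomogeneousOfDegree {X : Set (ℙ K (ι → K))} (f : CoordRing X) (m : ℕ) : Prop :=
  ∃ F : MvPolynomial ι K, F.IsHomogeneous m ∧ Ideal.Quotient.mk _ F = f

/-- The vanishing set `{[v] ∈ X | f(v) = 0}` in `X` of a homogeneous function `f ∈ K[X̂]`. -/
def vanishingSet {X : Set (ℙ K (ι → K))} (f : CoordRing X) : Set (ℙ K (ι → K)) :=
  {p | ∃ (x : affineCone X) (hx : (x : ι → K) ≠ 0),
    Projectivization.mk K (x : ι → K) hx = p ∧ evalAt x f = 0}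

/-- A projective variety: an irreducible (in particular nonempty) Zariski closed subset. -/
def IsProjectiveVariety (X : Set (ℙ K (ι → K))) : Prop :=
  IsClosed X ∧ IsIrreducible X

/-- The dimension of a subset of projective space (`⊥` for the empty set). -/
def dim (X : Set (ℙ K (ι → K))) : WithBot ℕ∞ :=
  topologicalKrullDim X

variable [Fintype ι]

/-- The differential `w ↦ ∑ i, ∂F/∂x_i (v) w_i` of a polynomial at a point. -/
def differential (F : MvPolynomial ι K) (v : ι → K) : (ι → K) →ₗ[K] K :=
  ∑ i, MvPolynomial.eval v (MvPolynomial.pderiv i F) • LinearMap.proj i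

/-- The Zariski tangent space of the affine cone `X̂` at a nonzero vector on the line `p`. -/
def coneTangentSpace (X : Set (ℙ K (ι → K))) (p : ℙ K (ι → K)) : Submodule K (ι → K) :=
  ⨅ F ∈ MvPolynomial.vanishingIdeal K (affineCone X), LinearMap.ker (differential F p.rep)

/-- `p` is a smooth point of the projective variety `X`: the tangent space of the cone over `X`
along the line `p` has dimension `dim X + 1` (equivalently, the projective tangent space of `X`
at `p` has dimension `dim X`). -/
def IsSmoothPoint (X : Set (ℙ K (ι → K))) (p : ℙ K (ι → K)) : Prop :=
  ((Module.finrank K (coneTangentSpace X p) : ℕ∞) : WithBot ℕ∞) = dim X + 1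

/-- The singular locus of the projective variety `X`. -/
def singularLocus (X : Set (ℙ K (ι → K))) : Set (ℙ K (ι → K)) :=
  {p ∈ X | ¬ IsSmoothPoint X p}

/-- `X` is smooth in codimension one: its singular locus has codimension at least two. -/
def IsSmoothInCodimOne (X : Set (ℙ K (ι → K))) : Prop :=
  dim (singularLocus X) + 2 ≤ dim X

/-- `Y` is a codimension one subvariety of `X`. -/
def IsCodimOneIn (Y X : Set (ℙ K (ι → K))) : Prop :=
  Y ⊆ X ∧ dim Y + 1 = dim X

/-- The family `(Y p, f p)`, `p ∈ A`, of projective subvarieties of `X` and of homogeneous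
functions of positive degree on `X` is a Seshadri stratification on `X ⊆ ℙ(K^ι)`. -/
structure IsSeshadriStratification {A : Type*} [PartialOrder A] (X : Set (ℙ K (ι → K)))
    (Y : A → Set (ℙ K (ι → K))) (f : A → CoordRing X) : Prop where
  finite : Finite A
  variety : ∀ p, IsProjectiveVariety (Y p)
  subset : ∀ p, Y p ⊆ X
  homogeneous : ∀ p, ∃ m : ℕ, 1 ≤ m ∧ IsHomogeneousOfDegree (f p) m
  /-- the order on `A` is the one given by inclusion of the subvarieties -/
  le_iff : ∀ p q, q ≤ p ↔ Y q ⊆ Y p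
  exists_top : ∃ pmax, (∀ p, p ≤ pmax) ∧ Y pmax = X
  smooth : ∀ p, IsSmoothInCodimOne (Y p)
  codim_one : ∀ p q, q ⋖ p → IsCodimOneIn (Y q) (Y p)
  vanish : ∀ p q, ¬ q ≤ p → Y p ⊆ vanishingSet (f q)
  boundary : ∀ p, vanishingSet (f p) ∩ Y p = ⋃ q, ⋃ (_ : q ⋖ p), Y q

end Projective

/-! ### Normal lattice polytopes -/

/-- The inclusion `M = ℤⁿ → M_ℝ = ℝⁿ` of the character lattice. -/
def toReal {n : ℕ} (χ : Fin n → ℤ) : Fin n → ℝ := fun i => (χ i : ℝ)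

/-- A full dimensional normal lattice polytope in `M_ℝ = ℝⁿ`, given as the convex hull of a
finite set of lattice points.  Normality: every lattice point of `k P` is a sum of `k` lattice
points of `P`. -/
structure NormalLatticePolytope (n : ℕ) where
  generators : Finset (Fin n → ℤ)
  fullDim : affineSpan ℝ (convexHull ℝ (toReal '' (generators : Set (Fin n → ℤ)))) = ⊤
  normal : ∀ (k : ℕ) (χ : Fin n → ℤ),
    (∃ x ∈ convexHull ℝ (toReal '' (generators : Set (Fin n → ℤ))), toReal χ = (k : ℝ) • x) →
      ∃ a : Fin k → Fin n → ℤ,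
        (∀ j, toReal (a j) ∈ convexHull ℝ (toReal '' (generators : Set (Fin n → ℤ)))) ∧
          ∑ j, a j = χ

variable {n : ℕ}

/-- The polytope as a subset of `ℝⁿ`. -/
def NormalLatticePolytope.carrier (P : NormalLatticePolytope n) : Set (Fin n → ℝ) :=
  convexHull ℝ (toReal '' (P.generators : Set (Fin n → ℤ)))

/-- The set `Λ = P ∩ M` of lattice points of `P`. -/
abbrev NormalLatticePolytope.Lam (P : NormalLatticePolytope n) : Type :=
  {χ : Fin n → ℤ // toReal χ ∈ P.carrier}

instance (P : NormalLatticePolytope n) : Finite P.Lam := by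
  have hb : Bornology.IsBounded P.carrier :=
    (isBounded_convexHull).2 ((P.generators.finite_toSet.image toReal).isBounded)
  obtain ⟨R, hR⟩ := hb.exists_norm_le
  have hfin : (Set.Icc (fun _ => -⌈R⌉ : Fin n → ℤ) (fun _ => ⌈R⌉)).Finite := Set.finite_Icc _ _
  refine (hfin.subset ?_).to_subtype
  intro χ hχ
  have h : ∀ i, |((χ i : ℤ) : ℝ)| ≤ R := fun i =>
    (norm_le_pi_norm (toReal χ) i).trans (hR _ hχ)
  refine ⟨fun i => ?_, fun i => ?_⟩
  · have h1 := (abs_le.1 (h i)).1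
    have h2 := Int.le_ceil R
    have h3 : ((-⌈R⌉ : ℤ) : ℝ) ≤ (χ i : ℝ) := by push_cast; linarith
    exact_mod_cast h3
  · have h1 := (abs_le.1 (h i)).2
    exact_mod_cast h1.trans (Int.le_ceil R)

instance (P : NormalLatticePolytope n) : Fintype P.Lam := Fintype.ofFinite _

/-- The (nonempty) faces of `P`, ordered by inclusion; `P` itself is a face. -/
abbrev NormalLatticePolytope.Face (P : NormalLatticePolytope n) : Type :=
  {σ : Set (Fin n → ℝ) // σ.Nonempty ∧ IsExposed ℝ P.carrier σ}

/-- A face `σ` placed in the affine hyperplane `{1} × M_ℝ` of `ℝ × M_ℝ`. -/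
def liftFace (σ : Set (Fin n → ℝ)) : Set (ℝ × (Fin n → ℝ)) := (fun x => ((1 : ℝ), x)) '' σ

/-! ### The torus and the embedded toric variety -/

section Toric

variable (K : Type*) [Field K]

/-- The torus `T = (K^*)ⁿ`. -/
abbrev Torus (n : ℕ) : Type _ := Fin n → Kˣ

/-- The torus `T̂ = K^* × T`. -/
abbrev TorusHat (n : ℕ) : Type _ := Kˣ × Torus K n

variable {K}

/-- The character of `T` given by `χ ∈ M = ℤⁿ`. -/
def character (χ : Fin n → ℤ) (t : Torus K n) : Kˣ := ∏ i, t i ^ χ i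

/-- The character of `T̂` given by `μ ∈ M̂ = ℤ × M`. -/
def characterHat (μ : ℤ × (Fin n → ℤ)) (t : TorusHat K n) : Kˣ := t.1 ^ μ.1 * character μ.2 t.2

theorem character_mul (χ : Fin n → ℤ) (s t : Torus K n) :
    character χ (s * t) = character χ s * character χ t := by
  simp [character, mul_zpow, Finset.prod_mul_distrib]

variable (P : NormalLatticePolytope n)

/-- The linear action of `T̂` on `V = K^Λ`: `(c, t) e_χ = c χ(t) e_χ`. -/
def torusActVec (t : TorusHat K n) (v : P.Lam → K) : P.Lam → K :=
  fun χ => (t.1 : K) * (character χ.1 t.2 : K) * v χ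

/-- The orbit `O = {[∑_{χ ∈ Λ ∩ σ} χ(t) e_χ] | t ∈ T}`. -/
def orbit (K : Type*) [Field K] (P : NormalLatticePolytope n) (σ : Set (Fin n → ℝ)) :
    Set (ℙ K (P.Lam → K)) :=
  {p | ∃ (t : Torus K n)
    (h : Set.indicator {χ : P.Lam | toReal χ.1 ∈ σ} (fun χ => (character χ.1 t : K)) ≠ 0),
    p = Projectivization.mk K _ h}

/-- The `T`-orbit closure `X_σ` attached to a face `σ`. -/
def orbitClosure (K : Type*) [Field K] (P : NormalLatticePolytope n) (σ : P.Face) :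
    Set (ℙ K (P.Lam → K)) :=
  closure (orbit K P σ.1)

/-- The embedded toric variety `X_P ⊆ ℙ(V)`: the Zariski closure of the image of
`T → ℙ(V)`, `t ↦ [∑_{χ ∈ Λ} χ(t) e_χ]`. -/
def toricVariety (K : Type*) [Field K] (P : NormalLatticePolytope n) : Set (ℙ K (P.Lam → K)) :=
  closure {p | ∃ (t : Torus K n) (h : (fun χ : P.Lam => (character χ.1 t : K)) ≠ 0),
    p = Projectivization.mk K _ h}

/-- The pullback `F ↦ (x ↦ F(t⁻¹ x))` on polynomials. -/
def torusActPoly (t : TorusHat K n) : MvPolynomial P.Lam K →ₐ[K] MvPolynomial P.Lam K :=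
  MvPolynomial.aeval fun χ : P.Lam =>
    MvPolynomial.C ((t⁻¹.1 : K) * (character χ.1 t⁻¹.2 : K)) * MvPolynomial.X χ

theorem eval_torusActPoly (t : TorusHat K n) (F : MvPolynomial P.Lam K) (v : P.Lam → K) :
    MvPolynomial.eval v (torusActPoly P t F) = MvPolynomial.eval (torusActVec P t⁻¹ v) F := by
  have : (MvPolynomial.aeval v).comp (torusActPoly P t) =
      MvPolynomial.aeval (R := K) (torusActVec P t⁻¹ v) := by
    apply MvPolynomial.algHom_ext
    intro χ
    simp [torusActPoly, torusActVec]
  have h := DFunLike.congr_fun this F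
  simpa [MvPolynomial.aeval_eq_eval] using h

theorem torusActPoly_homogeneous (t : TorusHat K n) {F : MvPolynomial P.Lam K} {d : ℕ}
    (hF : F.IsHomogeneous d) : (torusActPoly P t F).IsHomogeneous d := by
  have h1 : ∀ χ : P.Lam, (MvPolynomial.C ((t⁻¹.1 : K) * (character χ.1 t⁻¹.2 : K)) *
      MvPolynomial.X χ : MvPolynomial P.Lam K).IsHomogeneous 1 := fun χ => by
    rw [show (1 : ℕ) = 0 + 1 from rfl]
    exact (MvPolynomial.isHomogeneous_C P.Lam _).mul (MvPolynomial.isHomogeneous_X K χ)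
  have h2 := MvPolynomial.IsHomogeneous.aeval hF _ h1
  rw [one_mul] at h2
  exact h2

theorem eval_rep_eq_zero_iff {ι : Type*} {F : MvPolynomial ι K} {d : ℕ} (hF : F.IsHomogeneous d)
    (v : ι → K) (hv : v ≠ 0) :
    MvPolynomial.eval (Projectivization.mk K v hv).rep F = 0 ↔ MvPolynomial.eval v F = 0 := by
  obtain ⟨a, ha⟩ := Projectivization.exists_smul_eq_mk_rep K v hv
  have h : MvPolynomial.eval (a • v) F = (a : K) ^ d * MvPolynomial.eval v F := by
    rw [MvPolynomial.eval_eq, MvPolynomial.eval_eq, Finset.mul_sum]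
    refine Finset.sum_congr rfl fun s hs => ?_
    have hd : s.degree = d := by
      have := hF (MvPolynomial.mem_support_iff.1 hs)
      rwa [Finsupp.degree_eq_weight_one]
    have : ∏ i ∈ s.support, (a : K) ^ s i = (a : K) ^ d := by
      rw [Finset.prod_pow_eq_pow_sum, ← hd]; rfl
    simp only [Pi.smul_apply, Units.smul_def, smul_eq_mul, mul_pow, Finset.prod_mul_distrib, this]
    ring
  rw [← ha, h]
  simp

/-- The affine cone over `X_P` is stable under `T̂`. -/
theorem torusActVec_mem (t : TorusHat K n) {v : P.Lam → K}
    (hv : v ∈ affineCone (toricVariety K P)) :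
    torusActVec P t v ∈ affineCone (toricVariety K P) := by
  intro h
  have hv0 : v ≠ 0 := by
    rintro rfl
    exact h (by ext χ; simp [torusActVec])
  obtain ⟨S, hS, hSO⟩ := isClosed_iff.1 (isClosed_closure (s := {p : ℙ K (P.Lam → K) |
    ∃ (t : Torus K n) (h : (fun χ : P.Lam => (character χ.1 t : K)) ≠ 0),
      p = Projectivization.mk K _ h}))
  have hvX := hv hv0
  rw [toricVariety] at hvX ⊢
  have hsub : closure {p : ℙ K (P.Lam → K) |
      ∃ (t : Torus K n) (h : (fun χ : P.Lam => (character χ.1 t : K)) ≠ 0),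
        p = Projectivization.mk K _ h} ⊆ projZeros ((torusActPoly P t⁻¹) '' S) := by
    refine closure_minimal ?_ (isClosed_iff.2 ⟨_, ?_, rfl⟩)
    · rintro _ ⟨s, hs, rfl⟩ _ ⟨F, hF, rfl⟩
      obtain ⟨d, hd⟩ := hS F hF
      rw [eval_rep_eq_zero_iff (torusActPoly_homogeneous P t⁻¹ hd), eval_torusActPoly, inv_inv]
      have hw : (fun χ : P.Lam => (character χ.1 (t.2 * s) : K)) ≠ 0 := by
        obtain ⟨χ, -⟩ := Function.ne_iff.1 hs
        exact Function.ne_iff.2 ⟨χ, Units.ne_zero _⟩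
      have heq : torusActVec P t (fun χ : P.Lam => (character χ.1 s : K)) =
          (t.1 : K) • (fun χ : P.Lam => (character χ.1 (t.2 * s) : K)) := by
        ext χ
        simp [torusActVec, character_mul, mul_assoc]
      have hne : torusActVec P t (fun χ : P.Lam => (character χ.1 s : K)) ≠ 0 := by
        rw [heq]
        exact smul_ne_zero (Units.ne_zero _) hw
      have hmem : Projectivization.mk K _ hw ∈ projZeros S := by
        rw [← hSO]
        exact subset_closure ⟨_, hw, rfl⟩
      have hmk : Projectivization.mk K _ hne = Projectivization.mk K _ hw :=
        (Projectivization.mk_eq_mk_iff' K _ _ _ _).2 ⟨(t.1 : K), heq.symm⟩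
      rw [← eval_rep_eq_zero_iff hd _ hne, hmk]
      exact hmem F hF
    · rintro _ ⟨F, hF, rfl⟩
      obtain ⟨d, hd⟩ := hS F hF
      exact ⟨d, torusActPoly_homogeneous P t⁻¹ hd⟩
  rw [hSO]
  intro F hF
  obtain ⟨d, hd⟩ := hS F hF
  have h1 := hsub hvX _ ⟨F, hF, rfl⟩
  rw [eval_rep_eq_zero_iff (torusActPoly_homogeneous P t⁻¹ hd), eval_torusActPoly, inv_inv] at h1
  rwa [eval_rep_eq_zero_iff hd]

/-- The action of `T̂` on the coordinate ring of the cone: `(t f)(x) = f(t⁻¹ x)`. -/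
def torusAct (t : TorusHat K n) :
    CoordRing (toricVariety K P) →ₐ[K] CoordRing (toricVariety K P) :=
  Ideal.quotientMapₐ _ (torusActPoly P t) fun F hF v hv => by
    have := hF _ (torusActVec_mem P t⁻¹ hv)
    rw [MvPolynomial.aeval_eq_eval] at this ⊢
    simpa [eval_torusActPoly] using this

variable {P}

/-- `f ∈ K[X̂_P]` is a (nonzero) `T̂`-eigenfunction of weight `μ ∈ M̂ = ℤ × M`. -/
def IsHatEigenfunction (f : CoordRing (toricVariety K P)) (μ : ℤ × (Fin n → ℤ)) : Prop :=
  f ≠ 0 ∧ ∀ t : TorusHat K n, torusAct P t f = (characterHat μ t : K) • f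

/-- `f ∈ K[X̂_P]` is a (nonzero) `T`-eigenfunction. -/
def IsEigenfunction (f : CoordRing (toricVariety K P)) : Prop :=
  f ≠ 0 ∧ ∃ η : Fin n → ℤ, ∀ t : Torus K n,
    torusAct P ((1 : Kˣ), t) f = (character η t : K) • f

/-- The point `-μ / m` of `ℝ × M_ℝ`. -/
def normalizedWeight (μ : ℤ × (Fin n → ℤ)) (m : ℕ) : ℝ × (Fin n → ℝ) :=
  (-(1 / (m : ℝ))) • ((μ.1 : ℝ), toReal μ.2)

/-- A `T`-equivariant Seshadri stratification on `X_P`: a Seshadri stratification whose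
subvarieties are the `T`-orbit closures and whose functions are `T`-eigenfunctions. -/
structure IsEquivariantSeshadriStratification (Y : P.Face → Set (ℙ K (P.Lam → K)))
    (f : P.Face → CoordRing (toricVariety K P)) : Prop where
  seshadri : IsSeshadriStratification (toricVariety K P) Y f
  orbit_closure : ∀ σ, Y σ = orbitClosure K P σ
  eigenfunction : ∀ σ, IsEigenfunction (f σ)

/-- A combinatorial Seshadri stratification on `X_P`: the subvarieties are the `T`-orbit closures,
the functions are `T̂`-eigenfunctions of positive degree, and minus the weight divided by the
degree lies in the relative interior of the corresponding face. -/
structure IsCombinatorialSeshadriStratification (Y : P.Face → Set (ℙ K (P.Lam → K)))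
    (f : P.Face → CoordRing (toricVariety K P)) : Prop where
  orbit_closure : ∀ σ, Y σ = orbitClosure K P σ
  weight : ∀ σ, ∃ (μ : ℤ × (Fin n → ℤ)) (m : ℕ), IsHatEigenfunction (f σ) μ ∧
    1 ≤ m ∧ IsHomogeneousOfDegree (f σ) m ∧
    normalizedWeight μ m ∈ intrinsicInterior ℝ (liftFace σ.1)

end Toric

end ToricSeshadri

end

noncomputable section

namespace ToricSeshadri

/-! ### Farkas' lemma -/

/-! The coordinate ring of the cone over `X_P` embeds into the group algebra of `ℤ × ℤⁿ` by sending
the coordinate `x_χ` to the Laurent monomial of weight `(1, χ)`. Each weight space is therefore at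
most a line, and a homogeneous eigenfunction is a monomial `c x^a` with `∑ a_χ (1, χ) = -μ`
(`IsHatEigenfunction.exists_eq_monFun`). Hence `-μ / deg f` is `(1, center a)`, where `center a` is
the mean of the lattice points weighted by `a`.

The points of `X_σ` are those of the orbits of the faces `τ ≤ σ` (`IsToric.exists_eq_toricPoint`).
On the orbit of `τ` exactly the coordinates in `τ` are nonzero, so `x^a` is nowhere zero there if
`a` is supported on `τ`, that is if `center a ∈ τ` (`center_mem_iff`), and identically zero
otherwise. Condition (S3) at `σ` thus says that `σ` is the only face `τ ≤ σ` containing `center (a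
σ)`, which means that this point is in the relative interior of `σ`. Conversely, a face containing a
relative interior point of `σ` contains `σ`, and this gives (S2) and (S3).

What remains is (S1), a property of the orbit closures alone. For the dimension, chains of
irreducible closed sets become chains of primes that stop short of the irrelevant ideal, and Noether
normalization bounds their length by the rank of the lattice spanned by the `(1, χ)`, `χ ∈ σ`;
chains of faces attain the bound, since the rank grows by one at each cover (`rank_covBy`). For
smoothness, the tangent space of the cone at the orbits of `σ` and of its facets is computed with
logarithmic derivatives. At a facet `τ` the decisive fact is `exists_height`: modulo the lattice of
`τ`, every lattice point of `σ` is a natural multiple of a single one. Normality enters through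
`exists_wt_eq`. The convex geometry is made algebraic by describing cones and relative interiors
through linear forms, with Farkas' lemma as the engine. -/

theorem exists_nonneg_combination_of_forall_nonpos {W : Type*} [AddCommGroup W] [Module ℝ W] :
    ∀ (m : ℕ) (a : Fin m → W →ₗ[ℝ] ℝ) (b : W →ₗ[ℝ] ℝ),
      (∀ x, (∀ i, a i x ≤ 0) → b x ≤ 0) →
        ∃ c : Fin m → ℝ, (∀ i, 0 ≤ c i) ∧ b = ∑ i, c i • a i
  | 0, a, b, h => by
    refine ⟨fun _ => 0, fun _ => le_rfl, ?_⟩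
    ext x
    have h1 := h x (fun i => i.elim0)
    have h2 := h (-x) (fun i => i.elim0)
    simp only [map_neg] at h2
    simp only [Finset.univ_eq_empty, Finset.sum_empty, LinearMap.zero_apply]
    linarith
  | m + 1, a, b, h => by
    -- Either the inequality for `a 0` is redundant and can be dropped, or some `x` violates the
    -- conclusion without it; then necessarily `0 < a 0 x`.
    by_cases hb : ∀ x, (∀ i : Fin m, a i.succ x ≤ 0) → b x ≤ 0
    · obtain ⟨c, hc, hbc⟩ :=
        exists_nonneg_combination_of_forall_nonpos m (fun i => a i.succ) b hb
      refine ⟨Fin.cons 0 c, fun i => Fin.cases le_rfl hc i, ?_⟩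
      simp [Fin.sum_univ_succ, hbc]
    · push Not at hb
      obtain ⟨x, hx, hbx⟩ := hb
      have ha0 : 0 < a 0 x := by
        by_contra hcon
        exact absurd (h x (fun i => Fin.cases (not_lt.1 hcon) hx i)) (not_le.2 hbx)
      set s := (a 0 x)⁻¹ with hs
      have hs0 : 0 < s := inv_pos.2 ha0
      have hsa : s * a 0 x = 1 := inv_mul_cancel₀ ha0.ne'
      -- Induction for the forms precomposed with the projection `y ↦ y - (s * a 0 y) • x` onto the
      -- kernel of `a 0` along `x`.
      obtain ⟨c, hc, hbc⟩ := exists_nonneg_combination_of_forall_nonpos m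
        (fun i => a i.succ - (s * a i.succ x) • a 0) (b - (s * b x) • a 0) (by
          intro y hy
          have h1 := h (y - (s * a 0 y) • x) (fun i => by
            refine Fin.cases ?_ (fun i => ?_) i
            · simp only [map_sub, map_smul, smul_eq_mul]
              rw [mul_right_comm, hsa, one_mul, sub_self]
            · have := hy i
              simp only [LinearMap.sub_apply, LinearMap.smul_apply, smul_eq_mul, map_sub,
                map_smul] at this ⊢
              linarith)
          simp only [LinearMap.sub_apply, LinearMap.smul_apply, smul_eq_mul, map_sub,
            map_smul] at h1 ⊢
          linarith)
      -- The coefficient of `a 0` collects the projection terms; it is nonnegative because `b x > 0`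
      -- while the other forms are nonpositive at `x`.
      refine ⟨Fin.cons (s * b x - ∑ i, c i * (s * a i.succ x)) c, fun i => ?_, ?_⟩
      · refine Fin.cases ?_ hc i
        simp only [Fin.cons_zero]
        have h1 : ∑ i, c i * (s * a i.succ x) ≤ 0 := Finset.sum_nonpos fun i _ =>
          mul_nonpos_of_nonneg_of_nonpos (hc i)
            (mul_nonpos_of_nonneg_of_nonpos hs0.le (hx i))
        have h2 : 0 < s * b x := mul_pos hs0 hbx
        linarith
      · rw [Fin.sum_univ_succ]
        simp only [Fin.cons_zero, Fin.cons_succ]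
        have h1 : b = (s * b x) • a 0 + ∑ i, c i • (a i.succ - (s * a i.succ x) • a 0) := by
          rw [← hbc]; abel
        conv_lhs => rw [h1]
        simp only [smul_sub, Finset.sum_sub_distrib, smul_smul, ← Finset.sum_smul]
        refine LinearMap.ext fun y => ?_
        simp only [LinearMap.add_apply, LinearMap.sub_apply, LinearMap.smul_apply, smul_eq_mul]
        ring

/-- **Farkas' lemma** for finitely generated cones. -/
theorem farkas {ι E : Type*} [Fintype ι] [AddCommGroup E] [Module ℝ E] (v : ι → E) (y : E)
    (h : ∀ l : E →ₗ[ℝ] ℝ, (∀ i, 0 ≤ l (v i)) → 0 ≤ l y) :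
    ∃ c : ι → ℝ, (∀ i, 0 ≤ c i) ∧ y = ∑ i, c i • v i := by
  let e := Fintype.equivFin ι
  -- The dual version is applied on the dual space, with vectors viewed as functionals; the result
  -- descends since a space embeds in its bidual.
  obtain ⟨c, hc, hy⟩ := exists_nonneg_combination_of_forall_nonpos (Fintype.card ι)
    (fun i => Module.Dual.eval ℝ E (v (e.symm i))) (Module.Dual.eval ℝ E y) (by
      intro l hl
      have := h (-l) (fun i => by simpa using hl (e i))
      simpa using this)
  refine ⟨fun i => c (e i), fun i => hc _, ?_⟩
  apply Module.eval_apply_injective (K := ℝ) (V := E)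
  rw [hy, map_sum, ← e.sum_comp]
  simp

/-! ### Faces of a lattice polytope and cones over them -/

variable {n : ℕ}

/-- The inclusion `ℤ × ℤⁿ → ℝ × ℝⁿ`. -/
def toRealHat : (ℤ × (Fin n → ℤ)) →+ ℝ × (Fin n → ℝ) where
  toFun w := ((w.1 : ℝ), toReal w.2)
  map_zero' := by ext <;> simp [toReal]
  map_add' a b := by ext <;> simp [toReal]

theorem toRealHat_injective : Function.Injective (toRealHat (n := n)) := by
  rintro ⟨a, x⟩ ⟨b, y⟩ h
  have h1 := congrArg Prod.fst h
  have h2 := congrArg Prod.snd h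
  simp only [toRealHat, AddMonoidHom.coe_mk, ZeroHom.coe_mk, Int.cast_inj] at h1 h2
  refine Prod.ext h1 (funext fun i => ?_)
  have := congrFun h2 i
  simpa [toReal] using this

namespace NormalLatticePolytope

variable (P : NormalLatticePolytope n)

/-- The lattice point `(1, χ)`. -/
def hat (χ : P.Lam) : ℤ × (Fin n → ℤ) := (1, χ.1)

/-- The real point `(1, χ)`. -/
def hatR (χ : P.Lam) : ℝ × (Fin n → ℝ) := (1, toReal χ.1)

variable {P}

theorem toRealHat_hat (χ : P.Lam) : toRealHat (P.hat χ) = P.hatR χ := by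
  simp [toRealHat, hat, hatR]

/-- The lattice points of a face. -/
def latticePoints (σ : P.Face) : Set P.Lam := {χ | toReal χ.1 ∈ σ.1}

/-- The cone over a face. -/
def InCone (σ : P.Face) (y : ℝ × (Fin n → ℝ)) : Prop :=
  ∃ w : P.Lam → ℝ, (∀ χ, 0 ≤ w χ) ∧ (∀ χ, χ ∉ latticePoints σ → w χ = 0) ∧
    y = ∑ χ, w χ • P.hatR χ

theorem InCone.add {σ : P.Face} {y z : ℝ × (Fin n → ℝ)} (hy : InCone σ y) (hz : InCone σ z) :
    InCone σ (y + z) := by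
  obtain ⟨w, h1, h2, rfl⟩ := hy
  obtain ⟨w', h1', h2', rfl⟩ := hz
  refine ⟨w + w', fun χ => add_nonneg (h1 χ) (h1' χ), fun χ hχ => ?_, ?_⟩
  · simp [h2 χ hχ, h2' χ hχ]
  · simp [add_smul, Finset.sum_add_distrib]

theorem InCone.smul {σ : P.Face} {y : ℝ × (Fin n → ℝ)} (hy : InCone σ y) {c : ℝ} (hc : 0 ≤ c) :
    InCone σ (c • y) := by
  obtain ⟨w, h1, h2, rfl⟩ := hy
  refine ⟨c • w, fun χ => mul_nonneg hc (h1 χ), fun χ hχ => ?_, ?_⟩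
  · simp [h2 χ hχ]
  · simp [Finset.smul_sum, smul_smul]

theorem inCone_hatR {σ : P.Face} {χ : P.Lam} (hχ : χ ∈ latticePoints σ) :
    InCone σ (P.hatR χ) := by
  classical
  refine ⟨Pi.single χ 1, fun ψ => ?_, fun ψ hψ => ?_, ?_⟩
  · by_cases h : ψ = χ
    · subst h; simp
    · simp [h]
  · have : ψ ≠ χ := by rintro rfl; exact hψ hχ
    simp [this]
  · rw [Finset.sum_eq_single χ] <;> simp +contextual

theorem InCone.nonneg {σ : P.Face} {y : ℝ × (Fin n → ℝ)} (hy : InCone σ y)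
    {l : ℝ × (Fin n → ℝ) →ₗ[ℝ] ℝ} (hl : ∀ χ ∈ latticePoints σ, 0 ≤ l (P.hatR χ)) : 0 ≤ l y := by
  obtain ⟨w, h1, h2, rfl⟩ := hy
  rw [map_sum]
  refine Finset.sum_nonneg fun χ _ => ?_
  rw [map_smul]
  by_cases h : χ ∈ latticePoints σ
  · exact mul_nonneg (h1 χ) (hl χ h)
  · simp [h2 χ h]

theorem InCone.map_eq_zero {σ : P.Face} {y : ℝ × (Fin n → ℝ)} (hy : InCone σ y)
    {l : ℝ × (Fin n → ℝ) →ₗ[ℝ] ℝ} (hl : ∀ χ ∈ latticePoints σ, l (P.hatR χ) = 0) : l y = 0 := by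
  have h1 := hy.nonneg (l := l) fun χ hχ => (hl χ hχ).ge
  have h2 := hy.nonneg (l := -l) fun χ hχ => by simp [hl χ hχ]
  simp only [LinearMap.neg_apply] at h2
  linarith

theorem convex_carrier : Convex ℝ P.carrier := convex_convexHull ℝ _

/-- The first coordinate `1` records that the weights sum to one, so convex combinations in `P`
become conic combinations of the points `(1, χ)`. -/
theorem exists_weights {x : Fin n → ℝ} (hx : x ∈ P.carrier) :
    ∃ w : P.Lam → ℝ, (∀ χ, 0 ≤ w χ) ∧ ((1 : ℝ), x) = ∑ χ, w χ • P.hatR χ := by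
  classical
  have hconv : Convex ℝ {x : Fin n → ℝ | ∃ w : P.Lam → ℝ, (∀ χ, 0 ≤ w χ) ∧
      ((1 : ℝ), x) = ∑ χ, w χ • P.hatR χ} := by
    rintro x ⟨w, hw, hx⟩ y ⟨w', hw', hy⟩ a b ha hb hab
    refine ⟨a • w + b • w', fun χ => add_nonneg (mul_nonneg ha (hw χ)) (mul_nonneg hb (hw' χ)), ?_⟩
    have h : ((1 : ℝ), a • x + b • y) = a • ((1 : ℝ), x) + b • ((1 : ℝ), y) := by
      ext1 <;> simp [hab]
    rw [h, hx, hy]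
    simp [Finset.smul_sum, smul_smul, add_smul, Finset.sum_add_distrib]
  refine convexHull_min ?_ hconv hx
  rintro _ ⟨χ, hχ, rfl⟩
  let ψ : P.Lam := ⟨χ, subset_convexHull ℝ _ ⟨χ, hχ, rfl⟩⟩
  refine ⟨Pi.single ψ 1, fun η => ?_, ?_⟩
  · by_cases h : η = ψ
    · subst h; simp
    · simp [h]
  · rw [Finset.sum_eq_single ψ] <;> simp +contextual [hatR, ψ]

theorem mem_carrier_of_weights {x : Fin n → ℝ} {w : P.Lam → ℝ} (hw : ∀ χ, 0 ≤ w χ)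
    (h : ((1 : ℝ), x) = ∑ χ, w χ • P.hatR χ) : x ∈ P.carrier := by
  have h1 := congrArg Prod.fst h
  have h2 := congrArg Prod.snd h
  simp only [Prod.fst_sum, Prod.snd_sum, hatR, Prod.smul_fst, Prod.smul_snd, smul_eq_mul,
    mul_one] at h1 h2
  rw [h2]
  exact convex_carrier.sum_mem (fun χ _ => hw χ) h1.symm (fun χ _ => χ.2)

theorem face_subset (σ : P.Face) : σ.1 ⊆ P.carrier := σ.2.2.subset

/-- A face is cut out by a linear form on `ℝ × ℝⁿ` that is nonnegative on the polytope. -/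
theorem exists_form (σ : P.Face) : ∃ L : ℝ × (Fin n → ℝ) →ₗ[ℝ] ℝ,
    (∀ x ∈ P.carrier, 0 ≤ L (1, x)) ∧ ∀ x ∈ P.carrier, L (1, x) = 0 ↔ x ∈ σ.1 := by
  obtain ⟨l, hl⟩ := σ.2.2 σ.2.1
  obtain ⟨x0, hx0⟩ := σ.2.1
  have hx0' : x0 ∈ {x ∈ P.carrier | ∀ y ∈ P.carrier, l y ≤ l x} := hl ▸ hx0
  -- `L (s, x) = s * max l - l x`, where the exposing functional `l` attains its maximum at `x0`.
  refine ⟨l x0 • LinearMap.fst ℝ ℝ _ - l.toLinearMap ∘ₗ LinearMap.snd ℝ ℝ _, ?_, ?_⟩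
  · intro x hx
    have := hx0'.2 x hx
    simpa using this
  · intro x hx
    simp only [LinearMap.sub_apply, LinearMap.smul_apply, LinearMap.fst_apply, smul_eq_mul,
      mul_one, LinearMap.comp_apply, LinearMap.snd_apply, ContinuousLinearMap.coe_coe, sub_eq_zero]
    constructor
    · intro h
      rw [hl]
      exact ⟨hx, fun y hy => h ▸ hx0'.2 y hy⟩
    · intro h
      rw [hl] at h
      exact le_antisymm (h.2 _ hx0'.1) (hx0'.2 x hx)

theorem exists_face_of_form {L : ℝ × (Fin n → ℝ) →ₗ[ℝ] ℝ} (hL : ∀ x ∈ P.carrier, 0 ≤ L (1, x))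
    {x0 : Fin n → ℝ} (hx0 : x0 ∈ P.carrier) (h0 : L (1, x0) = 0) :
    ∃ τ : P.Face, ∀ x, x ∈ τ.1 ↔ x ∈ P.carrier ∧ L (1, x) = 0 := by
  refine ⟨⟨{x | x ∈ P.carrier ∧ L (1, x) = 0}, ⟨x0, hx0, h0⟩, fun _ => ?_⟩, fun x => Iff.rfl⟩
  let l : (Fin n → ℝ) →ₗ[ℝ] ℝ := -(L ∘ₗ LinearMap.inr ℝ ℝ _)
  refine ⟨LinearMap.toContinuousLinearMap l, ?_⟩
  have key : ∀ x, L (1, x) = L (1, 0) - l x := by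
    intro x
    have : ((1 : ℝ), x) = (1, 0) + (0, x) := by simp
    rw [this, map_add]
    simp [l]
  ext x
  simp only [Set.mem_ofPred_eq, LinearMap.coe_toContinuousLinearMap']
  refine and_congr_right fun hx => ?_
  constructor
  · intro h y hy
    have := hL y hy
    rw [key] at this h
    linarith
  · intro h
    have h1 := h x0 hx0
    have h2 := hL x hx
    rw [key] at h0 h2 ⊢
    linarith

/-- If a form that is nonnegative on `P` vanishes at a convex combination, it vanishes at every term
of positive weight. Faces are thereby determined by their lattice points, and arguments about them
become finite. -/
theorem mem_face_iff (σ : P.Face) (x : Fin n → ℝ) : x ∈ σ.1 ↔ InCone σ (1, x) := by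
  obtain ⟨L, hL, hL0⟩ := exists_form σ
  constructor
  · intro hx
    obtain ⟨w, hw, hwx⟩ := exists_weights (face_subset σ hx)
    refine ⟨w, hw, fun χ hχ => ?_, hwx⟩
    have h0 := (hL0 x (face_subset σ hx)).2 hx
    rw [hwx, map_sum, Finset.sum_eq_zero_iff_of_nonneg (fun χ _ => by
      rw [map_smul]; exact mul_nonneg (hw χ) (hL _ χ.2))] at h0
    have := h0 χ (Finset.mem_univ _)
    rw [map_smul, smul_eq_mul, mul_eq_zero] at this
    rcases this with h | h
    · exact h
    · exact absurd ((hL0 _ χ.2).1 h) hχ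
  · intro hx
    obtain ⟨w, hw, -, hwx⟩ := id hx
    have hxP := mem_carrier_of_weights hw hwx
    exact (hL0 x hxP).1 (hx.map_eq_zero fun χ hχ => (hL0 _ χ.2).2 hχ)

theorem latticePoints_nonempty (σ : P.Face) : (latticePoints σ).Nonempty := by
  obtain ⟨x, hx⟩ := σ.2.1
  obtain ⟨w, -, h2, h3⟩ := (mem_face_iff σ x).1 hx
  by_contra hcon
  rw [Set.not_nonempty_iff_eq_empty] at hcon
  have := congrArg Prod.fst h3
  simp [h2, hcon] at this

theorem le_iff_latticePoints_subset {τ σ : P.Face} :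
    τ ≤ σ ↔ latticePoints τ ⊆ latticePoints σ := by
  constructor
  · intro h χ hχ
    exact h hχ
  · intro h x hx
    obtain ⟨w, h1, h2, h3⟩ := (mem_face_iff τ x).1 hx
    exact (mem_face_iff σ x).2 ⟨w, h1, fun χ hχ => h2 χ fun h' => hχ (h h'), h3⟩

theorem latticePoints_injective : Function.Injective (latticePoints (P := P)) := fun _ _ h =>
  le_antisymm (le_iff_latticePoints_subset.2 h.subset) (le_iff_latticePoints_subset.2 h.superset)

instance : Finite P.Face := Finite.of_injective _ latticePoints_injective

theorem carrier_nonempty : P.carrier.Nonempty := by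
  by_contra hcon
  rw [Set.not_nonempty_iff_eq_empty] at hcon
  have h : affineSpan ℝ P.carrier = ⊤ := P.fullDim
  rw [hcon, AffineSubspace.span_empty] at h
  exact AffineSubspace.bot_ne_top ℝ (Fin n → ℝ) (Fin n → ℝ) h

/-- The polytope as a face of itself. -/
def topFace (P : NormalLatticePolytope n) : P.Face :=
  ⟨P.carrier, carrier_nonempty, IsExposed.refl _⟩

theorem le_topFace (σ : P.Face) : σ ≤ P.topFace := face_subset σ

theorem latticePoints_topFace : latticePoints P.topFace = Set.univ :=
  Set.eq_univ_of_forall fun χ => χ.2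

/-- A linear form that is nonnegative on a face cuts out a smaller face. -/
theorem exists_subface (σ : P.Face) {l : ℝ × (Fin n → ℝ) →ₗ[ℝ] ℝ}
    (hl : ∀ χ ∈ latticePoints σ, 0 ≤ l (P.hatR χ)) {x0 : Fin n → ℝ} (hx0 : x0 ∈ σ.1)
    (h0 : l (1, x0) = 0) : ∃ τ : P.Face, τ ≤ σ ∧ ∀ x, x ∈ τ.1 ↔ x ∈ σ.1 ∧ l (1, x) = 0 := by
  classical
  obtain ⟨L, hL, hL0⟩ := exists_form σ
  have hpos : ∀ χ : P.Lam, χ ∉ latticePoints σ → 0 < L (P.hatR χ) := fun χ hχ =>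
    lt_of_le_of_ne (hL _ χ.2) fun h => hχ ((hL0 _ χ.2).1 h.symm)
  -- A large multiple of the form exposing `σ` makes `N • L + l` positive at the lattice points
  -- outside `σ` and leaves `l` unchanged on `σ`: a face of a face is a face of `P`.
  obtain ⟨N, hN⟩ : ∃ N : ℝ, ∀ χ : P.Lam, χ ∉ latticePoints σ →
      0 < N * L (P.hatR χ) + l (P.hatR χ) := by
    obtain ⟨N, hN⟩ := (Set.finite_range fun χ : P.Lam =>
      -l (P.hatR χ) / L (P.hatR χ)).bddAbove
    refine ⟨N + 1, fun χ hχ => ?_⟩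
    have h1 : -l (P.hatR χ) / L (P.hatR χ) ≤ N := hN ⟨χ, rfl⟩
    rw [div_le_iff₀ (hpos χ hχ)] at h1
    have := hpos χ hχ
    nlinarith
  have hlat : ∀ χ : P.Lam, 0 ≤ (N • L + l) (P.hatR χ) := by
    intro χ
    by_cases hχ : χ ∈ latticePoints σ
    · have : L (P.hatR χ) = 0 := (hL0 _ χ.2).2 hχ
      simpa [this] using hl χ hχ
    · simpa using (hN χ hχ).le
  have hall : ∀ x ∈ P.carrier, 0 ≤ (N • L + l) (1, x) := by
    intro x hx
    obtain ⟨w, hw, hwx⟩ := exists_weights hx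
    rw [hwx, map_sum]
    refine Finset.sum_nonneg fun χ _ => ?_
    rw [map_smul]
    exact mul_nonneg (hw χ) (hlat χ)
  obtain ⟨τ, hτ⟩ := exists_face_of_form hall (face_subset σ hx0) (by
    simp [(hL0 x0 (face_subset σ hx0)).2 hx0, h0])
  have key : ∀ x, x ∈ τ.1 ↔ x ∈ σ.1 ∧ l (1, x) = 0 := by
    intro x
    rw [hτ]
    constructor
    · rintro ⟨hx, h⟩
      obtain ⟨w, hw, hwx⟩ := exists_weights hx
      have hxσ : x ∈ σ.1 := by
        rw [mem_face_iff]
        refine ⟨w, hw, fun χ hχ => ?_, hwx⟩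
        have h' := h
        rw [hwx, map_sum, Finset.sum_eq_zero_iff_of_nonneg (fun χ _ => by
          rw [map_smul]; exact mul_nonneg (hw χ) (hlat χ))] at h'
        have := h' χ (Finset.mem_univ _)
        rw [map_smul, smul_eq_mul, mul_eq_zero] at this
        rcases this with h | h
        · exact h
        · exact absurd h (by simpa using (hN χ hχ).ne')
      refine ⟨hxσ, ?_⟩
      simpa [(hL0 x hx).2 hxσ] using h
    · rintro ⟨hx, h⟩
      exact ⟨face_subset σ hx, by simp [(hL0 x (face_subset σ hx)).2 hx, h]⟩
  exact ⟨τ, fun x hx => ((key x).1 hx).1, key⟩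

/-- `y` lies in the relative interior of the cone over `σ`. -/
def InInterior (σ : P.Face) (y : ℝ × (Fin n → ℝ)) : Prop :=
  InCone σ y ∧ ∀ l : ℝ × (Fin n → ℝ) →ₗ[ℝ] ℝ, (∀ χ ∈ latticePoints σ, 0 ≤ l (P.hatR χ)) →
    l y = 0 → ∀ χ ∈ latticePoints σ, l (P.hatR χ) = 0

theorem inInterior_of_forall_face {σ : P.Face} {x : Fin n → ℝ} (hx : x ∈ σ.1)
    (h : ∀ τ : P.Face, τ ≤ σ → x ∈ τ.1 → τ = σ) : InInterior σ (1, x) := by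
  refine ⟨(mem_face_iff σ x).1 hx, fun l hl h0 χ hχ => ?_⟩
  obtain ⟨τ, hτσ, hτ⟩ := exists_subface σ hl hx h0
  have := h τ hτσ ((hτ x).2 ⟨hx, h0⟩)
  subst this
  exact ((hτ _).1 hχ).2

/-- The form exposing `τ` is nonnegative on `σ` and vanishes at an interior point of `σ`, hence on
all of `σ`. -/
theorem InInterior.le_of_mem {σ : P.Face} {x : Fin n → ℝ} (hx : InInterior σ (1, x))
    {τ : P.Face} (h : x ∈ τ.1) : σ ≤ τ := by
  obtain ⟨L, hL, hL0⟩ := exists_form τ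
  rw [le_iff_latticePoints_subset]
  intro χ hχ
  exact (hL0 _ χ.2).1 (hx.2 L (fun ψ _ => hL _ ψ.2) ((hL0 x (face_subset τ h)).2 h) χ hχ)

theorem exists_inInterior {x : Fin n → ℝ} (hx : x ∈ P.carrier) :
    ∃ σ : P.Face, InInterior σ (1, x) := by
  obtain ⟨σ, hσ⟩ := Set.Finite.exists_minimal (Set.toFinite {σ : P.Face | x ∈ σ.1})
    ⟨P.topFace, hx⟩
  exact ⟨σ, inInterior_of_forall_face hσ.1 fun τ hτσ hxτ => le_antisymm hτσ (hσ.2 hxτ hτσ)⟩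

/-- A form of Farkas' lemma relative to a face. -/
theorem exists_inCone_add_smul {σ : P.Face} {y z : ℝ × (Fin n → ℝ)}
    (h : ∀ l : ℝ × (Fin n → ℝ) →ₗ[ℝ] ℝ, (∀ χ ∈ latticePoints σ, 0 ≤ l (P.hatR χ)) →
      l y ≤ 0 → 0 ≤ l z) : ∃ c : ℝ, 0 ≤ c ∧ InCone σ (z + c • y) := by
  classical
  -- Farkas for the generators of the cone over `σ` together with `-y`; the coefficient of `-y`
  -- moved to the other side is the required `c`.
  obtain ⟨c, hc, hz⟩ := farkas (ι := Option (latticePoints σ))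
    (fun i => i.elim (-y) fun χ => P.hatR χ.1) z (fun l hl => h l
      (fun χ hχ => hl (some ⟨χ, hχ⟩)) (by simpa using hl none))
  refine ⟨c none, hc none, fun χ => if h : χ ∈ latticePoints σ then c (some ⟨χ, h⟩) else 0,
    fun χ => ?_, fun χ hχ => dif_neg hχ, ?_⟩
  · dsimp only
    split_ifs
    exacts [hc _, le_rfl]
  · rw [hz, Fintype.sum_option]
    simp only [Option.elim_none, Option.elim_some, smul_neg]
    rw [neg_add_cancel_comm]
    refine Fintype.sum_of_injective (Subtype.val : latticePoints σ → P.Lam)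
      Subtype.val_injective _ _ (fun χ hχ => ?_) (fun χ => ?_)
    · rw [dif_neg (by simpa using hχ), zero_smul]
    · rw [dif_pos χ.2]

/-- A form that is nonnegative on `σ` and nonpositive at the interior point `y` vanishes on the
whole cone, in particular at `z`, so the Farkas condition is met: a large multiple of `y` dominates
any point of the cone. -/
theorem InInterior.exists_smul_sub {σ : P.Face} {y z : ℝ × (Fin n → ℝ)} (hy : InInterior σ y)
    (hz : InCone σ z) : ∃ c : ℝ, 0 ≤ c ∧ InCone σ (c • y - z) := by
  obtain ⟨c, hc, h⟩ := exists_inCone_add_smul (σ := σ) (y := y) (z := -z) (by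
    intro l hl hly
    have h0 : l y = 0 := le_antisymm hly (hy.1.nonneg hl)
    rw [map_neg, hz.map_eq_zero (hy.2 l hl h0), neg_zero])
  exact ⟨c, hc, by rwa [neg_add_eq_sub] at h⟩

end NormalLatticePolytope

/-! ### Intrinsic interiors of convex sets -/

/-- The segment from `z` to `y` can be prolonged a little beyond `y`, because the line through both
stays in the affine span. -/
theorem exists_pos_add_smul_sub_mem {E : Type*} [NormedAddCommGroup E] [NormedSpace ℝ E]
    {A : Set E} {y z : E} (hy : y ∈ intrinsicInterior ℝ A) (hz : z ∈ A) :
    ∃ ε : ℝ, 0 < ε ∧ y + ε • (y - z) ∈ A := by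
  obtain ⟨y', hy', rfl⟩ := mem_intrinsicInterior.1 hy
  let g : ℝ → affineSpan ℝ A := fun ε =>
    ⟨AffineMap.lineMap z (y' : E) (1 + ε),
      AffineMap.lineMap_mem _ (subset_affineSpan ℝ A hz) y'.2⟩
  have hg : Continuous g := Continuous.subtype_mk (by fun_prop) _
  have hg0 : g 0 = y' := by ext; simp [g]
  have hnhds : g ⁻¹' interior ((↑) ⁻¹' A : Set (affineSpan ℝ A)) ∈ nhds (0 : ℝ) :=
    (isOpen_interior.preimage hg).mem_nhds (by simpa [hg0] using hy')
  obtain ⟨δ, hδ, hball⟩ := Metric.mem_nhds_iff.1 hnhds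
  refine ⟨δ / 2, half_pos hδ, ?_⟩
  have h1 : δ / 2 ∈ Metric.ball (0 : ℝ) δ := by
    rw [Metric.mem_ball, dist_zero_right, Real.norm_eq_abs, abs_of_pos (half_pos hδ)]
    exact half_lt_self hδ
  have h2 : ((g (δ / 2) : affineSpan ℝ A) : E) ∈ A :=
    interior_subset (s := ((↑) ⁻¹' A : Set (affineSpan ℝ A))) (hball h1)
  convert h2 using 1
  simp only [g, AffineMap.lineMap_apply, vsub_eq_sub, vadd_eq_add]
  module

/-- The homothety with centre `z` and ratio `t⁻¹` is a continuous self-map of the affine span. The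
preimage of the relative interior under it is open, contained in `A` by convexity, and contains the
point in question. -/
theorem lineMap_mem_intrinsicInterior {E : Type*} [NormedAddCommGroup E] [NormedSpace ℝ E]
    {A : Set E} (hA : Convex ℝ A) {x z : E} (hx : x ∈ intrinsicInterior ℝ A) (hz : z ∈ A) {t : ℝ}
    (ht0 : 0 < t) (ht1 : t ≤ 1) : AffineMap.lineMap z x t ∈ intrinsicInterior ℝ A := by
  obtain ⟨x', hx', rfl⟩ := mem_intrinsicInterior.1 hx
  have hzA := subset_affineSpan ℝ A hz
  let g : affineSpan ℝ A → affineSpan ℝ A := fun y =>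
    ⟨AffineMap.lineMap z (y : E) t⁻¹, AffineMap.lineMap_mem _ hzA y.2⟩
  have hg : Continuous g := Continuous.subtype_mk (by
    simp only [AffineMap.lineMap_apply, vsub_eq_sub, vadd_eq_add]; fun_prop) _
  let u : affineSpan ℝ A := ⟨AffineMap.lineMap z (x' : E) t, AffineMap.lineMap_mem _ hzA x'.2⟩
  have hgu : g u = x' := by
    ext
    simp only [g, u, AffineMap.lineMap_apply, vsub_eq_sub, vadd_eq_add, add_sub_cancel_right,
      smul_smul, inv_mul_cancel₀ ht0.ne', one_smul, sub_add_cancel]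
  refine mem_intrinsicInterior.2 ⟨u, ?_, rfl⟩
  refine mem_interior.2 ⟨g ⁻¹' interior ((↑) ⁻¹' A), ?_, isOpen_interior.preimage hg, by
    simpa [hgu] using hx'⟩
  intro y hy
  have h1 : ((g y : affineSpan ℝ A) : E) ∈ A :=
    interior_subset (s := ((↑) ⁻¹' A : Set (affineSpan ℝ A))) hy
  have h2 : (y : E) = AffineMap.lineMap z (g y : E) t := by
    simp only [g, AffineMap.lineMap_apply, vsub_eq_sub, vadd_eq_add, add_sub_cancel_right,
      smul_smul, mul_inv_cancel₀ ht0.ne', one_smul, sub_add_cancel]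
  change (y : E) ∈ A
  rw [h2]
  exact hA.lineMap_mem hz h1 ⟨ht0.le, ht1⟩

namespace NormalLatticePolytope

variable {n : ℕ} {P : NormalLatticePolytope n}

theorem InCone.fst_nonneg {σ : P.Face} {y : ℝ × (Fin n → ℝ)} (hy : InCone σ y) : 0 ≤ y.1 :=
  hy.nonneg (l := LinearMap.fst ℝ ℝ _) fun χ _ => by simp [hatR]

theorem InCone.eq_zero {σ : P.Face} {y : ℝ × (Fin n → ℝ)} (hy : InCone σ y) (h : y.1 = 0) :
    y = 0 := by
  obtain ⟨w, h1, -, rfl⟩ := hy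
  simp only [Prod.fst_sum, hatR, Prod.smul_fst, smul_eq_mul, mul_one] at h
  rw [Finset.sum_eq_zero_iff_of_nonneg fun χ _ => h1 χ] at h
  exact Finset.sum_eq_zero fun χ hχ => by rw [h χ hχ, zero_smul]

theorem InCone.snd_mem {σ : P.Face} {y : ℝ × (Fin n → ℝ)} (hy : InCone σ y) (h : 0 < y.1) :
    y.1⁻¹ • y.2 ∈ σ.1 := by
  rw [mem_face_iff]
  convert hy.smul (inv_nonneg.2 h.le) using 1
  ext1
  · simp [h.ne']
  · simp

/-- This links the topological relative interior with the one defined by forms. Prolonging segments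
gives one direction. For the other, subtracting a relative interior point `x0` from a large multiple
of `(1, x)` stays in the cone, so `x` lies on a segment from a point of the face to `x0`, away from
the first end. -/
theorem mem_intrinsicInterior_liftFace_iff (σ : P.Face) (x : Fin n → ℝ) :
    ((1 : ℝ), x) ∈ intrinsicInterior ℝ (liftFace σ.1) ↔ InInterior σ (1, x) := by
  have hconv : Convex ℝ (liftFace σ.1) := by
    rintro _ ⟨x, hx, rfl⟩ _ ⟨y, hy, rfl⟩ a b ha hb hab
    refine ⟨a • x + b • y, (σ.2.2.convex convex_carrier) hx hy ha hb hab, ?_⟩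
    ext1 <;> simp [hab]
  constructor
  · intro h
    obtain ⟨x', hx', hxx⟩ := intrinsicInterior_subset h
    obtain rfl : x' = x := congrArg Prod.snd hxx
    refine ⟨(mem_face_iff σ x').1 hx', fun l hl h0 χ hχ => ?_⟩
    obtain ⟨ε, hε, x'', hx'', hy⟩ := exists_pos_add_smul_sub_mem h (⟨_, hχ, rfl⟩ :
      P.hatR χ ∈ liftFace σ.1)
    have h1 := ((mem_face_iff σ x'').1 hx'').nonneg hl
    have h2 : l (1, x'') = -(ε * l (P.hatR χ)) := by
      have hy' : ((1 : ℝ), x'') = (1, x') + ε • ((1, x') - P.hatR χ) := hy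
      rw [hy', map_add, map_smul, map_sub, h0]
      simp
    have h3 := hl χ hχ
    have h4 : 0 ≤ ε * l (P.hatR χ) := mul_nonneg hε.le h3
    have h5 : ε * l (P.hatR χ) = 0 := by linarith
    exact (mul_eq_zero.1 h5).resolve_left hε.ne'
  · intro h
    obtain ⟨x0, hx0⟩ := (Set.Nonempty.intrinsicInterior hconv (σ.2.1.image _))
    obtain ⟨x0', hx0', hxx0⟩ := intrinsicInterior_subset hx0
    obtain ⟨c, hc, hcone⟩ := h.exists_smul_sub ((mem_face_iff σ x0').1 hx0')
    -- With `c` alone the difference could have height zero; with `c + 1` its height is `c > 0`, so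
    -- it can be rescaled to height one.
    have hcone' : InCone σ ((c + 1) • ((1 : ℝ), x) - (1, x0')) := by
      have := hcone.add h.1
      convert this using 1
      module
    have h1 := hcone.fst_nonneg
    simp only [Prod.fst_sub, Prod.smul_fst, smul_eq_mul, mul_one] at h1
    have hc0 : 0 < c := by linarith
    have hz := hcone'.snd_mem (by simpa using hc0)
    have := lineMap_mem_intrinsicInterior hconv hx0 (z := ((1 : ℝ), _)) ⟨_, hz, rfl⟩
      (t := (c + 1)⁻¹) (by positivity) (inv_le_one_of_one_le₀ (by linarith))
    convert this using 1
    subst hxx0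
    rw [AffineMap.lineMap_apply]
    ext1
    · simp
    · have hc1 : c + 1 ≠ 0 := by positivity
      simp only [Prod.fst_sub, Prod.smul_fst, smul_eq_mul, mul_one, add_sub_cancel_right,
        Prod.snd_sub, Prod.smul_snd, vsub_eq_sub, vadd_eq_add, Prod.snd_add]
      ext i
      simp only [Pi.add_apply, Pi.smul_apply, Pi.sub_apply, smul_eq_mul]
      field_simp
      ring

/-! ### Weights of monomials -/

/-- The weight `∑ a_χ (1, χ)` of an exponent. -/
def wt (P : NormalLatticePolytope n) : (P.Lam →₀ ℕ) →ₗ[ℕ] ℤ × (Fin n → ℤ) :=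
  Finsupp.linearCombination ℕ P.hat

@[simp]
theorem wt_single (χ : P.Lam) (k : ℕ) : P.wt (Finsupp.single χ k) = k • P.hat χ := by
  simp [wt]

theorem wt_eq_sum (a : P.Lam →₀ ℕ) : P.wt a = ∑ χ, a χ • P.hat χ := by
  rw [wt, Finsupp.linearCombination_apply, Finsupp.sum_fintype]
  simp

theorem toRealHat_wt (a : P.Lam →₀ ℕ) :
    toRealHat (P.wt a) = ∑ χ, (a χ : ℝ) • P.hatR χ := by
  rw [wt_eq_sum, map_sum]
  refine Finset.sum_congr rfl fun χ _ => ?_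
  rw [map_nsmul, toRealHat_hat, Nat.cast_smul_eq_nsmul]

theorem wt_fst (a : P.Lam →₀ ℕ) : (P.wt a).1 = a.degree := by
  rw [wt_eq_sum, Prod.fst_sum, Finsupp.degree_eq_sum]
  simp [hat]

/-- The exponent `a` involves only elements of `S`. -/
def SupportedOn (S : Set P.Lam) (a : P.Lam →₀ ℕ) : Prop := ∀ χ, χ ∉ S → a χ = 0

theorem SupportedOn.add {S : Set P.Lam} {a b : P.Lam →₀ ℕ} (ha : SupportedOn S a)
    (hb : SupportedOn S b) : SupportedOn S (a + b) := fun χ hχ => by simp [ha χ hχ, hb χ hχ]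

theorem SupportedOn.nsmul {S : Set P.Lam} {a : P.Lam →₀ ℕ} (ha : SupportedOn S a) (k : ℕ) :
    SupportedOn S (k • a) := fun χ hχ => by simp [ha χ hχ]

theorem SupportedOn.mono {S T : Set P.Lam} {a : P.Lam →₀ ℕ} (ha : SupportedOn S a)
    (h : S ⊆ T) : SupportedOn T a := fun χ hχ => ha χ fun h' => hχ (h h')

theorem supportedOn_single {S : Set P.Lam} {χ : P.Lam} (hχ : χ ∈ S) (k : ℕ) :
    SupportedOn S (Finsupp.single χ k) := fun ψ hψ => by
  rw [Finsupp.single_apply, if_neg]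
  rintro rfl
  exact hψ hχ

theorem SupportedOn.inCone {σ : P.Face} {a : P.Lam →₀ ℕ} (ha : SupportedOn (latticePoints σ) a) :
    InCone σ (toRealHat (P.wt a)) :=
  ⟨fun χ => a χ, fun χ => Nat.cast_nonneg _, fun χ hχ => by simp [ha χ hχ], toRealHat_wt a⟩

theorem map_toRealHat_wt (l : ℝ × (Fin n → ℝ) →ₗ[ℝ] ℝ) (a : P.Lam →₀ ℕ) :
    l (toRealHat (P.wt a)) = ∑ χ, a χ * l (P.hatR χ) := by
  simp [toRealHat_wt]

/-- An exponent whose weight lies in the cone over `σ` involves only lattice points of `σ`. -/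
theorem supportedOn_of_inCone {σ : P.Face} {a : P.Lam →₀ ℕ} (h : InCone σ (toRealHat (P.wt a))) :
    SupportedOn (latticePoints σ) a := by
  obtain ⟨L, hL, hL0⟩ := exists_form σ
  have h0 : L (toRealHat (P.wt a)) = 0 := h.map_eq_zero fun χ hχ => (hL0 _ χ.2).2 hχ
  rw [map_toRealHat_wt, Finset.sum_eq_zero_iff_of_nonneg fun χ _ =>
    mul_nonneg (Nat.cast_nonneg _) (show 0 ≤ L (P.hatR χ) from hL _ χ.2)] at h0
  intro χ hχ
  rcases mul_eq_zero.1 (h0 χ (Finset.mem_univ _)) with h | h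
  · exact_mod_cast h
  · exact absurd ((hL0 _ χ.2).1 h) hχ

theorem supportedOn_iff_inCone {σ : P.Face} {a : P.Lam →₀ ℕ} :
    SupportedOn (latticePoints σ) a ↔ InCone σ (toRealHat (P.wt a)) :=
  ⟨SupportedOn.inCone, supportedOn_of_inCone⟩

/-- Being supported on a face depends only on the weight. This is why setting the coordinates
outside a face to zero is compatible with the binomial relations. -/
theorem supportedOn_congr {σ : P.Face} {a b : P.Lam →₀ ℕ} (h : P.wt a = P.wt b) :
    SupportedOn (latticePoints σ) a ↔ SupportedOn (latticePoints σ) b := by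
  rw [supportedOn_iff_inCone, supportedOn_iff_inCone, h]

/-- Normality: every lattice point of the cone over a face is the weight of an exponent. -/
theorem exists_wt_eq {σ : P.Face} {w : ℤ × (Fin n → ℤ)} (h : InCone σ (toRealHat w)) :
    ∃ a : P.Lam →₀ ℕ, SupportedOn (latticePoints σ) a ∧ P.wt a = w := by
  suffices ∃ a : P.Lam →₀ ℕ, P.wt a = w by
    obtain ⟨a, rfl⟩ := this
    exact ⟨a, supportedOn_of_inCone h, rfl⟩
  have h0 := h.fst_nonneg
  -- At height zero one cannot divide by the height, but there the cone contains only the origin.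
  rcases h0.eq_or_lt with h0 | h0
  · refine ⟨0, ?_⟩
    have := h.eq_zero h0.symm
    rw [← map_zero (toRealHat (n := n))] at this
    rw [map_zero, toRealHat_injective this]
  · have hx := h.snd_mem h0
    have hpos : 0 < w.1 := by
      have : (0 : ℝ) < (w.1 : ℝ) := h0
      exact_mod_cast this
    obtain ⟨k, hk⟩ : ∃ k : ℕ, (k : ℤ) = w.1 := ⟨w.1.toNat, Int.toNat_of_nonneg hpos.le⟩
    have hkR : ((k : ℝ)) = (toRealHat w).1 := by
      change (k : ℝ) = ((w.1 : ℤ) : ℝ)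
      rw [← hk]; simp
    obtain ⟨a, ha, hsum⟩ := P.normal k w.2 ⟨_, face_subset σ hx, by
      rw [hkR, smul_smul, mul_inv_cancel₀ h0.ne', one_smul]; rfl⟩
    refine ⟨∑ j, Finsupp.single (⟨a j, ha j⟩ : P.Lam) 1, ?_⟩
    rw [map_sum]
    simp only [wt_single, one_smul]
    ext1
    · simp [Prod.fst_sum, hat, hk]
    · simp [Prod.snd_sum, hat, hsum]

/-- The sum of all elements of `S`, as an exponent. -/
def ones (S : Set P.Lam) : P.Lam →₀ ℕ := Finsupp.equivFunOnFinite.symm (S.indicator 1)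

theorem ones_apply_of_mem {S : Set P.Lam} {χ : P.Lam} (h : χ ∈ S) : ones S χ = 1 := by
  simp [ones, h]

theorem supportedOn_ones (S : Set P.Lam) : SupportedOn S (ones S) := fun χ hχ => by
  simp [ones, hχ]

theorem inInterior_ones (σ : P.Face) :
    InInterior σ (toRealHat (P.wt (ones (latticePoints σ)))) := by
  refine ⟨(supportedOn_ones _).inCone, fun l hl h0 χ hχ => ?_⟩
  rw [map_toRealHat_wt, Finset.sum_eq_zero_iff_of_nonneg] at h0
  · simpa [ones_apply_of_mem hχ] using h0 χ (Finset.mem_univ _)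
  · intro ψ _
    by_cases hψ : ψ ∈ latticePoints σ
    · exact mul_nonneg (Nat.cast_nonneg _) (hl ψ hψ)
    · simp [supportedOn_ones _ ψ hψ]

/-- The coefficient produced by Farkas is rounded up to an integer, so that normality can be applied
to the resulting lattice point. -/
theorem InCone.exists_nat {σ : P.Face} {y z : ℝ × (Fin n → ℝ)} (hy : InCone σ y) {c : ℝ}
    (h : InCone σ (z + c • y)) : ∃ N : ℕ, InCone σ (z + (N : ℝ) • y) := by
  refine ⟨⌈c⌉₊, ?_⟩
  have := h.add (hy.smul (sub_nonneg.2 (Nat.le_ceil c)))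
  convert this using 1
  module

/-- Modulo the binomial relations, every coordinate in `σ` divides a power of a monomial whose
weight is interior to the cone over `σ`. Such a monomial therefore cannot be nonzero where one of
these coordinates vanishes. -/
theorem InInterior.exists_nsmul_wt_eq {σ : P.Face} {b : P.Lam →₀ ℕ}
    (hb : InInterior σ (toRealHat (P.wt b))) {χ : P.Lam} (hχ : χ ∈ latticePoints σ) :
    ∃ (N : ℕ) (a : P.Lam →₀ ℕ), SupportedOn (latticePoints σ) a ∧
      N • P.wt b = P.hat χ + P.wt a := by
  obtain ⟨c, -, hc⟩ := hb.exists_smul_sub (inCone_hatR hχ)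
  obtain ⟨N, hN⟩ := hb.1.exists_nat (z := -P.hatR χ) (c := c) (by rwa [neg_add_eq_sub])
  obtain ⟨a, ha, hwa⟩ := exists_wt_eq (σ := σ) (w := -P.hat χ + N • P.wt b) (by
    convert hN using 1
    rw [map_add, map_neg, toRealHat_hat, map_nsmul, Nat.cast_smul_eq_nsmul])
  exact ⟨N, a, ha, by rw [hwa]; abel⟩

/-- The smallest face containing the elements of a nonempty set of lattice points. -/
theorem exists_face_of_nonempty {S : Set P.Lam} (hS : S.Nonempty) :
    ∃ τ : P.Face, S ⊆ latticePoints τ ∧ InInterior τ (toRealHat (P.wt (ones S))) := by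
  set y := toRealHat (P.wt (ones S)) with hy
  have hcone : InCone P.topFace y :=
    (supportedOn_ones S).mono (by simp [latticePoints_topFace]) |>.inCone
  have hpos : 0 < y.1 := by
    refine lt_of_le_of_ne hcone.fst_nonneg fun h => ?_
    have h1 : (P.wt (ones S)).1 = 0 := by
      have : ((P.wt (ones S)).1 : ℝ) = 0 := h.symm
      exact_mod_cast this
    rw [wt_fst, Nat.cast_eq_zero, Finsupp.degree_eq_zero_iff] at h1
    obtain ⟨χ, hχ⟩ := hS
    have := ones_apply_of_mem hχ
    simp [h1] at this
  -- The minimal face through the barycentre of `S`, obtained by rescaling the sum `y` to height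
  -- one.
  obtain ⟨τ, hτ⟩ := exists_inInterior (face_subset _ (hcone.snd_mem hpos))
  have hyx : y = y.1 • ((1 : ℝ), y.1⁻¹ • y.2) := by
    ext1
    · simp
    · simp [smul_smul, hpos.ne']
  have hint : InInterior τ y := by
    rw [hyx]
    refine ⟨hτ.1.smul hpos.le, fun l hl h0 => hτ.2 l hl ?_⟩
    rw [map_smul, smul_eq_mul] at h0
    exact (mul_eq_zero.1 h0).resolve_left hpos.ne'
  refine ⟨τ, fun χ hχ => ?_, hint⟩
  by_contra hcon
  have := supportedOn_of_inCone hint.1 χ hcon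
  rw [ones_apply_of_mem hχ] at this
  exact one_ne_zero this

/-! ### Facets -/

/-- Inverting an interior point of a facet `τ` turns the cone over `σ` into the half-space `0 ≤ L`
of its span. By Farkas it is enough to treat a form `l` that is nonnegative on `σ` and zero on `τ`;
on the span of `σ` such an `l`, unless it is zero, is a positive multiple of `1 / ε` times `L`. -/
theorem exists_inCone_of_covBy {τ σ : P.Face} (h : τ ⋖ σ) {L : ℝ × (Fin n → ℝ) →ₗ[ℝ] ℝ}
    (hL : ∀ x ∈ P.carrier, 0 ≤ L (1, x)) (hL0 : ∀ x ∈ P.carrier, L (1, x) = 0 ↔ x ∈ τ.1)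
    {z : ℝ × (Fin n → ℝ)} (hz : z ∈ Submodule.span ℝ (P.hatR '' latticePoints σ))
    (hLz : 0 ≤ L z) :
    ∃ N : ℕ, InCone σ (z + (N : ℝ) • toRealHat (P.wt (ones (latticePoints τ)))) := by
  have hsub := le_iff_latticePoints_subset.1 h.le
  have hτ := inInterior_ones τ
  have hcone : InCone σ (toRealHat (P.wt (ones (latticePoints τ)))) :=
    ((supportedOn_ones _).mono hsub).inCone
  suffices hs : ∃ c : ℝ, 0 ≤ c ∧
      InCone σ (z + c • toRealHat (P.wt (ones (latticePoints τ)))) by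
    obtain ⟨c, -, hc⟩ := hs
    exact hcone.exists_nat hc
  refine exists_inCone_add_smul fun l hl hly => ?_
  have hlτ : ∀ χ ∈ latticePoints τ, l (P.hatR χ) = 0 :=
    hτ.2 l (fun χ hχ => hl χ (hsub hχ)) (le_antisymm hly (hcone.nonneg hl))
  by_cases hcase : ∀ χ ∈ latticePoints σ, l (P.hatR χ) = 0
  · have : Submodule.span ℝ (P.hatR '' latticePoints σ) ≤ LinearMap.ker l :=
      Submodule.span_le.2 (by rintro _ ⟨χ, hχ, rfl⟩; exact hcase χ hχ)
    exact (LinearMap.mem_ker.1 (this hz)).ge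
  · push Not at hcase
    -- With `ε` the least ratio `L / l`, the form `L - ε • l` is nonnegative on `σ` and vanishes on
    -- `τ` and at `χ₁`. It cuts out a face strictly larger than `τ`, hence all of `σ`.
    obtain ⟨χ₁, ⟨hχ₁, hlχ₁⟩, hmin⟩ := Set.exists_min_image
      {χ | χ ∈ latticePoints σ ∧ l (P.hatR χ) ≠ 0} (fun χ => L (P.hatR χ) / l (P.hatR χ))
      (Set.toFinite _) hcase
    set ε := L (P.hatR χ₁) / l (P.hatR χ₁) with hε
    have hlχ₁' : 0 < l (P.hatR χ₁) := lt_of_le_of_ne (hl _ hχ₁) hlχ₁.symm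
    have hLχ₁ : 0 < L (P.hatR χ₁) := lt_of_le_of_ne (hL _ χ₁.2) fun h0 =>
      hlχ₁ (hlτ χ₁ ((hL0 _ χ₁.2).1 h0.symm))
    have hεpos : 0 < ε := div_pos hLχ₁ hlχ₁'
    have hg : ∀ χ ∈ latticePoints σ, 0 ≤ (L - ε • l) (P.hatR χ) := by
      intro χ hχ
      simp only [LinearMap.sub_apply, LinearMap.smul_apply, smul_eq_mul, sub_nonneg]
      by_cases h0 : l (P.hatR χ) = 0
      · rw [h0, mul_zero]; exact hL _ χ.2
      · exact (le_div_iff₀ (lt_of_le_of_ne (hl _ hχ) (Ne.symm h0))).1 (hmin χ ⟨hχ, h0⟩)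
    obtain ⟨ψ, hψ⟩ := latticePoints_nonempty τ
    have hτ0 : ∀ χ ∈ latticePoints τ, (L - ε • l) (P.hatR χ) = 0 := fun χ hχ => by
      have : L (P.hatR χ) = 0 := (hL0 _ χ.2).2 hχ
      simp [hlτ χ hχ, this]
    obtain ⟨ρ, hρσ, hρ⟩ := exists_subface σ hg (hsub hψ) (hτ0 ψ hψ)
    have hτρ : τ < ρ := by
      refine lt_of_le_of_ne (le_iff_latticePoints_subset.2 fun χ hχ =>
        (hρ _).2 ⟨hsub hχ, hτ0 χ hχ⟩) ?_
      rintro rfl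
      have h1 : toReal χ₁.1 ∈ τ.1 := (hρ _).2 ⟨hχ₁, by
        change (L - ε • l) (P.hatR χ₁) = 0
        simp [hε, hlχ₁]⟩
      exact hLχ₁.ne' ((hL0 _ χ₁.2).2 h1)
    have hρσ' : ρ = σ := by
      by_contra hne
      exact h.2 hτρ (lt_of_le_of_ne hρσ hne)
    subst hρσ'
    have hker : Submodule.span ℝ (P.hatR '' latticePoints ρ) ≤ LinearMap.ker (L - ε • l) :=
      Submodule.span_le.2 (by rintro _ ⟨χ, hχ, rfl⟩; exact ((hρ _).1 hχ).2)
    have h1 := LinearMap.mem_ker.1 (hker hz)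
    simp only [LinearMap.sub_apply, LinearMap.smul_apply, smul_eq_mul, sub_eq_zero] at h1
    rw [h1] at hLz
    exact nonneg_of_mul_nonneg_right hLz hεpos

/-- The lattice points of a face, relative to a facet of it: they are, up to lattice points of
the facet, multiples of one lattice point outside of the facet. -/
theorem exists_height {τ σ : P.Face} (h : τ ⋖ σ) :
    ∃ (q : P.Lam → ℕ) (χ₀ : P.Lam) (hgt : ℤ × (Fin n → ℤ) →+ ℝ),
      χ₀ ∈ latticePoints σ ∧ q χ₀ = 1 ∧
      (∀ χ ∈ latticePoints σ, q χ = 0 ↔ χ ∈ latticePoints τ) ∧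
      (∀ χ ∈ latticePoints σ, hgt (P.hat χ) = q χ) ∧
      ∀ χ ∈ latticePoints σ, ∃ b c : P.Lam →₀ ℕ, SupportedOn (latticePoints τ) b ∧
        SupportedOn (latticePoints τ) c ∧ P.hat χ + P.wt b = q χ • P.hat χ₀ + P.wt c := by
  have hsub := le_iff_latticePoints_subset.1 h.le
  obtain ⟨L, hL, hL0⟩ := exists_form τ
  have hL0' : ∀ χ : P.Lam, L (P.hatR χ) = 0 ↔ χ ∈ latticePoints τ := fun χ => hL0 _ χ.2
  have hL' : ∀ χ : P.Lam, 0 ≤ L (P.hatR χ) := fun χ => hL _ χ.2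
  have hne : (latticePoints σ \ latticePoints τ).Nonempty := by
    rw [Set.sdiff_nonempty]
    exact fun hs => h.1.not_ge (le_iff_latticePoints_subset.2 hs)
  obtain ⟨χ₀, ⟨hχ₀, hχ₀τ⟩, hmin⟩ := Set.exists_min_image _ (fun χ => L (P.hatR χ))
    (Set.toFinite _) hne
  have hpos : 0 < L (P.hatR χ₀) := lt_of_le_of_ne (hL' _) fun h0 => hχ₀τ ((hL0' _).1 h0.symm)
  -- Division with remainder of heights by the least positive height, that of `χ₀`.
  let q : P.Lam → ℕ := fun χ => ⌊L (P.hatR χ) / L (P.hatR χ₀)⌋₊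
  have key : ∀ χ ∈ latticePoints σ, L (P.hatR χ) = q χ * L (P.hatR χ₀) ∧
      ∃ b c : P.Lam →₀ ℕ, SupportedOn (latticePoints τ) b ∧
        SupportedOn (latticePoints τ) c ∧ P.hat χ + P.wt b = q χ • P.hat χ₀ + P.wt c := by
    intro χ hχ
    have h1 : (q χ : ℝ) * L (P.hatR χ₀) ≤ L (P.hatR χ) :=
      (le_div_iff₀ hpos).1 (Nat.floor_le (div_nonneg (hL' _) hpos.le))
    have h2 : L (P.hatR χ) < (q χ + 1) * L (P.hatR χ₀) :=
      (div_lt_iff₀ hpos).1 (Nat.lt_floor_add_one _)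
    obtain ⟨N, hN⟩ := exists_inCone_of_covBy h hL hL0
      (z := P.hatR χ - (q χ : ℝ) • P.hatR χ₀)
      (Submodule.sub_mem _ (Submodule.subset_span ⟨_, hχ, rfl⟩)
        (Submodule.smul_mem _ _ (Submodule.subset_span ⟨_, hχ₀, rfl⟩)))
      (by simpa using h1)
    have hcast : toRealHat (P.hat χ - q χ • P.hat χ₀ + N • P.wt (ones (latticePoints τ))) =
        P.hatR χ - (q χ : ℝ) • P.hatR χ₀ +
          (N : ℝ) • toRealHat (P.wt (ones (latticePoints τ))) := by
      rw [map_add, map_sub, map_nsmul, map_nsmul, toRealHat_hat, toRealHat_hat,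
        Nat.cast_smul_eq_nsmul, Nat.cast_smul_eq_nsmul]
    rw [← hcast] at hN
    obtain ⟨a, ha, hwa⟩ := exists_wt_eq hN
    have hval : ∑ ψ, a ψ * L (P.hatR ψ) = L (P.hatR χ) - q χ * L (P.hatR χ₀) := by
      rw [← map_toRealHat_wt, hwa, hcast]
      simp only [map_add, map_sub, map_smul, smul_eq_mul]
      rw [(inInterior_ones τ).1.map_eq_zero fun χ hχ => (hL0' χ).2 hχ]
      ring
    -- The remainder `a` has total height smaller than that of `χ₀`, so by minimality it uses no
    -- lattice point outside `τ`, and the remainder is in fact zero.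
    have haτ : SupportedOn (latticePoints τ) a := by
      intro ψ hψ
      by_contra hne
      have hψσ : ψ ∈ latticePoints σ := by
        by_contra hcon
        exact hne (ha ψ hcon)
      have h3 : (a ψ : ℝ) * L (P.hatR ψ) ≤ ∑ ψ, a ψ * L (P.hatR ψ) :=
        Finset.single_le_sum (f := fun ψ => (a ψ : ℝ) * L (P.hatR ψ))
          (fun ψ _ => mul_nonneg (Nat.cast_nonneg _) (hL' ψ)) (Finset.mem_univ ψ)
      have h4 : (1 : ℝ) ≤ a ψ := by exact_mod_cast Nat.one_le_iff_ne_zero.2 hne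
      have h5 := hmin ψ ⟨hψσ, hψ⟩
      nlinarith [hL' ψ]
    refine ⟨?_, N • ones (latticePoints τ), a, (supportedOn_ones _).nsmul N, haτ, ?_⟩
    · have h0 : ∑ ψ, a ψ * L (P.hatR ψ) = 0 := by
        rw [← map_toRealHat_wt]
        exact haτ.inCone.map_eq_zero fun χ hχ => (hL0' χ).2 hχ
      rw [h0] at hval
      linarith
    · rw [hwa, map_nsmul]
      abel
  refine ⟨q, χ₀,
    (AddMonoidHom.mulRight (L (P.hatR χ₀))⁻¹).comp (L.toAddMonoidHom.comp toRealHat),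
    hχ₀, ?_, ?_, ?_, fun χ hχ => (key χ hχ).2⟩
  · simp [q, hpos.ne']
  · intro χ hχ
    rw [← hL0', (key χ hχ).1, mul_eq_zero, Nat.cast_eq_zero, or_iff_left hpos.ne']
  · intro χ hχ
    have h1 : L (P.hatR χ) = q χ * L (P.hatR χ₀) := (key χ hχ).1
    have h2 : L (P.hatR χ) * (L (P.hatR χ₀))⁻¹ = q χ := by
      rw [h1, mul_assoc, mul_inv_cancel₀ hpos.ne', mul_one]
    simpa [toRealHat_hat] using h2

/-! ### The rank of a face -/

/-- The lattice spanned by the points `(1, χ)` for the lattice points `χ` of a face. -/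
def lattice (σ : P.Face) : Submodule ℤ (ℤ × (Fin n → ℤ)) :=
  Submodule.span ℤ (P.hat '' latticePoints σ)

/-- The rank of the lattice of a face: the dimension of the face plus one. -/
def rank (σ : P.Face) : ℕ := Module.finrank ℤ (lattice σ)

theorem hat_mem_lattice {σ : P.Face} {χ : P.Lam} (hχ : χ ∈ latticePoints σ) :
    P.hat χ ∈ lattice σ := Submodule.subset_span ⟨χ, hχ, rfl⟩

theorem SupportedOn.wt_mem_lattice {σ : P.Face} {a : P.Lam →₀ ℕ}
    (ha : SupportedOn (latticePoints σ) a) : P.wt a ∈ lattice σ := by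
  rw [wt_eq_sum]
  refine Submodule.sum_mem _ fun χ _ => ?_
  by_cases h : χ ∈ latticePoints σ
  · exact Submodule.smul_of_tower_mem _ _ (hat_mem_lattice h)
  · simp [ha χ h]

theorem lattice_mono {τ σ : P.Face} (h : τ ≤ σ) : lattice τ ≤ lattice σ :=
  Submodule.span_mono (Set.image_mono (le_iff_latticePoints_subset.1 h))

theorem rank_mono {τ σ : P.Face} (h : τ ≤ σ) : rank τ ≤ rank σ :=
  Submodule.finrank_mono (lattice_mono h)

/-- The lattice of `σ` is the direct sum of the lattice of the facet and `ℤ (1, χ₀)`; the height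
function makes the sum direct. -/
theorem rank_covBy {τ σ : P.Face} (h : τ ⋖ σ) : rank σ = rank τ + 1 := by
  obtain ⟨q, χ₀, hgt, hχ₀, hq₀, hqτ, hq, hdec⟩ := exists_height h
  have hsub := le_iff_latticePoints_subset.1 h.le
  let f : (lattice τ × ℤ) →ₗ[ℤ] ℤ × (Fin n → ℤ) :=
    (lattice τ).subtype.coprod (LinearMap.toSpanSingleton ℤ _ (P.hat χ₀))
  have hτ0 : ∀ x ∈ lattice τ, hgt x = 0 := by
    have : lattice τ ≤ LinearMap.ker hgt.toIntLinearMap := Submodule.span_le.2 (by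
      rintro _ ⟨χ, hχ, rfl⟩
      simp [hq χ (hsub hχ), (hqτ χ (hsub hχ)).2 hχ])
    exact fun x hx => this hx
  have hinj : Function.Injective f := by
    rw [← LinearMap.ker_eq_bot, LinearMap.ker_eq_bot']
    rintro ⟨x, k⟩ hxk
    simp only [f, LinearMap.coprod_apply, Submodule.subtype_apply,
      LinearMap.toSpanSingleton_apply] at hxk
    have h1 := congrArg hgt hxk
    rw [map_add, hτ0 x x.2, map_zsmul, hq χ₀ hχ₀, hq₀] at h1
    have hk : k = 0 := by simpa using h1
    subst hk
    simpa using hxk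
  have hrange : LinearMap.range f = lattice σ := by
    apply le_antisymm
    · rintro _ ⟨⟨x, k⟩, rfl⟩
      exact Submodule.add_mem _ (lattice_mono h.le x.2)
        (Submodule.smul_mem _ _ (hat_mem_lattice hχ₀))
    · refine Submodule.span_le.2 ?_
      rintro _ ⟨χ, hχ, rfl⟩
      obtain ⟨b, c, hb, hc, hbc⟩ := hdec χ hχ
      refine ⟨(⟨P.wt c, hc.wt_mem_lattice⟩ - ⟨P.wt b, hb.wt_mem_lattice⟩, q χ), ?_⟩
      simp only [f, LinearMap.coprod_apply, Submodule.subtype_apply,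
        LinearMap.toSpanSingleton_apply, Submodule.coe_sub, natCast_zsmul]
      rw [eq_sub_of_add_eq hbc]
      abel
  have e := LinearEquiv.ofInjective f hinj
  rw [rank, rank, ← hrange, ← e.finrank_eq, Module.finrank_prod, Module.finrank_self]

theorem exists_covBy_of_lt {τ σ : P.Face} (h : τ < σ) : ∃ ρ : P.Face, τ ≤ ρ ∧ ρ ⋖ σ := by
  obtain ⟨ρ, ⟨h1, h2⟩, hρ⟩ := (Set.toFinite {ρ : P.Face | τ ≤ ρ ∧ ρ < σ}).exists_maximal
    ⟨τ, le_rfl, h⟩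
  exact ⟨ρ, h1, h2, fun c hc1 hc2 => (hρ ⟨h1.trans hc1.le, hc2⟩ hc1.le).not_gt hc1⟩

theorem rank_lt {τ σ : P.Face} (h : τ < σ) : rank τ + 1 ≤ rank σ := by
  obtain ⟨ρ, h1, h2⟩ := exists_covBy_of_lt h
  rw [rank_covBy h2]
  exact Nat.succ_le_succ (rank_mono h1)

theorem rank_add_two_le {τ σ : P.Face} (h : τ < σ) (h' : ¬ τ ⋖ σ) : rank τ + 2 ≤ rank σ := by
  obtain ⟨ρ, h1, h2⟩ := exists_covBy_of_lt h
  have h3 : τ < ρ := lt_of_le_of_ne h1 (by rintro rfl; exact h' h2)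
  rw [rank_covBy h2]
  exact Nat.succ_le_succ (rank_lt h3)

/-- On a minimal face every coordinate is constant, since its minimum would cut out a smaller face;
so the face has a single lattice point. -/
theorem rank_of_isMin {σ : P.Face} (h : IsMin σ) : rank σ = 1 := by
  obtain ⟨χ, hχ⟩ := latticePoints_nonempty σ
  have hS : latticePoints σ = {χ} := by
    refine Set.eq_singleton_iff_unique_mem.2 ⟨hχ, fun ψ hψ => Subtype.ext (funext fun i => ?_)⟩
    obtain ⟨χ₁, hχ₁, hmin⟩ := Set.exists_min_image _ (fun χ : P.Lam => toReal χ.1 i)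
      (Set.toFinite _) (latticePoints_nonempty σ)
    let l : ℝ × (Fin n → ℝ) →ₗ[ℝ] ℝ :=
      LinearMap.proj (R := ℝ) (φ := fun _ : Fin n => ℝ) i ∘ₗ LinearMap.snd ℝ ℝ _ -
        toReal χ₁.1 i • LinearMap.fst ℝ ℝ _
    obtain ⟨τ, hτσ, hτ⟩ := exists_subface σ (l := l) (fun χ hχ => by
      simpa [l, hatR] using hmin χ hχ) hχ₁ (by simp [l])
    have hστ : ∀ η ∈ latticePoints σ, toReal η.1 i = toReal χ₁.1 i := fun η hη => by
      have := ((hτ _).1 (h hτσ hη)).2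
      simpa [l, sub_eq_zero] using this
    have := (hστ ψ hψ).trans (hστ χ hχ).symm
    simpa [toReal] using this
  have hne : P.hat χ ≠ 0 := fun h0 => by
    have := congrArg Prod.fst h0
    simp [hat] at this
  rw [rank, lattice, hS, Set.image_singleton,
    ← (LinearEquiv.toSpanNonzeroSingleton ℤ _ (P.hat χ) hne).finrank_eq, Module.finrank_self]

end NormalLatticePolytope

open NormalLatticePolytope TopologicalSpace

/-! ### Characters -/

section Characters

variable {K : Type*} [Field K] {n : ℕ}

theorem character_add (χ ψ : Fin n → ℤ) (t : Torus K n) :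
    character (χ + ψ) t = character χ t * character ψ t := by
  simp [character, zpow_add, Finset.prod_mul_distrib]

theorem characterHat_add (w w' : ℤ × (Fin n → ℤ)) (t : TorusHat K n) :
    characterHat (w + w') t = characterHat w t * characterHat w' t := by
  simp only [characterHat, Prod.fst_add, Prod.snd_add, zpow_add, character_add]
  exact mul_mul_mul_comm _ _ _ _

theorem characterHat_mul (w : ℤ × (Fin n → ℤ)) (s t : TorusHat K n) :
    characterHat w (s * t) = characterHat w s * characterHat w t := by
  simp only [characterHat, Prod.fst_mul, Prod.snd_mul, mul_zpow, character_mul]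
  exact mul_mul_mul_comm _ _ _ _

/-- The character of `T̂` of weight `w`, as a homomorphism to the multiplicative monoid of `K`. -/
def characterHom (w : ℤ × (Fin n → ℤ)) : TorusHat K n →* K :=
  (Units.coeHom K).comp (MonoidHom.mk' (characterHat w) (characterHat_mul w))

@[simp]
theorem characterHom_apply (w : ℤ × (Fin n → ℤ)) (t : TorusHat K n) :
    characterHom w t = (characterHat w t : K) := rfl

/-- Evaluation of weights at a point of `T̂`. -/
def weightHom (t : TorusHat K n) : Multiplicative (ℤ × (Fin n → ℤ)) →* Kˣ :=
  MonoidHom.mk' (fun w => characterHat w.toAdd t) fun v w => characterHat_add v.toAdd w.toAdd t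

theorem characterHat_neg (w : ℤ × (Fin n → ℤ)) (t : TorusHat K n) :
    characterHat (-w) t = (characterHat w t)⁻¹ := map_inv (weightHom t) (Multiplicative.ofAdd w)

theorem characterHat_nsmul (k : ℕ) (w : ℤ × (Fin n → ℤ)) (t : TorusHat K n) :
    characterHat (k • w) t = characterHat w t ^ k :=
  map_pow (weightHom t) (Multiplicative.ofAdd w) k

theorem characterHat_sum {ι : Type*} (s : Finset ι) (w : ι → ℤ × (Fin n → ℤ))
    (t : TorusHat K n) : characterHat (∑ i ∈ s, w i) t = ∏ i ∈ s, characterHat (w i) t :=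
  map_prod (weightHom t) (fun i => Multiplicative.ofAdd (w i)) s

theorem characterHat_inv (w : ℤ × (Fin n → ℤ)) (t : TorusHat K n) :
    characterHat w t⁻¹ = (characterHat w t)⁻¹ := by
  simp [characterHat, character, mul_comm]

theorem zpow_two_unit_injective [CharZero K] {k l : ℤ}
    (h : Units.mk0 (2 : K) two_ne_zero ^ k = Units.mk0 (2 : K) two_ne_zero ^ l) : k = l := by
  have h1 := congrArg (Units.val) h
  simp only [Units.val_zpow_eq_zpow_val, Units.val_mk0] at h1
  have h2 : (((2 : ℚ) ^ k : ℚ) : K) = (((2 : ℚ) ^ l : ℚ) : K) := by push_cast; exact h1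
  exact zpow_right_injective₀ (by norm_num) (by norm_num) (Rat.cast_injective h2)

/-- In characteristic zero `2` is not a root of unity, so evaluating at `2` in one coordinate
recovers the exponent. -/
theorem characterHom_injective [CharZero K] :
    Function.Injective (characterHom (K := K) (n := n)) := by
  classical
  intro w w' h
  have h1 : ∀ t : TorusHat K n, characterHat w t = characterHat w' t := fun t =>
    Units.ext (DFunLike.congr_fun h t)
  refine Prod.ext ?_ (funext fun i => ?_)
  · have := h1 (Units.mk0 2 two_ne_zero, 1)
    simp only [characterHat, character, Pi.one_apply, one_zpow, Finset.prod_const_one,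
      mul_one] at this
    exact zpow_two_unit_injective this
  · have := h1 (1, Function.update 1 i (Units.mk0 2 two_ne_zero))
    simp only [characterHat, character, one_zpow, one_mul] at this
    rw [Finset.prod_eq_single i, Finset.prod_eq_single i] at this
    · simpa using zpow_two_unit_injective (by simpa using this)
    all_goals simp +contextual

/-- Evaluation of a Laurent polynomial at a point of `T̂`. -/
def evalHat (t : TorusHat K n) : AddMonoidAlgebra K (ℤ × (Fin n → ℤ)) →ₐ[K] K :=
  AddMonoidAlgebra.lift K K _ ((Units.coeHom K).comp (weightHom t))

@[simp]
theorem evalHat_single (t : TorusHat K n) (w : ℤ × (Fin n → ℤ)) (c : K) :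
    evalHat t (AddMonoidAlgebra.single w c) = c * (characterHat w t : K) := by
  simp [evalHat, weightHom]

/-- Dedekind's linear independence of characters. -/
theorem eq_zero_of_forall_evalHat [CharZero K] {g : AddMonoidAlgebra K (ℤ × (Fin n → ℤ))}
    (h : ∀ t, evalHat t g = 0) : g = 0 := by
  have hli := (linearIndependent_monoidHom (TorusHat K n) K).comp _
    (characterHom_injective (n := n))
  rw [linearIndependent_iff] at hli
  rw [← AddMonoidAlgebra.coeff_eq_zero]
  refine hli _ (funext fun t => ?_)
  rw [Finsupp.linearCombination_apply, Finsupp.sum, Finset.sum_apply]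
  have := h t
  rw [evalHat, AddMonoidAlgebra.lift_apply, Finsupp.sum] at this
  simpa [weightHom] using this

end Characters

/-! ### Monomials and the toric parametrization -/

section Monomials

variable {K : Type*} [Field K] {n : ℕ} {P : NormalLatticePolytope n}

/-- The value at `v` of the monomial with exponent `a`. -/
def mon (v : P.Lam → K) (a : P.Lam →₀ ℕ) : K := ∏ χ, v χ ^ a χ

theorem eval_monomial_eq (v : P.Lam → K) (a : P.Lam →₀ ℕ) (c : K) :
    MvPolynomial.eval v (MvPolynomial.monomial a c) = c * mon v a := by
  rw [MvPolynomial.eval_monomial, Finsupp.prod_fintype _ _ (fun _ => pow_zero _), mon]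

theorem mon_add (v : P.Lam → K) (a b : P.Lam →₀ ℕ) : mon v (a + b) = mon v a * mon v b := by
  simp [mon, pow_add, Finset.prod_mul_distrib]

theorem mon_single (v : P.Lam → K) (χ : P.Lam) : mon v (Finsupp.single χ 1) = v χ := by
  classical
  rw [mon, Finset.prod_eq_single χ] <;> simp +contextual

theorem mon_ne_zero_iff (v : P.Lam → K) (a : P.Lam →₀ ℕ) :
    mon v a ≠ 0 ↔ SupportedOn {χ | v χ ≠ 0} a := by
  rw [mon, Finset.prod_ne_zero_iff]
  refine forall_congr' fun χ => ?_
  simp only [Finset.mem_univ, true_imp_iff, ne_eq, pow_eq_zero_iff', not_and, not_not,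
    Set.mem_ofPred_eq]

theorem mon_smul (c : K) (v : P.Lam → K) (a : P.Lam →₀ ℕ) :
    mon (c • v) a = c ^ a.degree * mon v a := by
  simp [mon, mul_pow, Finset.prod_mul_distrib, Finset.prod_pow_eq_pow_sum, Finsupp.degree_eq_sum]

theorem degree_eq_of_wt_eq {a b : P.Lam →₀ ℕ} (h : P.wt a = P.wt b) : a.degree = b.degree := by
  have := congrArg Prod.fst h
  rw [wt_fst, wt_fst] at this
  exact_mod_cast this

/-- The point `∑_{χ ∈ S} χ(t) e_χ` for `t ∈ T̂`. -/
def toricPoint (S : Set P.Lam) (t : TorusHat K n) : P.Lam → K :=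
  S.indicator fun χ => (characterHat (P.hat χ) t : K)

theorem toricPoint_of_mem {S : Set P.Lam} {χ : P.Lam} (h : χ ∈ S) (t : TorusHat K n) :
    toricPoint S t χ = (characterHat (P.hat χ) t : K) := Set.indicator_of_mem h _

theorem toricPoint_of_notMem {S : Set P.Lam} {χ : P.Lam} (h : χ ∉ S) (t : TorusHat K n) :
    toricPoint S t χ = 0 := Set.indicator_of_notMem h _

theorem toricPoint_ne_zero_iff {S : Set P.Lam} {χ : P.Lam} {t : TorusHat K n} :
    toricPoint S t χ ≠ 0 ↔ χ ∈ S := by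
  by_cases h : χ ∈ S
  · simp [toricPoint_of_mem h, h]
  · simp [toricPoint_of_notMem h, h]

theorem mon_toricPoint {S : Set P.Lam} {a : P.Lam →₀ ℕ} (ha : SupportedOn S a)
    (t : TorusHat K n) : mon (toricPoint S t) a = (characterHat (P.wt a) t : K) := by
  rw [wt_eq_sum, characterHat_sum, mon, Units.coe_prod]
  refine Finset.prod_congr rfl fun χ _ => ?_
  rw [characterHat_nsmul, Units.val_pow_eq_pow_val]
  by_cases h : χ ∈ S
  · rw [toricPoint_of_mem h]
  · simp [ha χ h]

theorem mon_toricPoint_of_not {S : Set P.Lam} {a : P.Lam →₀ ℕ} (ha : ¬ SupportedOn S a)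
    (t : TorusHat K n) : mon (toricPoint S t) a = 0 := by
  by_contra h
  refine ha ?_
  exact ((mon_ne_zero_iff _ _).1 h).mono fun χ => toricPoint_ne_zero_iff.1

theorem toricPoint_ne_zero {S : Set P.Lam} (hS : S.Nonempty) (t : TorusHat K n) :
    toricPoint S t ≠ 0 := by
  obtain ⟨χ, hχ⟩ := hS
  exact Function.ne_iff.2 ⟨χ, toricPoint_ne_zero_iff.2 hχ⟩

theorem characterHat_hat (χ : P.Lam) (t : TorusHat K n) :
    characterHat (P.hat χ) t = t.1 * character χ.1 t.2 := by
  simp [characterHat, hat]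

theorem toricPoint_eq_smul (S : Set P.Lam) (t : TorusHat K n) :
    toricPoint S t = (t.1 : K) • toricPoint S (1, t.2) := by
  ext χ
  by_cases h : χ ∈ S
  · simp [toricPoint_of_mem h, characterHat_hat]
  · simp [toricPoint_of_notMem h]

/-- The parametrization of the cone over an orbit closure: the algebra homomorphism sending the
coordinate `x_χ` to the Laurent monomial of weight `(1, χ)` if `χ ∈ S`, and to `0` otherwise. -/
def toricMap (K : Type*) [Field K] (S : Set P.Lam) :
    MvPolynomial P.Lam K →ₐ[K] AddMonoidAlgebra K (ℤ × (Fin n → ℤ)) :=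
  MvPolynomial.aeval (S.indicator fun χ => AddMonoidAlgebra.single (P.hat χ) 1)

theorem toricMap_X_of_mem {S : Set P.Lam} {χ : P.Lam} (h : χ ∈ S) :
    toricMap K S (MvPolynomial.X χ) = AddMonoidAlgebra.single (P.hat χ) 1 := by
  simp [toricMap, h]

theorem evalHat_toricMap (S : Set P.Lam) (t : TorusHat K n) (F : MvPolynomial P.Lam K) :
    evalHat t (toricMap K S F) = MvPolynomial.eval (toricPoint S t) F := by
  have : (evalHat t).comp (toricMap K S) = MvPolynomial.aeval (toricPoint S t) := by
    refine MvPolynomial.algHom_ext fun χ => ?_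
    by_cases h : χ ∈ S
    · simp [toricMap, toricPoint, h]
    · simp [toricMap, toricPoint, h]
  have h := DFunLike.congr_fun this F
  simpa [MvPolynomial.aeval_eq_eval] using h

variable [CharZero K]

theorem toricMap_eq_zero_iff {S : Set P.Lam} {F : MvPolynomial P.Lam K} :
    toricMap K S F = 0 ↔ ∀ t, MvPolynomial.eval (toricPoint S t) F = 0 := by
  simp only [← evalHat_toricMap]
  exact ⟨fun h t => by rw [h, map_zero], eq_zero_of_forall_evalHat⟩

theorem toricMap_monomial {S : Set P.Lam} {a : P.Lam →₀ ℕ} (ha : SupportedOn S a) (c : K) :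
    toricMap K S (MvPolynomial.monomial a c) = AddMonoidAlgebra.single (P.wt a) c := by
  rw [← sub_eq_zero]
  refine eq_zero_of_forall_evalHat fun t => ?_
  rw [map_sub, evalHat_toricMap, eval_monomial_eq, mon_toricPoint ha, evalHat_single, sub_self]

theorem toricMap_monomial_of_not {S : Set P.Lam} {a : P.Lam →₀ ℕ} (ha : ¬ SupportedOn S a)
    (c : K) : toricMap K S (MvPolynomial.monomial a c) = 0 := by
  refine eq_zero_of_forall_evalHat fun t => ?_
  rw [evalHat_toricMap, eval_monomial_eq, mon_toricPoint_of_not ha, mul_zero]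

/-- A linear form on polynomials that respects the binomial relations vanishes on the kernel of
the toric parametrization. -/
theorem map_eq_zero_of_toricMap_eq_zero {S : Set P.Lam} {D : MvPolynomial P.Lam K →ₗ[K] K}
    (hD : ∀ a b, SupportedOn S a → SupportedOn S b → P.wt a = P.wt b →
      D (MvPolynomial.monomial a 1) = D (MvPolynomial.monomial b 1))
    (hD0 : ∀ a, ¬ SupportedOn S a → D (MvPolynomial.monomial a 1) = 0)
    {F : MvPolynomial P.Lam K} (hF : toricMap K S F = 0) : D F = 0 := by
  classical
  -- The value at a weight is read off from an arbitrary exponent of that weight; `hD` makes the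
  -- choice immaterial, so `D` factors through the parametrization.
  let d : ℤ × (Fin n → ℤ) → K := fun w =>
    if h : ∃ a : P.Lam →₀ ℕ, SupportedOn S a ∧ P.wt a = w then
      D (MvPolynomial.monomial h.choose 1) else 0
  let D' : AddMonoidAlgebra K (ℤ × (Fin n → ℤ)) →+ K :=
    (Finsupp.linearCombination K d).toAddMonoidHom.comp
      (AddMonoidAlgebra.coeffAddEquiv (R := K) (M := ℤ × (Fin n → ℤ))).toAddMonoidHom
  have hD's : ∀ w c, D' (AddMonoidAlgebra.single w c) = c * d w := fun w c => by
    change Finsupp.linearCombination K d (AddMonoidAlgebra.single w c).coeff = _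
    rw [AddMonoidAlgebra.coeff_single, Finsupp.linearCombination_single, smul_eq_mul]
  have hmon : ∀ a c, D (MvPolynomial.monomial a c) =
      D' (toricMap K S (MvPolynomial.monomial a c)) := by
    intro a c
    have hc : D (MvPolynomial.monomial a c) = c * D (MvPolynomial.monomial a 1) := by
      rw [← smul_eq_mul, ← map_smul, MvPolynomial.smul_monomial, smul_eq_mul, mul_one]
    by_cases ha : SupportedOn S a
    · have h : ∃ b : P.Lam →₀ ℕ, SupportedOn S b ∧ P.wt b = P.wt a := ⟨a, ha, rfl⟩
      rw [toricMap_monomial ha, hD's, hc]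
      simp only [d, dif_pos h]
      rw [hD a _ ha h.choose_spec.1 h.choose_spec.2.symm]
    · rw [toricMap_monomial_of_not ha, map_zero, hc, hD0 a ha, mul_zero]
  have : ∀ F, D F = D' (toricMap K S F) := fun F => by
    induction F using MvPolynomial.induction_on' with
    | monomial a c => exact hmon a c
    | add p q hp hq => rw [map_add, map_add, map_add, hp, hq]
  rw [this, hF, map_zero]

end Monomials

/-! ### The cone over an orbit closure -/

section Cone

variable {K : Type*} [Field K] {n : ℕ} {P : NormalLatticePolytope n}

/-- The vectors supported on `S` that satisfy all binomial relations. -/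
def IsToric (S : Set P.Lam) (v : P.Lam → K) : Prop :=
  (∀ χ, χ ∉ S → v χ = 0) ∧ ∀ a b, P.wt a = P.wt b → mon v a = mon v b

theorem IsToric.smul {S : Set P.Lam} {v : P.Lam → K} (hv : IsToric S v) (c : K) :
    IsToric S (c • v) :=
  ⟨fun χ hχ => by simp [hv.1 χ hχ], fun a b hab => by
    rw [mon_smul, mon_smul, hv.2 a b hab, degree_eq_of_wt_eq hab]⟩

theorem isToric_smul_iff {S : Set P.Lam} {v : P.Lam → K} (c : Kˣ) :
    IsToric S (c • v) ↔ IsToric S v := by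
  refine ⟨fun h => ?_, fun h => h.smul (c : K)⟩
  have := h.smul ((c⁻¹ : Kˣ) : K)
  rwa [← Units.smul_def, inv_smul_smul] at this

theorem isToric_toricPoint (σ : P.Face) (t : TorusHat K n) :
    IsToric (latticePoints σ) (toricPoint (latticePoints σ) t) := by
  refine ⟨fun χ hχ => toricPoint_of_notMem hχ t, fun a b hab => ?_⟩
  by_cases ha : SupportedOn (latticePoints σ) a
  · rw [mon_toricPoint ha, mon_toricPoint ((supportedOn_congr hab).1 ha), hab]
  · rw [mon_toricPoint_of_not ha, mon_toricPoint_of_not fun hb => ha ((supportedOn_congr hab).2 hb)]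

theorem IsToric.mon_eq_zero {S : Set P.Lam} {v : P.Lam → K} (hv : IsToric S v)
    {a : P.Lam →₀ ℕ} (ha : ¬ SupportedOn S a) : mon v a = 0 := by
  by_contra h
  refine ha (((mon_ne_zero_iff _ _).1 h).mono fun χ hχ => ?_)
  by_contra hcon
  exact hχ (hv.1 χ hcon)

theorem orbit_eq (σ : P.Face) : orbit K P σ.1 = {p | ∃ t : Torus K n,
    p = Projectivization.mk K (toricPoint (latticePoints σ) (1, t))
      (toricPoint_ne_zero (latticePoints_nonempty σ) _)} := by
  have key : ∀ t : Torus K n, Set.indicator {χ : P.Lam | toReal χ.1 ∈ σ.1}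
      (fun χ => (character χ.1 t : K)) = toricPoint (latticePoints σ) (1, t) := by
    intro t
    simp only [toricPoint, latticePoints, characterHat_hat, one_mul]
  ext p
  constructor
  · rintro ⟨t, h, rfl⟩
    exact ⟨t, by simp only [key]⟩
  · rintro ⟨t, rfl⟩
    refine ⟨t, ?_, ?_⟩
    · rw [key]
      exact toricPoint_ne_zero (latticePoints_nonempty σ) _
    · simp only [key]

theorem orbitClosure_topFace : orbitClosure K P P.topFace = toricVariety K P := by
  rw [orbitClosure, toricVariety, orbit_eq]
  congr 1
  have key : ∀ t : Torus K n, (fun χ : P.Lam => (character χ.1 t : K)) =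
      toricPoint (latticePoints P.topFace) (1, t) := by
    intro t
    ext χ
    rw [toricPoint_of_mem (by simp [latticePoints_topFace]), characterHat_hat, one_mul]
  ext p
  constructor
  · rintro ⟨t, h⟩
    refine ⟨t, ?_, ?_⟩
    · rw [key]
      exact toricPoint_ne_zero (latticePoints_nonempty _) _
    · simpa only [key] using h
  · rintro ⟨t, h, rfl⟩
    exact ⟨t, by simp only [key]⟩

theorem isClosed_isToric (S : Set P.Lam) :
    IsClosed {p : ℙ K (P.Lam → K) | IsToric S p.rep} := by
  rw [isClosed_iff]
  refine ⟨{F | (∃ χ ∉ S, F = MvPolynomial.X χ) ∨ ∃ a b, P.wt a = P.wt b ∧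
    F = MvPolynomial.monomial a 1 - MvPolynomial.monomial b 1}, ?_, ?_⟩
  · rintro F (⟨χ, -, rfl⟩ | ⟨a, b, hab, rfl⟩)
    · exact ⟨1, MvPolynomial.isHomogeneous_X K χ⟩
    -- The binomials are homogeneous because the first coordinate of the weight is the degree.
    · exact ⟨a.degree, (MvPolynomial.isHomogeneous_monomial _ rfl).sub
        (MvPolynomial.isHomogeneous_monomial _ (degree_eq_of_wt_eq hab).symm)⟩
  · ext p
    constructor
    · rintro ⟨h1, h2⟩ F (⟨χ, hχ, rfl⟩ | ⟨a, b, hab, rfl⟩)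
      · simpa using h1 χ hχ
      · rw [map_sub, eval_monomial_eq, eval_monomial_eq, h2 a b hab, sub_self]
    · intro h
      refine ⟨fun χ hχ => ?_, fun a b hab => ?_⟩
      · simpa using h _ (Or.inl ⟨χ, hχ, rfl⟩)
      · have := h _ (Or.inr ⟨a, b, hab, rfl⟩)
        rw [map_sub, eval_monomial_eq, eval_monomial_eq, one_mul, one_mul, sub_eq_zero] at this
        exact this

theorem isToric_rep_mk {S : Set P.Lam} {v : P.Lam → K} (hv : v ≠ 0) :
    IsToric S (Projectivization.mk K v hv).rep ↔ IsToric S v := by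
  obtain ⟨a, ha⟩ := Projectivization.exists_smul_eq_mk_rep K v hv
  rw [← ha, isToric_smul_iff]

theorem eval_smul_of_isHomogeneous {ι : Type*} {F : MvPolynomial ι K} {d : ℕ}
    (hF : F.IsHomogeneous d) (c : K) (v : ι → K) :
    MvPolynomial.eval (c • v) F = c ^ d * MvPolynomial.eval v F := by
  rw [MvPolynomial.eval_eq, MvPolynomial.eval_eq, Finset.mul_sum]
  refine Finset.sum_congr rfl fun s hs => ?_
  have hd : s.degree = d := by
    have := hF (MvPolynomial.mem_support_iff.1 hs)
    rwa [Finsupp.degree_eq_weight_one]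
  have : ∏ i ∈ s.support, c ^ s i = c ^ d := by
    rw [Finset.prod_pow_eq_pow_sum, ← hd]; rfl
  simp only [Pi.smul_apply, smul_eq_mul, mul_pow, Finset.prod_mul_distrib, this]
  ring

variable [CharZero K]

/-- Evaluation at a toric vector is a linear form that respects the binomial relations, hence it
kills the toric ideal. -/
theorem eval_eq_zero_of_isToric {S : Set P.Lam} {v : P.Lam → K} (hv : IsToric S v)
    {F : MvPolynomial P.Lam K} (hF : toricMap K S F = 0) : MvPolynomial.eval v F = 0 := by
  have := map_eq_zero_of_toricMap_eq_zero (D := (MvPolynomial.aeval v).toLinearMap)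
    (fun a b _ _ hab => by
      simp only [AlgHom.toLinearMap_apply, MvPolynomial.aeval_eq_eval]
      rw [eval_monomial_eq, eval_monomial_eq, hv.2 a b hab])
    (fun a ha => by
      simp only [AlgHom.toLinearMap_apply, MvPolynomial.aeval_eq_eval]
      rw [eval_monomial_eq, hv.mon_eq_zero ha, mul_zero]) hF
  simpa [MvPolynomial.aeval_eq_eval] using this

theorem toricMap_eq_zero_of_isHomogeneous {S : Set P.Lam} {F : MvPolynomial P.Lam K} {d : ℕ}
    (hF : F.IsHomogeneous d)
    (h : ∀ t : Torus K n, MvPolynomial.eval (toricPoint S (1, t)) F = 0) :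
    toricMap K S F = 0 := by
  rw [toricMap_eq_zero_iff]
  intro t
  rw [toricPoint_eq_smul, eval_smul_of_isHomogeneous hF, h, mul_zero]

/-- The binomial relations are closed conditions that hold on the orbit. Conversely, a homogeneous
polynomial vanishing on the orbit lies in the toric ideal, so it vanishes at every toric vector. -/
theorem mem_orbitClosure_iff {σ : P.Face} {p : ℙ K (P.Lam → K)} :
    p ∈ orbitClosure K P σ ↔ IsToric (latticePoints σ) p.rep := by
  constructor
  · intro h
    refine closure_minimal (t := {p : ℙ K (P.Lam → K) | IsToric (latticePoints σ) p.rep})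
      ?_ (isClosed_isToric _) h
    rw [orbit_eq]
    rintro _ ⟨t, rfl⟩
    exact (isToric_rep_mk _).2 (isToric_toricPoint σ _)
  · intro h
    refine Set.mem_sInter.2 ?_
    rintro C ⟨hC, hsub⟩
    obtain ⟨T, hT, rfl⟩ := isClosed_iff.1 hC
    intro F hF
    obtain ⟨d, hd⟩ := hT F hF
    refine eval_eq_zero_of_isToric h (toricMap_eq_zero_of_isHomogeneous hd fun t => ?_)
    have := hsub (by rw [orbit_eq]; exact ⟨t, rfl⟩) F hF
    rwa [eval_rep_eq_zero_iff hd] at this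

theorem mem_affineCone_orbitClosure_iff {σ : P.Face} {v : P.Lam → K} :
    v ∈ affineCone (orbitClosure K P σ) ↔ IsToric (latticePoints σ) v := by
  simp only [affineCone, Set.mem_ofPred_eq, mem_orbitClosure_iff, isToric_rep_mk]
  by_cases hv : v = 0
  · subst hv
    simp only [ne_eq, not_true_eq_false, false_imp_iff, true_iff]
    have := (isToric_toricPoint (K := K) σ 1).smul 0
    simpa using this
  · exact ⟨fun h => h hv, fun h _ => h⟩

theorem mem_vanishingIdeal_orbitClosure_iff {σ : P.Face} {F : MvPolynomial P.Lam K} :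
    F ∈ MvPolynomial.vanishingIdeal K (affineCone (orbitClosure K P σ)) ↔
      toricMap K (latticePoints σ) F = 0 := by
  rw [MvPolynomial.mem_vanishingIdeal_iff]
  simp only [MvPolynomial.aeval_eq_eval]
  constructor
  · intro h
    rw [toricMap_eq_zero_iff]
    exact fun t => h _ (mem_affineCone_orbitClosure_iff.2 (isToric_toricPoint σ t))
  · intro h v hv
    exact eval_eq_zero_of_isToric (mem_affineCone_orbitClosure_iff.1 hv) h

theorem vanishingIdeal_orbitClosure (σ : P.Face) :
    MvPolynomial.vanishingIdeal K (affineCone (orbitClosure K P σ)) =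
      RingHom.ker (toricMap K (latticePoints σ)) := by
  ext F
  rw [mem_vanishingIdeal_orbitClosure_iff, RingHom.mem_ker]

/-- Irreducibility reflects that the group algebra of `ℤ × ℤⁿ` is a domain: two proper closed
subsets covering the orbit would give nonzero Laurent polynomials with product zero. -/
theorem isProjectiveVariety_orbitClosure (σ : P.Face) :
    IsProjectiveVariety (orbitClosure K P σ) := by
  refine ⟨isClosed_closure, IsIrreducible.closure ⟨?_, ?_⟩⟩
  · rw [orbit_eq]
    exact ⟨_, 1, rfl⟩
  · rw [isPreirreducible_iff_isClosed_union_isClosed]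
    intro Z₁ Z₂ hZ₁ hZ₂ hsub
    by_contra! hcon
    have key : ∀ Z : Set (ℙ K (P.Lam → K)), IsClosed Z → ¬ orbit K P σ.1 ⊆ Z →
        ∃ (F : MvPolynomial P.Lam K) (d : ℕ), F.IsHomogeneous d ∧
          toricMap K (latticePoints σ) F ≠ 0 ∧ ∀ p ∈ Z, MvPolynomial.eval p.rep F = 0 := by
      intro Z hZ hne
      obtain ⟨T, hT, rfl⟩ := isClosed_iff.1 hZ
      obtain ⟨p, hp, hpT⟩ := Set.not_subset.1 hne
      simp only [projZeros, Set.mem_ofPred_eq, not_forall] at hpT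
      obtain ⟨F, hF, hFp⟩ := hpT
      obtain ⟨d, hd⟩ := hT F hF
      refine ⟨F, d, hd, fun h0 => ?_, fun p hp => hp F hF⟩
      rw [orbit_eq] at hp
      obtain ⟨t, rfl⟩ := hp
      rw [eval_rep_eq_zero_iff hd] at hFp
      exact hFp (toricMap_eq_zero_iff.1 h0 _)
    obtain ⟨F, d, hF, hF0, hFZ⟩ := key Z₁ hZ₁ hcon.1
    obtain ⟨G, e, hG, hG0, hGZ⟩ := key Z₂ hZ₂ hcon.2
    have hFG : toricMap K (latticePoints σ) (F * G) = 0 := by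
      refine toricMap_eq_zero_of_isHomogeneous (hF.mul hG) fun t => ?_
      have hp : Projectivization.mk K (toricPoint (latticePoints σ) (1, t))
          (toricPoint_ne_zero (latticePoints_nonempty σ) _) ∈ orbit K P σ.1 := by
        rw [orbit_eq]; exact ⟨t, rfl⟩
      rw [map_mul]
      rcases hsub hp with h | h
      · have := hFZ _ h
        rw [eval_rep_eq_zero_iff hF] at this
        rw [this, zero_mul]
      · have := hGZ _ h
        rw [eval_rep_eq_zero_iff hG] at this
        rw [this, mul_zero]
    rw [map_mul] at hFG
    exact (mul_ne_zero hF0 hG0) hFG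

end Cone

/-! ### The orbit decomposition -/

section Orbits

variable {n : ℕ} {P : NormalLatticePolytope n}

/-- The positive part of an integer valued function on a set of lattice points. -/
def posExponent {S : Set P.Lam} (c : S → ℤ) : P.Lam →₀ ℕ :=
  open Classical in
  Finsupp.equivFunOnFinite.symm fun χ => if hχ : χ ∈ S then (c ⟨χ, hχ⟩).toNat else 0

theorem supportedOn_posExponent {S : Set P.Lam} (c : S → ℤ) : SupportedOn S (posExponent c) :=
  fun χ hχ => by simp [posExponent, hχ]

theorem sum_smul_eq_posExponent {B : Type*} [AddCommGroup B] {S : Set P.Lam} [Fintype S]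
    (c : S → ℤ) (v : P.Lam → B) :
    ∑ χ : S, c χ • v χ = ∑ χ, posExponent c χ • v χ - ∑ χ, posExponent (-c) χ • v χ := by
  rw [← Finset.sum_sub_distrib]
  refine Fintype.sum_of_injective (Subtype.val : S → P.Lam)
    Subtype.val_injective _ _ (fun χ hχ => ?_) (fun χ => ?_)
  · have : χ ∉ S := by simpa using hχ
    simp [posExponent, this]
  · simp only [posExponent, Finsupp.equivFunOnFinite_symm_apply_apply, χ.2, dif_pos]
    rw [← natCast_zsmul, ← natCast_zsmul, ← sub_smul, Pi.neg_apply, Int.toNat_sub_toNat_neg]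

/-- A function on a set of lattice points that respects their additive relations is induced by a
homomorphism on the lattice that they span. -/
theorem exists_linearMap_of_relations {A : Type*} [AddCommGroup A] (S : Set P.Lam) (u : P.Lam → A)
    (h : ∀ a b : P.Lam →₀ ℕ, SupportedOn S a → SupportedOn S b → P.wt a = P.wt b →
      ∑ χ, a χ • u χ = ∑ χ, b χ • u χ) :
    ∃ g : Submodule.span ℤ (P.hat '' S) →ₗ[ℤ] A,
      ∀ (χ : P.Lam) (hχ : χ ∈ S), g ⟨P.hat χ, Submodule.subset_span ⟨χ, hχ, rfl⟩⟩ = u χ := by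
  classical
  let x : S → Submodule.span ℤ (P.hat '' S) := fun χ =>
    ⟨P.hat χ.1, Submodule.subset_span ⟨χ.1, χ.2, rfl⟩⟩
  let f := Fintype.linearCombination ℤ x
  let k := Fintype.linearCombination ℤ fun χ : S => u χ.1
  have hf : Function.Surjective f := by
    rw [← LinearMap.range_eq_top, Fintype.range_linearCombination]
    have : Set.range x = Subtype.val ⁻¹' (P.hat '' S) := by
      ext ⟨y, hy⟩
      constructor
      · rintro ⟨χ, hχ⟩
        exact ⟨χ.1, χ.2, congrArg Subtype.val hχ⟩
      · rintro ⟨χ, hχ, hχy⟩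
        exact ⟨⟨χ, hχ⟩, Subtype.ext hχy⟩
    rw [this]
    exact Submodule.span_span_coe_preimage
  -- Splitting an integral relation into positive and negative parts turns it into two exponents of
  -- equal weight, to which the hypothesis applies.
  have hker : LinearMap.ker f ≤ LinearMap.ker k := by
    intro c hc
    have hwt : P.wt (posExponent c) = P.wt (posExponent (-c)) := by
      have h1 : ∑ χ : S, c χ • P.hat χ.1 = 0 := by
        have := congrArg Subtype.val (LinearMap.mem_ker.1 hc)
        simpa [f, x, Fintype.linearCombination_apply] using this
      rw [sum_smul_eq_posExponent, sub_eq_zero] at h1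
      rw [wt_eq_sum, wt_eq_sum, h1]
    rw [LinearMap.mem_ker]
    change ∑ χ : S, c χ • u χ.1 = 0
    rw [sum_smul_eq_posExponent, h _ _ (supportedOn_posExponent c) (supportedOn_posExponent (-c))
      hwt, sub_self]
  refine ⟨(LinearMap.ker f).liftQ k hker ∘ₗ (f.quotKerEquivOfSurjective hf).symm, fun χ hχ => ?_⟩
  have h1 : f (Pi.single ⟨χ, hχ⟩ 1) = ⟨P.hat χ, Submodule.subset_span ⟨χ, hχ, rfl⟩⟩ := by
    simp [f, x, Fintype.linearCombination_apply_single]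
  rw [← h1, LinearMap.comp_apply, LinearEquiv.coe_coe,
    LinearMap.quotKerEquivOfSurjective_symm_apply, Submodule.liftQ_apply]
  simp [k, Fintype.linearCombination_apply_single]

variable {K : Type*} [Field K]

theorem exists_characterHat_eq (h : ℤ × (Fin n → ℤ) →ₗ[ℤ] Additive Kˣ) :
    ∃ t : TorusHat K n, ∀ w, characterHat w t = (h w).toMul := by
  classical
  refine ⟨((h (1, 0)).toMul, fun i => (h (0, Pi.single i 1)).toMul), fun w => ?_⟩
  have hw : w = w.1 • ((1 : ℤ), (0 : Fin n → ℤ)) +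
      ∑ i, w.2 i • ((0 : ℤ), (Pi.single i (1 : ℤ) : Fin n → ℤ)) := by
    refine Prod.ext ?_ (funext fun i => ?_)
    · simp [Prod.fst_sum]
    · simp [Prod.snd_sum, Finset.sum_apply, Pi.single_apply]
  conv_rhs => rw [hw, map_add, map_smul, map_sum]
  simp only [map_smul, toMul_add, toMul_zsmul, toMul_sum, characterHat, character]

/-- Over an algebraically closed field `Kˣ` is divisible, hence an injective `ℤ`-module. A character
of any sublattice, saturated or not, thus extends to `ℤ × ℤⁿ` and is given by a torus point. -/
theorem baer_additive_units [IsAlgClosed K] : Module.Baer ℤ (Additive Kˣ) := by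
  have hsurj : ∀ {k : ℕ}, k ≠ 0 → Function.Surjective fun a : Additive Kˣ => k • a := by
    intro k hk a
    obtain ⟨z, hz⟩ := IsAlgClosed.exists_pow_nat_eq (a.toMul : K) (Nat.pos_of_ne_zero hk)
    have hz0 : z ≠ 0 := by
      rintro rfl
      rw [zero_pow hk] at hz
      exact a.toMul.ne_zero hz.symm
    refine ⟨Additive.ofMul (Units.mk0 z hz0), ?_⟩
    apply Additive.toMul.injective
    ext
    simpa using hz
  let _ : DivisibleBy (Additive Kˣ) ℕ := divisibleByOfSMulRightSurj _ _ hsurj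
  let _ : DivisibleBy (Additive Kˣ) ℤ := AddGroup.divisibleByIntOfDivisibleByNat _
  exact Module.Baer.of_divisible _

/-- Every nonzero point of the cone over an orbit closure lies on the cone over an orbit. -/
theorem IsToric.exists_eq_toricPoint [IsAlgClosed K] {σ : P.Face} {v : P.Lam → K}
    (hv : IsToric (latticePoints σ) v) (hv0 : v ≠ 0) :
    ∃ τ : P.Face, τ ≤ σ ∧ ∃ t : TorusHat K n, v = toricPoint (latticePoints τ) t := by
  obtain ⟨τ, hSτ, hint⟩ := exists_face_of_nonempty (S := {χ | v χ ≠ 0}) (Function.ne_iff.1 hv0)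
  -- The support of `v` fills the smallest face `τ` around it: a vanishing coordinate in `τ` would
  -- divide a power of a nonvanishing monomial.
  have hτS : ∀ χ ∈ latticePoints τ, v χ ≠ 0 := by
    intro χ hχ h0
    obtain ⟨N, a, -, hN⟩ := hint.exists_nsmul_wt_eq hχ
    have h1 : mon v (N • ones {χ | v χ ≠ 0}) = mon v (Finsupp.single χ 1 + a) :=
      hv.2 _ _ (by rw [map_nsmul, map_add, wt_single, one_smul, hN])
    have h2 : mon v (N • ones {χ | v χ ≠ 0}) ≠ 0 :=
      (mon_ne_zero_iff _ _).2 ((supportedOn_ones _).nsmul N)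
    rw [h1, mon_add, mon_single, h0, zero_mul] at h2
    exact h2 rfl
  refine ⟨τ, le_iff_latticePoints_subset.2 fun χ hχ => ?_, ?_⟩
  · by_contra hcon
    exact hτS χ hχ (hv.1 χ hcon)
  · classical
    -- The coordinates of `v` on `τ`, read as values of a character; the default `0` is the unit `1`
    -- and is never used on `τ`.
    let u : P.Lam → Additive Kˣ := fun χ =>
      if h : v χ ≠ 0 then Additive.ofMul (Units.mk0 (v χ) h) else 0
    have hu : ∀ a : P.Lam →₀ ℕ, SupportedOn (latticePoints τ) a →
        (((∑ χ, a χ • u χ : Additive Kˣ).toMul : Kˣ) : K) = mon v a := by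
      intro a ha
      rw [toMul_sum, Units.coe_prod, mon]
      refine Finset.prod_congr rfl fun χ _ => ?_
      by_cases hχ : χ ∈ latticePoints τ
      · simp [u, hτS χ hχ]
      · simp [ha χ hχ]
    obtain ⟨g, hg⟩ := exists_linearMap_of_relations (latticePoints τ) u (fun a b ha hb hab => by
      apply Additive.toMul.injective
      ext
      rw [hu a ha, hu b hb, hv.2 a b hab])
    obtain ⟨h, hh⟩ := baer_additive_units.extension_property
      (Submodule.subtype (Submodule.span ℤ (P.hat '' latticePoints τ)))
      (Submodule.injective_subtype _) g
    obtain ⟨t, ht⟩ := exists_characterHat_eq h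
    refine ⟨t, funext fun χ => ?_⟩
    by_cases hχ : χ ∈ latticePoints τ
    · rw [toricPoint_of_mem hχ, ht]
      have h1 : h (P.hat χ) = u χ := by
        rw [← hg χ hχ, ← hh]
        rfl
      rw [h1]
      simp [u, hτS χ hχ]
    · rw [toricPoint_of_notMem hχ]
      by_contra hne
      exact hχ (hSτ hne)

end Orbits

/-! ### Krull dimension of subspaces -/

section KrullDim

variable {T : Type*} [TopologicalSpace T]

/-- Closures in `T` of a chain in `Y` form a chain again, and the largest one, being irreducible,
lies in a single member of the finite closed cover. -/
theorem topologicalKrullDim_le_of_subset_iUnion {ι : Type*} [Finite ι] {Y : Set T}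
    (X : ι → IrreducibleCloseds T) {d : ℕ∞} (hd : ∀ i, Order.height (X i) ≤ d)
    (h : Y ⊆ ⋃ i, (X i : Set T)) : topologicalKrullDim Y ≤ d := by
  refine iSup_le fun p => ?_
  let f : IrreducibleCloseds Y → IrreducibleCloseds T :=
    IrreducibleCloseds.map Subtype.val continuous_subtype_val
  have hf : StrictMono f :=
    IrreducibleCloseds.map_strictMono_of_isInducing Topology.IsInducing.subtypeVal
  obtain ⟨i, hi⟩ : ∃ i, (f p.last : Set T) ⊆ X i := by
    have h1 : (f p.last : Set T) ⊆ ⋃ i, (X i : Set T) := by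
      refine closure_minimal ?_ (isClosed_iUnion_of_finite fun i => (X i).isClosed)
      rintro _ ⟨y, -, rfl⟩
      exact h y.2
    have h2 := isIrreducible_iff_sUnion_isClosed.1 (f p.last).isIrreducible
      (Set.finite_range fun i => (X i : Set T)).toFinset
      (by simpa using fun i => (X i).isClosed) (by simpa [Set.sUnion_range] using h1)
    obtain ⟨z, hz, hsub⟩ := h2
    obtain ⟨i, rfl⟩ := (Set.Finite.mem_toFinset _).1 hz
    exact ⟨i, hsub⟩
  have h3 : ((p.map f hf).length : ℕ∞) ≤ Order.height (X i) := Order.length_le_height hi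
  exact_mod_cast h3.trans (hd i)

theorem isIrreducible_preimage_subtypeVal {X V : Set T} (hV : IsIrreducible V) (h : V ⊆ X) :
    IsIrreducible (Subtype.val ⁻¹' V : Set X) := by
  obtain ⟨x, hx⟩ := hV.nonempty
  refine ⟨⟨⟨x, h hx⟩, hx⟩, ?_⟩
  rw [isPreirreducible_iff_isClosed_union_isClosed]
  intro Z₁ Z₂ hZ₁ hZ₂ hsub
  obtain ⟨C₁, hC₁, rfl⟩ := isClosed_induced_iff.1 hZ₁
  obtain ⟨C₂, hC₂, rfl⟩ := isClosed_induced_iff.1 hZ₂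
  rcases isPreirreducible_iff_isClosed_union_isClosed.1 hV.isPreirreducible C₁ C₂ hC₁ hC₂
    (fun y hy => hsub (show (⟨y, h hy⟩ : X) ∈ _ from hy)) with h' | h'
  · exact Or.inl fun y hy => h' hy
  · exact Or.inr fun y hy => h' hy

theorem topologicalKrullDim_eq_height (X : IrreducibleCloseds T) :
    topologicalKrullDim (X : Set T) = Order.height X := by
  apply le_antisymm
  · exact topologicalKrullDim_le_of_subset_iUnion (fun _ : Unit => X) (fun _ => le_rfl)
      (Set.subset_iUnion (fun _ : Unit => (X : Set T)) ())
  · let f : Set.Iic X → IrreducibleCloseds (X : Set T) := fun V =>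
      ⟨Subtype.val ⁻¹' (V.1 : Set T), isIrreducible_preimage_subtypeVal V.1.isIrreducible V.2,
        V.1.isClosed.preimage continuous_subtype_val⟩
    have hf : StrictMono f := by
      refine Monotone.strictMono_of_injective (fun V W h x hx => h hx) fun V W h => ?_
      have h' : (Subtype.val ⁻¹' (V.1 : Set T) : Set (X : Set T)) = Subtype.val ⁻¹' (W.1 : Set T) :=
        congrArg IrreducibleCloseds.carrier h
      refine Subtype.ext (IrreducibleCloseds.ext ?_)
      rw [Subtype.preimage_val_eq_preimage_val_iff] at h'
      have hV : (V.1 : Set T) ⊆ X := V.2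
      have hW : (W.1 : Set T) ⊆ X := W.2
      rwa [Set.inter_eq_right.2 hV, Set.inter_eq_right.2 hW] at h'
    rw [Order.height_eq_krullDim_Iic]
    exact Order.krullDim_le_of_strictMono f hf

end KrullDim

/-! ### Homogeneous primes -/

section Primes

variable {K : Type*} [Field K] {ι : Type*}

/-- The restriction of a polynomial to the line spanned by `v`. -/
def restrictLine (v : ι → K) : MvPolynomial ι K →ₐ[K] Polynomial K :=
  MvPolynomial.aeval fun i => Polynomial.C (v i) * Polynomial.X

theorem eval_restrictLine (v : ι → K) (F : MvPolynomial ι K) (c : K) :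
    (restrictLine v F).eval c = MvPolynomial.eval (c • v) F := by
  have : (Polynomial.aeval c).comp (restrictLine v) = MvPolynomial.aeval (R := K) (c • v) := by
    refine MvPolynomial.algHom_ext fun i => ?_
    simp only [restrictLine, AlgHom.comp_apply, MvPolynomial.aeval_X, map_mul, Polynomial.aeval_C,
      Polynomial.aeval_X, Pi.smul_apply, smul_eq_mul, Algebra.algebraMap_self, RingHom.id_apply]
    exact mul_comm _ _
  have h := DFunLike.congr_fun this F
  simpa [MvPolynomial.aeval_eq_eval, Polynomial.aeval_def] using h

theorem vanishingIdeal_affineCone_anti {Z Z' : Set (ℙ K (ι → K))} (h : Z ⊆ Z') :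
    MvPolynomial.vanishingIdeal K (affineCone Z') ≤
      MvPolynomial.vanishingIdeal K (affineCone Z) :=
  MvPolynomial.vanishingIdeal_anti_mono fun _ hv hv0 => h (hv hv0)

variable [Infinite K]

theorem restrictLine_of_isHomogeneous {F : MvPolynomial ι K} {d : ℕ} (hF : F.IsHomogeneous d)
    (v : ι → K) : restrictLine v F = Polynomial.monomial d (MvPolynomial.eval v F) := by
  refine Polynomial.funext fun c => ?_
  rw [eval_restrictLine, eval_smul_of_isHomogeneous hF, Polynomial.eval_monomial, mul_comm]

theorem coeff_restrictLine (v : ι → K) (F : MvPolynomial ι K) (d : ℕ) :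
    (restrictLine v F).coeff d =
      MvPolynomial.eval v (MvPolynomial.homogeneousComponent d F) := by
  conv_lhs => rw [← MvPolynomial.sum_homogeneousComponent F]
  rw [map_sum, Polynomial.finsetSum_coeff]
  simp only [restrictLine_of_isHomogeneous (MvPolynomial.homogeneousComponent_isHomogeneous _ F),
    Polynomial.coeff_monomial]
  rw [Finset.sum_ite_eq']
  split_ifs with h
  · rfl
  · rw [MvPolynomial.homogeneousComponent_eq_zero, map_zero]
    simpa using h

theorem restrictLine_eq_zero_iff {v : ι → K} {F : MvPolynomial ι K} :
    restrictLine v F = 0 ↔ ∀ c : K, MvPolynomial.eval (c • v) F = 0 := by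
  simp only [← eval_restrictLine]
  exact ⟨fun h c => by rw [h, Polynomial.eval_zero], fun h => Polynomial.funext (by simpa using h)⟩

/-- Restriction to lines handles inhomogeneous polynomials: the coefficients of the restriction are
the values of the homogeneous components, so vanishing on a whole line is a closed condition on the
point. -/
theorem mem_vanishingIdeal_affineCone_iff {Z : Set (ℙ K (ι → K))} (hZ : Z.Nonempty)
    {F : MvPolynomial ι K} : F ∈ MvPolynomial.vanishingIdeal K (affineCone Z) ↔
      ∀ p ∈ Z, restrictLine p.rep F = 0 := by
  rw [MvPolynomial.mem_vanishingIdeal_iff]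
  simp only [MvPolynomial.aeval_eq_eval, restrictLine_eq_zero_iff]
  constructor
  · intro h p hp c
    refine h _ fun hne => ?_
    have : Projectivization.mk K (c • p.rep) hne = p := by
      conv_rhs => rw [← p.mk_rep]
      exact (Projectivization.mk_eq_mk_iff' K _ _ _ _).2 ⟨c, rfl⟩
    rwa [this]
  · intro h v hv
    by_cases hv0 : v = 0
    · obtain ⟨p, hp⟩ := hZ
      have := h p hp 0
      rwa [zero_smul, ← hv0] at this
    · obtain ⟨a, ha⟩ := Projectivization.exists_smul_eq_mk_rep K v hv0
      have := h _ (hv hv0) (a⁻¹ : Kˣ)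
      rwa [← ha, Units.smul_def, smul_smul, Units.inv_mul, one_smul] at this

theorem isClosed_restrictLine_eq_zero (F : MvPolynomial ι K) :
    IsClosed {p : ℙ K (ι → K) | restrictLine p.rep F = 0} := by
  rw [isClosed_iff]
  refine ⟨Set.range fun d => MvPolynomial.homogeneousComponent d F, ?_, ?_⟩
  · rintro _ ⟨d, rfl⟩
    exact ⟨d, MvPolynomial.homogeneousComponent_isHomogeneous d F⟩
  · ext p
    simp [projZeros, Polynomial.ext_iff, coeff_restrictLine]

/-- On each line a product of two univariate polynomials vanishes, so one factor does. The two
resulting closed sets cover the irreducible `Z`. -/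
theorem isPrime_vanishingIdeal_affineCone {Z : Set (ℙ K (ι → K))} (hZ : IsIrreducible Z) :
    (MvPolynomial.vanishingIdeal K (affineCone Z)).IsPrime := by
  refine Ideal.isPrime_iff.2 ⟨fun h => ?_, fun {F G} hFG => ?_⟩
  · obtain ⟨p, hp⟩ := hZ.nonempty
    have h1 : (1 : MvPolynomial ι K) ∈ MvPolynomial.vanishingIdeal K (affineCone Z) := by
      rw [h]; trivial
    have := (mem_vanishingIdeal_affineCone_iff hZ.nonempty).1 h1 p hp
    rw [map_one] at this
    exact one_ne_zero this
  · simp only [mem_vanishingIdeal_affineCone_iff hZ.nonempty] at hFG ⊢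
    refine isPreirreducible_iff_isClosed_union_isClosed.1 hZ.isPreirreducible _ _
      (isClosed_restrictLine_eq_zero F) (isClosed_restrictLine_eq_zero G) fun p hp => ?_
    have := hFG p hp
    rwa [map_mul, mul_eq_zero] at this

theorem vanishingIdeal_affineCone_lt {Z Z' : Set (ℙ K (ι → K))} (hZ : IsClosed Z)
    (hne : Z.Nonempty) (h : Z ⊂ Z') : MvPolynomial.vanishingIdeal K (affineCone Z') <
      MvPolynomial.vanishingIdeal K (affineCone Z) := by
  refine lt_of_le_of_ne (vanishingIdeal_affineCone_anti h.subset) fun heq => ?_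
  obtain ⟨p, hp, hpZ⟩ := Set.exists_of_ssubset h
  obtain ⟨S, hS, rfl⟩ := isClosed_iff.1 hZ
  refine hpZ fun F hF => ?_
  obtain ⟨d, hd⟩ := hS F hF
  have hmem : F ∈ MvPolynomial.vanishingIdeal K (affineCone (projZeros S)) := by
    rw [mem_vanishingIdeal_affineCone_iff hne]
    intro q hq
    rw [restrictLine_of_isHomogeneous hd, hq F hF, map_zero]
  rw [← heq, mem_vanishingIdeal_affineCone_iff ⟨p, hp⟩] at hmem
  have := restrictLine_eq_zero_iff.1 (hmem p hp) 1
  rwa [one_smul] at this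

theorem vanishingIdeal_affineCone_lt_origin {Z : Set (ℙ K (ι → K))} (hne : Z.Nonempty) :
    MvPolynomial.vanishingIdeal K (affineCone Z) <
      MvPolynomial.vanishingIdeal K ({0} : Set (ι → K)) := by
  refine lt_of_le_of_ne (MvPolynomial.vanishingIdeal_anti_mono ?_) fun heq => ?_
  · rintro _ rfl h
    exact absurd rfl h
  · obtain ⟨p, hp⟩ := hne
    obtain ⟨i, hi⟩ := Function.ne_iff.1 p.rep_nonzero
    have hmem : MvPolynomial.X i ∈ MvPolynomial.vanishingIdeal K ({0} : Set (ι → K)) := by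
      rw [MvPolynomial.mem_vanishingIdeal_iff]
      simp
    rw [← heq, mem_vanishingIdeal_affineCone_iff ⟨p, hp⟩] at hmem
    have := restrictLine_eq_zero_iff.1 (hmem p hp) 1
    exact hi (by simpa using this)

/-- A chain of irreducible closed subsets of a projective variety gives a chain of primes in the
homogeneous coordinate ring that does not reach the irrelevant ideal. -/
theorem height_add_one_le_ringKrullDim (X : IrreducibleCloseds (ℙ K (ι → K))) :
    (Order.height X : WithBot ℕ∞) + 1 ≤ ringKrullDim (CoordRing (X : Set (ℙ K (ι → K)))) := by
  rw [ringKrullDim_quotient]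
  set I := MvPolynomial.vanishingIdeal K (affineCone (X : Set (ℙ K (ι → K))))
  let J : IrreducibleCloseds (ℙ K (ι → K)) → PrimeSpectrum (MvPolynomial ι K) := fun Z =>
    ⟨MvPolynomial.vanishingIdeal K (affineCone (Z : Set (ℙ K (ι → K)))),
      isPrime_vanishingIdeal_affineCone Z.isIrreducible⟩
  have hJ : ∀ Z Z' : IrreducibleCloseds (ℙ K (ι → K)), Z < Z' → J Z' < J Z := fun Z Z' h =>
    vanishingIdeal_affineCone_lt Z.isClosed Z.isIrreducible.nonempty h
  have hJX : ∀ Z ≤ X, J Z ∈ PrimeSpectrum.zeroLocus (I : Set (MvPolynomial ι K)) := fun Z hZ =>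
    vanishingIdeal_affineCone_anti hZ
  let m : PrimeSpectrum (MvPolynomial ι K) :=
    ⟨MvPolynomial.vanishingIdeal K ({0} : Set (ι → K)), inferInstance⟩
  have hJm : ∀ Z, J Z < m := fun Z =>
    vanishingIdeal_affineCone_lt_origin Z.isIrreducible.nonempty
  have hm : m ∈ PrimeSpectrum.zeroLocus (I : Set (MvPolynomial ι K)) :=
    (vanishingIdeal_affineCone_lt_origin X.isIrreducible.nonempty).le
  have key : ∀ p : LTSeries (IrreducibleCloseds (ℙ K (ι → K))), p.last = X →
      ((p.length : ℕ∞) : WithBot ℕ∞) + 1 ≤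
        Order.krullDim (PrimeSpectrum.zeroLocus (I : Set (MvPolynomial ι K))) := by
    intro p hp
    let q : LTSeries (PrimeSpectrum.zeroLocus (I : Set (MvPolynomial ι K))) :=
      -- Passing to ideals reverses inclusions, so the chain is read backwards; the irrelevant ideal
      -- is then appended on top and accounts for the extra one.
      LTSeries.mk p.length
        (fun i => ⟨J (p i.rev), hJX _ (hp ▸ LTSeries.monotone p (Fin.le_last _))⟩)
        (fun i j hij => hJ _ _ (p.strictMono (Fin.rev_lt_rev.2 hij)))
    let q' := q.snoc ⟨m, hm⟩ (hJm _)
    have h1 := Order.LTSeries.length_le_krullDim q'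
    have h2 : q'.length = p.length + 1 := rfl
    rw [h2] at h1
    exact_mod_cast h1
  by_cases hbot : Order.krullDim (PrimeSpectrum.zeroLocus (I : Set (MvPolynomial ι K))) = ⊤
  · rw [hbot]; exact le_top
  obtain ⟨p₀, hp₀, -⟩ : ∃ p : LTSeries (IrreducibleCloseds (ℙ K (ι → K))), p.last = X ∧ True :=
    ⟨RelSeries.singleton _ X, rfl, trivial⟩
  obtain ⟨N, hN⟩ : ∃ N : ℕ, Order.krullDim
      (PrimeSpectrum.zeroLocus (I : Set (MvPolynomial ι K))) = (N : WithBot ℕ∞) := by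
    have hpos := key p₀ hp₀
    generalize Order.krullDim (PrimeSpectrum.zeroLocus (I : Set (MvPolynomial ι K))) = D at *
    induction D using WithBot.recBotCoe with
    | bot => simp at hpos
    | coe D =>
      induction D using ENat.recTopCoe with
      | top => exact absurd rfl hbot
      | coe D => exact ⟨D, rfl⟩
  rw [hN] at key ⊢
  have hle : Order.height X ≤ ((N - 1 : ℕ) : ℕ∞) := by
    refine Order.height_le fun p hp => ?_
    have h1 := key p hp
    have h2 : p.length + 1 ≤ N := by exact_mod_cast h1
    exact_mod_cast (by omega : p.length ≤ N - 1)
  have hN1 : 1 ≤ N := by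
    have h1 := key p₀ hp₀
    have h2 : p₀.length + 1 ≤ N := by exact_mod_cast h1
    omega
  calc (Order.height X : WithBot ℕ∞) + 1 ≤ (((N - 1 : ℕ) : ℕ∞) : WithBot ℕ∞) + 1 := by
        exact add_le_add_left (WithBot.coe_le_coe.2 hle) 1
    _ = N := by exact_mod_cast (by omega : N - 1 + 1 = N)

end Primes

/-! ### The dimension of an orbit closure -/

section Dimension

/-- By incomparability, contraction of primes along an integral map is strictly monotone. -/
theorem ringKrullDim_le_of_isIntegral {A B : Type*} [CommRing A] [CommRing B] (f : A →+* B)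
    (hf : f.IsIntegral) : ringKrullDim B ≤ ringKrullDim A := by
  algebraize [f]
  have : Algebra.IsIntegral A B := ⟨hf⟩
  refine Order.krullDim_le_of_strictMono (PrimeSpectrum.comap f) fun I J hIJ => ?_
  exact Ideal.IsIntegral.comap_lt_comap (R := A) (I := I.asIdeal) (J := J.asIdeal) hIJ

/-- Noether normalization: the ring is integral over a polynomial subring, whose number of variables
is at most the transcendence degree. -/
theorem ringKrullDim_le_of_trdeg_le {K R : Type*} [Field K] [CommRing R] [Nontrivial R]
    [Algebra K R] [Algebra.FiniteType K R] {d : ℕ} (h : Algebra.trdeg K R ≤ d) :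
    ringKrullDim R ≤ d := by
  obtain ⟨s, g, hg, hint⟩ := exists_integral_inj_algHom_of_fg K R
  refine (ringKrullDim_le_of_isIntegral g.toRingHom hint).trans ?_
  rw [MvPolynomial.ringKrullDim_of_isNoetherianRing, ringKrullDim_eq_zero_of_field, zero_add,
    Nat.card_fin]
  have h1 := lift_trdeg_le_of_injective g hg
  rw [MvPolynomial.trdeg_of_isDomain] at h1
  have h2 := h1.trans (Cardinal.lift_le.2 h)
  simp only [Cardinal.mk_fin, Cardinal.lift_natCast, Nat.cast_le] at h2
  exact_mod_cast h2

variable {K : Type*} [Field K] {n : ℕ} {P : NormalLatticePolytope n}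

/-- A transcendence basis can be chosen among the images of the coordinates. Its weights are
linearly independent, because an integral relation, split by signs, would identify two distinct
monomials in the basis elements. -/
theorem trdeg_toricMap_le (S : Set P.Lam) :
    Algebra.trdeg K (MvPolynomial P.Lam K ⧸ RingHom.ker (toricMap K S)) ≤
      Module.finrank ℤ (Submodule.span ℤ (P.hat '' S)) := by
  set R := MvPolynomial P.Lam K ⧸ RingHom.ker (toricMap K S)
  let Ψ : R →ₐ[K] AddMonoidAlgebra K (ℤ × (Fin n → ℤ)) := Ideal.kerLiftAlg (toricMap K S)
  have hΨ : Function.Injective Ψ := Ideal.kerLiftAlg_injective _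
  have hdom : NoZeroDivisors R := hΨ.noZeroDivisors Ψ (map_zero Ψ) (map_mul Ψ)
  have hnt : Nontrivial R := by
    refine ⟨0, 1, fun h => ?_⟩
    have := congrArg Ψ h
    rw [map_zero, map_one] at this
    exact zero_ne_one this
  have : IsDomain R := (isDomain_iff_noZeroDivisors_and_nontrivial R).2 ⟨hdom, hnt⟩
  let x : P.Lam → R := fun χ => Ideal.Quotient.mkₐ K _ (MvPolynomial.X χ)
  have hΨx : ∀ χ, Ψ (x χ) = toricMap K S (MvPolynomial.X χ) := fun χ => rfl
  have hadj : Algebra.adjoin K (Set.range x) = ⊤ := by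
    have : Set.range x = Ideal.Quotient.mkₐ K (RingHom.ker (toricMap K S)) ''
        Set.range MvPolynomial.X := by
      rw [← Set.range_comp]; rfl
    rw [this, ← AlgHom.map_adjoin, MvPolynomial.adjoin_range_X, Algebra.map_top,
      AlgHom.range_eq_top]
    exact Ideal.Quotient.mkₐ_surjective _ _
  have halg : Algebra.IsAlgebraic (Algebra.adjoin K (Set.range x)) R :=
    ⟨fun r => isAlgebraic_algebraMap
      (⟨r, by rw [hadj]; trivial⟩ : Algebra.adjoin K (Set.range x))⟩
  obtain ⟨t, htx, ht⟩ := exists_isTranscendenceBasis_subset (R := K) (Set.range x)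
  have hfin : Finite t := ((Set.finite_range x).subset htx).to_subtype
  have := Fintype.ofFinite t
  choose χ hχ using fun y : t => htx y.2
  have hχS : ∀ y, χ y ∈ S := by
    intro y
    by_contra hcon
    refine ht.1.ne_zero y (hΨ ?_)
    rw [← hχ y, hΨx, map_zero]
    simp [toricMap, hcon]
  have hΨy : ∀ y : t, Ψ (y : R) = AddMonoidAlgebra.single (P.hat (χ y)) 1 := fun y => by
    rw [← hχ y, hΨx, toricMap_X_of_mem (hχS y)]
  have hmon : ∀ c : t →₀ ℕ,
      Ψ (MvPolynomial.aeval (Subtype.val : t → R) (MvPolynomial.monomial c (1 : K))) =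
        AddMonoidAlgebra.single (∑ y, c y • P.hat (χ y)) 1 := by
    intro c
    rw [MvPolynomial.aeval_monomial, map_one, one_mul,
      Finsupp.prod_fintype _ _ (fun _ => pow_zero _), map_prod]
    simp only [map_pow, hΨy, AddMonoidAlgebra.single_pow, one_pow]
    exact (map_prod (AddMonoidAlgebra.of K (ℤ × (Fin n → ℤ)))
      (fun y => Multiplicative.ofAdd (c y • P.hat (χ y))) Finset.univ).symm
  have hli : LinearIndependent ℤ (fun y : t => (⟨P.hat (χ y),
      Submodule.subset_span ⟨_, hχS y, rfl⟩⟩ : Submodule.span ℤ (P.hat '' S))) := by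
    rw [Fintype.linearIndependent_iff]
    intro c hc y
    let a : t →₀ ℕ := Finsupp.equivFunOnFinite.symm fun y => (c y).toNat
    let b : t →₀ ℕ := Finsupp.equivFunOnFinite.symm fun y => (-c y).toNat
    have h1 : ∑ y, a y • P.hat (χ y) = ∑ y, b y • P.hat (χ y) := by
      have h2 := congrArg Subtype.val hc
      simp only [AddSubmonoidClass.coe_finsetSum, Submodule.coe_smul,
        Submodule.coe_zero] at h2
      rw [← sub_eq_zero, ← Finset.sum_sub_distrib, ← h2]
      refine Finset.sum_congr rfl fun y _ => ?_
      rw [← natCast_zsmul, ← natCast_zsmul, ← sub_smul]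
      simp [a, b]
    have hab : MvPolynomial.monomial a (1 : K) = MvPolynomial.monomial b 1 := by
      refine ht.1 (hΨ ?_)
      rw [hmon, hmon, h1]
    have hab' : a = b := by
      rw [MvPolynomial.monomial_eq_monomial_iff] at hab
      simpa using hab
    have := DFunLike.congr_fun hab' y
    simp only [a, b, Finsupp.equivFunOnFinite_symm_apply_apply] at this
    omega
  have hcard := hli.fintype_card_le_finrank
  rw [← ht.cardinalMk_eq_trdeg, Cardinal.mk_fintype]
  exact_mod_cast hcard

/-- An orbit closure as an irreducible closed subset. -/
def orbitClosureIrred (K : Type*) [Field K] [CharZero K] (σ : P.Face) :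
    IrreducibleCloseds (ℙ K (P.Lam → K)) :=
  ⟨orbitClosure K P σ, (isProjectiveVariety_orbitClosure σ).2,
    (isProjectiveVariety_orbitClosure σ).1⟩

variable [CharZero K]

theorem orbitClosure_subset_iff {τ σ : P.Face} :
    orbitClosure K P τ ⊆ orbitClosure K P σ ↔ τ ≤ σ := by
  constructor
  · intro h
    have h1 : Projectivization.mk K (toricPoint (latticePoints τ) 1)
        (toricPoint_ne_zero (latticePoints_nonempty τ) _) ∈ orbitClosure K P τ :=
      mem_orbitClosure_iff.2 ((isToric_rep_mk _).2 (isToric_toricPoint τ 1))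
    have h2 := (isToric_rep_mk _).1 (mem_orbitClosure_iff.1 (h h1))
    rw [le_iff_latticePoints_subset]
    intro χ hχ
    by_contra hcon
    exact toricPoint_ne_zero_iff.2 hχ (h2.1 χ hcon)
  · intro h
    refine closure_minimal ?_ isClosed_closure
    rw [orbit_eq]
    rintro _ ⟨t, rfl⟩
    rw [mem_orbitClosure_iff, isToric_rep_mk]
    have h1 := isToric_toricPoint τ ((1, t) : TorusHat K n)
    exact ⟨fun χ hχ => h1.1 χ fun h' => hχ (le_iff_latticePoints_subset.1 h h'), h1.2⟩

theorem one_le_rank (σ : P.Face) : 1 ≤ rank σ := by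
  obtain ⟨τ, hτσ, hτ⟩ := (Set.toFinite (Set.Iic σ)).exists_minimal ⟨σ, le_refl σ⟩
  have hmin : IsMin τ := fun ρ hρ => hτ (hρ.trans hτσ) hρ
  exact (rank_of_isMin hmin).ge.trans (rank_mono hτσ)

theorem height_orbitClosure_le (σ : P.Face) :
    Order.height (orbitClosureIrred K σ) ≤ ((rank σ - 1 : ℕ) : ℕ∞) := by
  have hnt : Nontrivial (CoordRing (orbitClosure K P σ)) :=
    Ideal.Quotient.nontrivial_iff.2
      (isPrime_vanishingIdeal_affineCone (isProjectiveVariety_orbitClosure σ).2).ne_top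
  have h1 := height_add_one_le_ringKrullDim (orbitClosureIrred K σ)
  have h2 : ringKrullDim (CoordRing (orbitClosure K P σ)) ≤ (rank σ : WithBot ℕ∞) := by
    refine ringKrullDim_le_of_trdeg_le (K := K) ?_
    unfold CoordRing
    rw [vanishingIdeal_orbitClosure]
    exact trdeg_toricMap_le _
  have h3 := h1.trans h2
  have h4 : Order.height (orbitClosureIrred K σ) + 1 ≤ (rank σ : ℕ∞) := by exact_mod_cast h3
  have h5 : ((rank σ : ℕ) : ℕ∞) = ((rank σ - 1 : ℕ) : ℕ∞) + 1 := by
    exact_mod_cast (Nat.sub_add_cancel (one_le_rank σ)).symm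
  rw [h5] at h4
  exact (ENat.add_le_add_iff_right ENat.one_ne_top).1 h4

theorem orbitClosureIrred_strictMono : StrictMono (orbitClosureIrred K (P := P)) := by
  intro τ σ h
  exact lt_of_le_not_ge (orbitClosure_subset_iff.2 h.le)
    fun h' => h.not_ge (orbitClosure_subset_iff.1 h')

/-- Descending through covers of faces loses exactly one in rank and at least one in height; minimal
faces have rank one and are points. -/
theorem le_height_orbitClosure (r : ℕ) : ∀ σ : P.Face, rank σ = r + 1 →
    (r : ℕ∞) ≤ Order.height (orbitClosureIrred K σ) := by
  induction r with
  | zero => exact fun σ _ => by simp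
  | succ r ih =>
    intro σ hσ
    have hmin : ¬ IsMin σ := fun h => by
      have := rank_of_isMin h
      omega
    obtain ⟨τ, hτ⟩ := not_isMin_iff.1 hmin
    obtain ⟨ρ, -, hρ⟩ := exists_covBy_of_lt hτ
    have h1 := ih ρ (by have := rank_covBy hρ; omega)
    -- Heights increase strictly only where they are finite, which the upper bound supplies.
    have h2 : Order.height (orbitClosureIrred K ρ) < Order.height (orbitClosureIrred K σ) :=
      Order.height_strictMono (orbitClosureIrred_strictMono hρ.lt)
        ((height_orbitClosure_le ρ).trans_lt (ENat.natCast_lt_top _))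
    push_cast
    exact (add_le_add_left h1 1).trans (Order.add_one_le_of_lt h2)

theorem height_orbitClosure (σ : P.Face) :
    Order.height (orbitClosureIrred K σ) = ((rank σ - 1 : ℕ) : ℕ∞) :=
  le_antisymm (height_orbitClosure_le σ)
    (le_height_orbitClosure _ σ (Nat.sub_add_cancel (one_le_rank σ)).symm)

theorem dim_orbitClosure (σ : P.Face) :
    dim (orbitClosure K P σ) = (((rank σ - 1 : ℕ) : ℕ∞) : WithBot ℕ∞) := by
  rw [← height_orbitClosure (K := K)]
  exact topologicalKrullDim_eq_height (orbitClosureIrred K σ)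

end Dimension

/-! ### Tangent spaces of orbit closures -/

section Tangent

variable {K : Type*} [Field K] {n : ℕ} {P : NormalLatticePolytope n}

/-- The derivative of the monomial with exponent `a` in direction `u` at the point
`∑_{χ ∈ S} e_χ`. -/
def logDeriv (S : Set P.Lam) (u : P.Lam → K) (a : P.Lam →₀ ℕ) : K :=
  open Classical in
  -- The truncated subtraction is harmless: where `a χ = 0` the summand is zero anyway.
  ∑ χ, if SupportedOn S (a - Finsupp.single χ 1) then a χ * u χ else 0

theorem logDeriv_of_supportedOn {S : Set P.Lam} (u : P.Lam → K) {a : P.Lam →₀ ℕ}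
    (ha : SupportedOn S a) : logDeriv S u a = ∑ χ, a χ * u χ := by
  refine Finset.sum_congr rfl fun χ _ => if_pos fun ψ hψ => ?_
  simp [ha ψ hψ]

/-- At a point with support `S`, a monomial with a single factor outside `S` has only that direction
as derivative; with two such factors it vanishes to second order. -/
theorem logDeriv_single_add {S : Set P.Lam} (u : P.Lam → K) {χ : P.Lam} (hχ : χ ∉ S)
    {a : P.Lam →₀ ℕ} (ha : SupportedOn S a) :
    logDeriv S u (Finsupp.single χ 1 + a) = u χ := by
  classical
  rw [logDeriv, Finset.sum_eq_single χ]
  · rw [if_pos (by rwa [add_tsub_cancel_left])]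
    simp [ha χ hχ]
  · intro ψ _ hψ
    refine if_neg fun h => ?_
    have := h χ hχ
    simp [hψ.symm] at this
  · simp

theorem logDeriv_single_add_single_add {S : Set P.Lam} (u : P.Lam → K) {χ χ' : P.Lam}
    (hχ : χ ∉ S) (hχ' : χ' ∉ S) (a : P.Lam →₀ ℕ) :
    logDeriv S u (Finsupp.single χ 1 + (Finsupp.single χ' 1 + a)) = 0 := by
  classical
  refine Finset.sum_eq_zero fun ψ _ => if_neg fun h => ?_
  have h1 := h χ hχ
  have h2 := h χ' hχ'
  simp only [Finsupp.coe_tsub, Finsupp.coe_add, Pi.sub_apply, Pi.add_apply,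
    Finsupp.single_apply] at h1 h2
  grind

theorem logDeriv_of_not_supportedOn {S S' : Set P.Lam} (hS : S ⊆ S') {u : P.Lam → K}
    (hu : ∀ χ, χ ∉ S' → u χ = 0) {a : P.Lam →₀ ℕ} (ha : ¬ SupportedOn S' a) :
    logDeriv S u a = 0 := by
  classical
  refine Finset.sum_eq_zero fun χ _ => ?_
  split_ifs with h
  · by_cases hχ : χ ∈ S'
    · exfalso
      refine ha fun ψ hψ => ?_
      have h1 := h ψ fun h' => hψ (hS h')
      have h2 : χ ≠ ψ := by rintro rfl; exact hψ hχ
      simpa [h2] using h1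
    · rw [hu χ hχ, mul_zero]
  · rfl

theorem exists_eq_single_add {S : Set P.Lam} {a : P.Lam →₀ ℕ} (ha : ¬ SupportedOn S a) :
    ∃ χ ∉ S, ∃ a', a = Finsupp.single χ 1 + a' := by
  simp only [SupportedOn, not_forall] at ha
  obtain ⟨χ, hχ, h0⟩ := ha
  refine ⟨χ, hχ, a - Finsupp.single χ 1, ?_⟩
  rw [add_tsub_cancel_of_le]
  rw [Finsupp.single_le_iff]
  exact Nat.one_le_iff_ne_zero.2 h0

theorem supportedOn_trichotomy (S : Set P.Lam) (a : P.Lam →₀ ℕ) : SupportedOn S a ∨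
    (∃ χ ∉ S, ∃ a', SupportedOn S a' ∧ a = Finsupp.single χ 1 + a') ∨
    ∃ χ ∉ S, ∃ χ' ∉ S, ∃ a', a = Finsupp.single χ 1 + (Finsupp.single χ' 1 + a') := by
  by_cases ha : SupportedOn S a
  · exact Or.inl ha
  · obtain ⟨χ, hχ, a', rfl⟩ := exists_eq_single_add ha
    by_cases ha' : SupportedOn S a'
    · exact Or.inr (Or.inl ⟨χ, hχ, a', ha', rfl⟩)
    · obtain ⟨χ', hχ', a'', rfl⟩ := exists_eq_single_add ha'
      exact Or.inr (Or.inr ⟨χ, hχ, χ', hχ', a'', rfl⟩)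

/-- Rescaling directions by character values transports derivatives at the point of `t` to those at
the base point, up to the nonzero factor given by the weight. Tangent conditions thus become
independent of `t`. -/
theorem differential_monomial (S : Set P.Lam) (t : TorusHat K n) (u : P.Lam → K)
    (a : P.Lam →₀ ℕ) :
    differential (MvPolynomial.monomial a (1 : K)) (toricPoint S t)
      (fun χ => (characterHat (P.hat χ) t : K) * u χ) =
        (characterHat (P.wt a) t : K) * logDeriv S u a := by
  classical
  simp only [differential, LinearMap.sum_apply, LinearMap.smul_apply, LinearMap.proj_apply,
    smul_eq_mul, MvPolynomial.pderiv_monomial, eval_monomial_eq, one_mul, logDeriv,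
    Finset.mul_sum]
  refine Finset.sum_congr rfl fun χ _ => ?_
  split_ifs with h
  · rw [mon_toricPoint h]
    by_cases h0 : a χ = 0
    · simp [h0]
    · have h1 : P.wt a = P.hat χ + P.wt (a - Finsupp.single χ 1) := by
        conv_lhs => rw [← add_tsub_cancel_of_le (show Finsupp.single χ 1 ≤ a by
          rw [Finsupp.single_le_iff]; exact Nat.one_le_iff_ne_zero.2 h0)]
        rw [map_add, wt_single, one_smul]
      rw [h1, characterHat_add, Units.val_mul]
      ring
  · rw [mon_toricPoint_of_not h]
    ring

theorem differential_add (F G : MvPolynomial P.Lam K) (v : P.Lam → K) :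
    differential (F + G) v = differential F v + differential G v := by
  simp [differential, add_smul, Finset.sum_add_distrib]

theorem differential_smul (c : K) (F : MvPolynomial P.Lam K) (v : P.Lam → K) :
    differential (c • F) v = c • differential F v := by
  simp [differential, Finset.smul_sum, smul_smul]

/-- A homomorphism on the lattice of a face, as a function on the lattice points of the face. -/
def homToFun (K : Type*) [Field K] (σ : P.Face) : (lattice σ →ₗ[ℤ] K) →ₗ[K] (P.Lam → K) :=
  open Classical in
  { toFun := fun g χ => if h : χ ∈ latticePoints σ then g ⟨P.hat χ, hat_mem_lattice h⟩ else 0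
    map_add' := fun g g' => by
      ext χ
      by_cases h : χ ∈ latticePoints σ <;> simp [h]
    map_smul' := fun c g => by
      ext χ
      by_cases h : χ ∈ latticePoints σ <;> simp [h] }

theorem homToFun_of_mem {σ : P.Face} (g : lattice σ →ₗ[ℤ] K) {χ : P.Lam}
    (h : χ ∈ latticePoints σ) : homToFun K σ g χ = g ⟨P.hat χ, hat_mem_lattice h⟩ := by
  simp [homToFun, h]

theorem homToFun_of_notMem {σ : P.Face} (g : lattice σ →ₗ[ℤ] K) {χ : P.Lam}
    (h : χ ∉ latticePoints σ) : homToFun K σ g χ = 0 := by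
  simp [homToFun, h]

theorem homToFun_injective (σ : P.Face) : Function.Injective (homToFun K σ) := by
  rw [← LinearMap.ker_eq_bot, LinearMap.ker_eq_bot']
  intro g hg
  refine LinearMap.ext_on_range (v := fun χ : latticePoints σ =>
    (⟨P.hat χ, hat_mem_lattice χ.2⟩ : lattice σ)) ?_ fun χ => ?_
  · have : Set.range (fun χ : latticePoints σ => (⟨P.hat χ, hat_mem_lattice χ.2⟩ : lattice σ)) =
        Subtype.val ⁻¹' (P.hat '' latticePoints σ) := by
      ext ⟨y, hy⟩
      constructor
      · rintro ⟨χ, hχ⟩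
        exact ⟨χ.1, χ.2, congrArg Subtype.val hχ⟩
      · rintro ⟨χ, hχ, hχy⟩
        exact ⟨⟨χ, hχ⟩, Subtype.ext hχy⟩
    rw [this]
    exact Submodule.span_span_coe_preimage
  · rw [← homToFun_of_mem g χ.2, hg]
    rfl

theorem sum_homToFun {σ : P.Face} (g : lattice σ →ₗ[ℤ] K) {a : P.Lam →₀ ℕ}
    (ha : SupportedOn (latticePoints σ) a) :
    ∑ χ, a χ * homToFun K σ g χ = g ⟨P.wt a, ha.wt_mem_lattice⟩ := by
  classical
  have h1 : (⟨P.wt a, ha.wt_mem_lattice⟩ : lattice σ) = ∑ χ, a χ •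
      (if h : χ ∈ latticePoints σ then ⟨P.hat χ, hat_mem_lattice h⟩ else 0 : lattice σ) := by
    ext1
    change P.wt a = _
    rw [wt_eq_sum, AddSubmonoidClass.coe_finsetSum]
    refine Finset.sum_congr rfl fun χ _ => ?_
    by_cases h : χ ∈ latticePoints σ
    · simp [h]
    · simp [ha χ h]
  rw [h1, map_sum]
  refine Finset.sum_congr rfl fun χ _ => ?_
  by_cases h : χ ∈ latticePoints σ
  · rw [homToFun_of_mem g h, dif_pos h, map_nsmul, nsmul_eq_mul]
  · simp [ha χ h]

theorem exists_homToFun_eq {σ : P.Face} (u : P.Lam → K)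
    (h : ∀ a b : P.Lam →₀ ℕ, SupportedOn (latticePoints σ) a → SupportedOn (latticePoints σ) b →
      P.wt a = P.wt b → ∑ χ, a χ * u χ = ∑ χ, b χ * u χ) :
    ∃ g : lattice σ →ₗ[ℤ] K, ∀ χ ∈ latticePoints σ, homToFun K σ g χ = u χ := by
  obtain ⟨g, hg⟩ := exists_linearMap_of_relations (latticePoints σ) u
    (by simpa only [nsmul_eq_mul] using h)
  exact ⟨g, fun χ hχ => by rw [homToFun_of_mem g hχ]; exact hg χ hχ⟩

theorem finrank_hom_lattice (σ : P.Face) : Module.finrank K (lattice σ →ₗ[ℤ] K) = rank σ := by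
  rw [← ((Module.Free.chooseBasis ℤ (lattice σ)).constr K (M' := K)).finrank_eq,
    Module.finrank_pi, rank, Module.finrank_eq_card_chooseBasisIndex]

instance (σ : P.Face) : Module.Finite K (lattice σ →ₗ[ℤ] K) :=
  Module.Finite.equiv ((Module.Free.chooseBasis ℤ (lattice σ)).constr K (M' := K))

/-- Rescaling by the character values of a torus element. -/
def scale (t : TorusHat K n) : (P.Lam → K) ≃ₗ[K] (P.Lam → K) :=
  LinearEquiv.piCongrRight fun χ => LinearEquiv.smulOfUnit (characterHat (P.hat χ) t)

theorem scale_apply (t : TorusHat K n) (u : P.Lam → K) :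
    scale t u = fun χ => (characterHat (P.hat χ) t : K) * u χ := rfl

theorem finrank_coneTangentSpace_of_range {V : Type*} [AddCommGroup V] [Module K V]
    [Module.Finite K V] {T : Submodule K (P.Lam → K)} (f : V →ₗ[K] (P.Lam → K))
    (hf : Function.Injective f) (t : TorusHat K n)
    (h : ∀ u, scale t u ∈ T ↔ u ∈ LinearMap.range f) :
    Module.finrank K T = Module.finrank K V := by
  have : T = LinearMap.range ((scale t).toLinearMap ∘ₗ f) := by
    ext w
    obtain ⟨u, rfl⟩ := (scale t).surjective w
    rw [h]
    simp
  rw [this]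
  exact LinearMap.finrank_range_of_inj ((scale t).injective.comp hf)

variable [CharZero K]

theorem toricMap_binomial (σ : P.Face) {a b : P.Lam →₀ ℕ} (h : P.wt a = P.wt b) :
    toricMap K (latticePoints σ)
      (MvPolynomial.monomial a 1 + (-1 : K) • MvPolynomial.monomial b 1) = 0 := by
  rw [map_add, map_smul]
  by_cases ha : SupportedOn (latticePoints σ) a
  · rw [toricMap_monomial ha, toricMap_monomial ((supportedOn_congr h).1 ha), h, neg_one_smul,
      add_neg_cancel]
  · rw [toricMap_monomial_of_not ha,
      toricMap_monomial_of_not fun hb => ha ((supportedOn_congr h).2 hb), smul_zero, add_zero]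

/-- The tangent space of the cone over `X_σ` at a point of the orbit of `τ ≤ σ`, described by
logarithmic derivatives. -/
theorem mem_coneTangentSpace_iff {τ σ : P.Face} (hτσ : τ ≤ σ) {p : ℙ K (P.Lam → K)}
    {t : TorusHat K n} (hp : p.rep = toricPoint (latticePoints τ) t) (u : P.Lam → K) :
    (fun χ => (characterHat (P.hat χ) t : K) * u χ) ∈ coneTangentSpace (orbitClosure K P σ) p ↔
      (∀ χ, χ ∉ latticePoints σ → u χ = 0) ∧
        ∀ a b, SupportedOn (latticePoints σ) a → SupportedOn (latticePoints σ) b →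
          P.wt a = P.wt b →
            logDeriv (latticePoints τ) u a = logDeriv (latticePoints τ) u b := by
  have hsub := le_iff_latticePoints_subset.1 hτσ
  simp only [coneTangentSpace, Submodule.mem_iInf, LinearMap.mem_ker,
    mem_vanishingIdeal_orbitClosure_iff, hp]
  constructor
  · intro h
    constructor
    · intro χ hχ
      have h1 : ¬ SupportedOn (latticePoints σ) (Finsupp.single χ 1) := fun h' => by
        simpa using h' χ hχ
      have h2 := h _ (toricMap_monomial_of_not (K := K) h1 1)
      rw [differential_monomial, wt_single, one_smul] at h2
      have h3 := (mul_eq_zero.1 h2).resolve_left (Units.ne_zero _)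
      rw [← add_zero (Finsupp.single χ 1), logDeriv_single_add u (fun h' => hχ (hsub h'))
        (fun _ _ => rfl)] at h3
      exact h3
    · intro a b _ _ hab
      have h2 := h _ (toricMap_binomial σ hab)
      rw [differential_add, differential_smul, LinearMap.add_apply, LinearMap.smul_apply,
        differential_monomial, differential_monomial, hab, smul_eq_mul, neg_one_mul,
        add_neg_eq_zero] at h2
      exact mul_left_cancel₀ (Units.ne_zero _) h2
  · rintro ⟨h0, h⟩ F hF
    let D : MvPolynomial P.Lam K →ₗ[K] K :=
      { toFun := fun F => differential F (toricPoint (latticePoints τ) t)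
          (fun χ => (characterHat (P.hat χ) t : K) * u χ)
        map_add' := fun F G => by rw [differential_add, LinearMap.add_apply]
        map_smul' := fun c F => by rw [differential_smul]; rfl }
    refine map_eq_zero_of_toricMap_eq_zero (D := D) (fun a b ha hb hab => ?_) (fun a ha => ?_) hF
    · change differential _ _ _ = differential _ _ _
      rw [differential_monomial, differential_monomial, h a b ha hb hab, hab]
    · change differential _ _ _ = _
      rw [differential_monomial, logDeriv_of_not_supportedOn hsub h0 ha, mul_zero]

/-- On the open orbit the tangent condition says that `u` respects all additive relations, i.e. is a
homomorphism from the lattice of `σ` to `K`. -/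
theorem finrank_coneTangentSpace_self {σ : P.Face} {p : ℙ K (P.Lam → K)}
    {t : TorusHat K n} (hp : p.rep = toricPoint (latticePoints σ) t) :
    Module.finrank K (coneTangentSpace (orbitClosure K P σ) p) = rank σ := by
  rw [← finrank_hom_lattice (K := K)]
  refine finrank_coneTangentSpace_of_range (homToFun K σ) (homToFun_injective σ) t fun u => ?_
  rw [scale_apply, mem_coneTangentSpace_iff le_rfl hp]
  constructor
  · rintro ⟨h0, h⟩
    obtain ⟨g, hg⟩ := exists_homToFun_eq u fun a b ha hb hab => by
      rw [← logDeriv_of_supportedOn u ha, ← logDeriv_of_supportedOn u hb, h a b ha hb hab]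
    refine ⟨g, funext fun χ => ?_⟩
    by_cases hχ : χ ∈ latticePoints σ
    · exact hg χ hχ
    · rw [h0 χ hχ, homToFun_of_notMem g hχ]
  · rintro ⟨g, rfl⟩
    refine ⟨fun χ hχ => homToFun_of_notMem g hχ, fun a b ha hb hab => ?_⟩
    rw [logDeriv_of_supportedOn _ ha, logDeriv_of_supportedOn _ hb, sum_homToFun g ha,
      sum_homToFun g hb]
    simp only [hab]

/-- At the orbit of a facet `τ`, a tangent vector is a homomorphism on the lattice of `τ` together
with one transversal parameter `k`: it takes the value `k` at all lattice points of height one and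
`0` at greater height. The dimension is `rank τ + 1`. -/
theorem finrank_coneTangentSpace_covBy {τ σ : P.Face} (hcov : τ ⋖ σ) {p : ℙ K (P.Lam → K)}
    {t : TorusHat K n} (hp : p.rep = toricPoint (latticePoints τ) t) :
    Module.finrank K (coneTangentSpace (orbitClosure K P σ) p) = rank σ := by
  classical
  have hsub := le_iff_latticePoints_subset.1 hcov.le
  obtain ⟨q, χ₀, hgt, hχ₀, hq₀, hqτ, hq, hdec⟩ := exists_height hcov
  let E : Set P.Lam := {χ | χ ∈ latticePoints σ ∧ q χ = 1}
  have hEτ : ∀ χ ∈ E, χ ∉ latticePoints τ := fun χ hχ h => by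
    have h1 := (hqτ χ hχ.1).2 h
    have h2 := hχ.2
    omega
  let ind : K →ₗ[K] (P.Lam → K) := LinearMap.toSpanSingleton K _ (E.indicator 1)
  have hind : ∀ k χ, ind k χ = if χ ∈ E then k else 0 := fun k χ => by
    simp [ind, Set.indicator_apply]
  let f : ((lattice τ →ₗ[ℤ] K) × K) →ₗ[K] (P.Lam → K) := (homToFun K τ).coprod ind
  have hf : ∀ g k χ, f (g, k) χ = homToFun K τ g χ + if χ ∈ E then k else 0 := fun g k χ => by
    simp [f, hind]
  have hfτ : ∀ g k, ∀ χ ∈ latticePoints τ, f (g, k) χ = homToFun K τ g χ := fun g k χ hχ => by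
    rw [hf, if_neg fun h => hEτ χ h hχ, add_zero]
  have hfn : ∀ g k, ∀ χ, χ ∉ latticePoints τ → f (g, k) χ = if χ ∈ E then k else 0 :=
    fun g k χ hχ => by rw [hf, homToFun_of_notMem g hχ, zero_add]
  have hχ₀τ : χ₀ ∉ latticePoints τ := hEτ χ₀ ⟨hχ₀, hq₀⟩
  have hinj : Function.Injective f := by
    rw [← LinearMap.ker_eq_bot, LinearMap.ker_eq_bot']
    rintro ⟨g, k⟩ h
    have hk : k = 0 := by
      have := congrFun h χ₀
      rwa [hfn _ _ _ hχ₀τ, if_pos (show χ₀ ∈ E from ⟨hχ₀, hq₀⟩)] at this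
    subst hk
    have hg : homToFun K τ g = 0 := by
      ext χ
      have := congrFun h χ
      simpa [hf] using this
    rw [homToFun_injective τ (hg.trans (map_zero _).symm)]
    rfl
  have hfr : Module.finrank K ((lattice τ →ₗ[ℤ] K) × K) = rank σ := by
    rw [Module.finrank_prod, finrank_hom_lattice, Module.finrank_self, rank_covBy hcov]
  rw [← hfr]
  refine finrank_coneTangentSpace_of_range f hinj t fun u => ?_
  rw [scale_apply, mem_coneTangentSpace_iff hcov.le hp]
  constructor
  · rintro ⟨h0, h⟩
    obtain ⟨g, hg⟩ := exists_homToFun_eq (σ := τ) u fun a b ha hb hab => by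
      rw [← logDeriv_of_supportedOn u ha, ← logDeriv_of_supportedOn u hb,
        h a b (ha.mono hsub) (hb.mono hsub) hab]
    refine ⟨(g, u χ₀), funext fun χ => ?_⟩
    by_cases hχτ : χ ∈ latticePoints τ
    · rw [hfτ _ _ _ hχτ, hg χ hχτ]
    rw [hfn _ _ _ hχτ]
    by_cases hχ : χ ∈ latticePoints σ
    · obtain ⟨b, c, hb, hc, hbc⟩ := hdec χ hχ
      have hq0 : q χ ≠ 0 := fun h' => hχτ ((hqτ χ hχ).1 h')
      have hwt : P.wt (Finsupp.single χ 1 + b) = P.wt (q χ • Finsupp.single χ₀ 1 + c) := by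
        rw [map_add, map_add, map_nsmul, wt_single, wt_single, one_smul, one_smul, hbc]
      have h1 := h _ _ ((supportedOn_single hχ 1).add (hb.mono hsub))
        (((supportedOn_single hχ₀ 1).nsmul (q χ)).add (hc.mono hsub)) hwt
      rw [logDeriv_single_add u hχτ hb] at h1
      rw [h1]
      by_cases hq1 : q χ = 1
      · rw [if_pos (show χ ∈ E from ⟨hχ, hq1⟩), hq1, one_smul, logDeriv_single_add u hχ₀τ hc]
      · rw [if_neg fun h' => hq1 h'.2]
        -- At height at least two the equivalent monomial has two factors `χ₀` outside `τ`, so its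
        -- derivative vanishes.
        obtain ⟨k, hk⟩ : ∃ k, q χ = k + 2 := ⟨q χ - 2, by omega⟩
        rw [hk, add_smul, two_smul, add_comm (k • _), add_assoc, add_assoc,
          logDeriv_single_add_single_add u hχ₀τ hχ₀τ]
    · rw [if_neg fun h' => hχ h'.1, h0 χ hχ]
  · rintro ⟨⟨g, k⟩, rfl⟩
    refine ⟨fun χ hχ => ?_, ?_⟩
    · rw [hfn _ _ _ fun h' => hχ (hsub h'), if_neg fun h' => hχ h'.1]
    -- The total height of an exponent is a function of its weight, so exponents of equal weight
    -- fall into the same case of `hval` below.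
    · have hQ : ∀ a, SupportedOn (latticePoints σ) a →
          hgt (P.wt a) = ((∑ χ, a χ * q χ : ℕ) : ℝ) := by
        intro a ha
        rw [wt_eq_sum, map_sum]
        push_cast
        refine Finset.sum_congr rfl fun χ _ => ?_
        by_cases h : χ ∈ latticePoints σ
        · rw [map_nsmul, hq χ h, nsmul_eq_mul]
        · simp [ha χ h]
      have hpos : ∀ χ ∈ latticePoints σ, χ ∉ latticePoints τ → 1 ≤ q χ := fun χ hχ hχτ =>
        Nat.one_le_iff_ne_zero.2 fun h' => hχτ ((hqτ χ hχ).1 h')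
      have hQs : ∀ χ a, ∑ ψ, (Finsupp.single χ 1 + a : P.Lam →₀ ℕ) ψ * q ψ =
          q χ + ∑ ψ, a ψ * q ψ := by
        intro χ a
        simp [add_mul, Finset.sum_add_distrib, Finsupp.single_apply]
      have hQτ : ∀ a, SupportedOn (latticePoints τ) a → ∑ ψ, a ψ * q ψ = 0 := by
        intro a ha
        refine Finset.sum_eq_zero fun ψ _ => ?_
        by_cases h : ψ ∈ latticePoints τ
        · rw [(hqτ ψ (hsub h)).2 h, mul_zero]
        · rw [ha ψ h, zero_mul]
      have hval : ∀ a, (ha : SupportedOn (latticePoints σ) a) →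
          (∃ h : SupportedOn (latticePoints τ) a, ∑ ψ, a ψ * q ψ = 0 ∧
            logDeriv (latticePoints τ) (f (g, k)) a = g ⟨P.wt a, h.wt_mem_lattice⟩) ∨
          (∑ ψ, a ψ * q ψ = 1 ∧ logDeriv (latticePoints τ) (f (g, k)) a = k) ∨
          (2 ≤ ∑ ψ, a ψ * q ψ ∧ logDeriv (latticePoints τ) (f (g, k)) a = 0) := by
        intro a ha
        rcases supportedOn_trichotomy (latticePoints τ) a with
          h | ⟨χ, hχ, a', ha', rfl⟩ | ⟨χ, hχ, χ', hχ', a', rfl⟩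
        · refine Or.inl ⟨h, hQτ a h, ?_⟩
          rw [logDeriv_of_supportedOn _ h, ← sum_homToFun g h]
          refine Finset.sum_congr rfl fun χ _ => ?_
          by_cases hχ : χ ∈ latticePoints τ
          · rw [hfτ _ _ _ hχ]
          · rw [h χ hχ]; simp
        · have hχσ : χ ∈ latticePoints σ := by
            by_contra hcon
            have := ha χ hcon
            simp at this
          have := hpos χ hχσ hχ
          rw [logDeriv_single_add _ hχ ha', hfn _ _ _ hχ, hQs, hQτ a' ha', add_zero]
          by_cases hq1 : q χ = 1
          · exact Or.inr (Or.inl ⟨hq1, if_pos ⟨hχσ, hq1⟩⟩)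
          · exact Or.inr (Or.inr ⟨by omega, if_neg fun h' => hq1 h'.2⟩)
        · have hχσ : χ ∈ latticePoints σ := by
            by_contra hcon
            have := ha χ hcon
            simp at this
          have hχσ' : χ' ∈ latticePoints σ := by
            by_contra hcon
            have := ha χ' hcon
            simp at this
          refine Or.inr (Or.inr ⟨?_, logDeriv_single_add_single_add _ hχ hχ' a'⟩)
          rw [hQs, hQs]
          have := hpos χ hχσ hχ
          have := hpos χ' hχσ' hχ'
          omega
      intro a b ha hb hab
      have hQab : ∑ ψ, a ψ * q ψ = ∑ ψ, b ψ * q ψ := by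
        have := hQ a ha
        rw [hab, hQ b hb] at this
        exact_mod_cast this.symm
      rcases hval a ha with ⟨h1, h2, h3⟩ | ⟨h2, h3⟩ | ⟨h2, h3⟩ <;>
        rcases hval b hb with ⟨h1', h2', h3'⟩ | ⟨h2', h3'⟩ | ⟨h2', h3'⟩ <;>
        first
          | (exfalso; omega)
          | (rw [h3, h3']; simp only [hab])
          | rw [h3, h3']

theorem isSmoothPoint_of_covBy {τ σ : P.Face} (h : τ = σ ∨ τ ⋖ σ) {p : ℙ K (P.Lam → K)}
    {t : TorusHat K n} (hp : p.rep = toricPoint (latticePoints τ) t) :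
    IsSmoothPoint (orbitClosure K P σ) p := by
  have hfr : Module.finrank K (coneTangentSpace (orbitClosure K P σ) p) = rank σ := by
    rcases h with rfl | h
    · exact finrank_coneTangentSpace_self hp
    · exact finrank_coneTangentSpace_covBy h hp
  rw [IsSmoothPoint, hfr, dim_orbitClosure]
  exact_mod_cast (Nat.sub_add_cancel (one_le_rank σ)).symm

/-- The orbits of `σ` and of its facets consist of smooth points, so the singular locus is covered
by finitely many orbit closures of codimension at least two. -/
theorem isSmoothInCodimOne_orbitClosure [IsAlgClosed K] (σ : P.Face) :
    IsSmoothInCodimOne (orbitClosure K P σ) := by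
  let I := {τ : P.Face // rank τ + 2 ≤ rank σ}
  have hsub : singularLocus (orbitClosure K P σ) ⊆
      ⋃ τ : I, (orbitClosureIrred K τ.1 : Set (ℙ K (P.Lam → K))) := by
    rintro p ⟨hp, hsing⟩
    obtain ⟨τ, hτσ, t, ht⟩ := (mem_orbitClosure_iff.1 hp).exists_eq_toricPoint p.rep_nonzero
    have hlt : τ < σ := lt_of_le_of_ne hτσ fun h => hsing (isSmoothPoint_of_covBy (Or.inl h) ht)
    have hcov : ¬ τ ⋖ σ := fun h => hsing (isSmoothPoint_of_covBy (Or.inr h) ht)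
    refine Set.mem_iUnion.2 ⟨⟨τ, rank_add_two_le hlt hcov⟩, ?_⟩
    change p ∈ orbitClosure K P τ
    rw [mem_orbitClosure_iff, ht]
    exact isToric_toricPoint τ t
  rw [IsSmoothInCodimOne, dim_orbitClosure]
  by_cases hI : Nonempty I
  · obtain ⟨τ₀, hτ₀⟩ := hI
    have h1 := one_le_rank τ₀
    -- The face `τ₀` guarantees `3 ≤ rank σ`, so the subtraction is not truncated.
    have h2 : dim (singularLocus (orbitClosure K P σ)) ≤
        (((rank σ - 3 : ℕ) : ℕ∞) : WithBot ℕ∞) := by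
      refine topologicalKrullDim_le_of_subset_iUnion _ (fun τ : I => ?_) hsub
      rw [height_orbitClosure]
      have := τ.2
      exact_mod_cast (by omega : rank τ.1 - 1 ≤ rank σ - 3)
    calc dim (singularLocus (orbitClosure K P σ)) + 2
        ≤ (((rank σ - 3 : ℕ) : ℕ∞) : WithBot ℕ∞) + 2 := add_le_add_left h2 2
      _ = (((rank σ - 1 : ℕ) : ℕ∞) : WithBot ℕ∞) := by
        rw [show rank σ - 1 = rank σ - 3 + 2 by omega]
        norm_num
  -- An empty singular locus has dimension `⊥`, and `⊥ + 2 = ⊥`.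
  · have h1 : singularLocus (orbitClosure K P σ) = ∅ := by
      refine Set.subset_eq_empty hsub ?_
      have : IsEmpty I := not_nonempty_iff.1 hI
      simp
    have h2 : dim (singularLocus (orbitClosure K P σ)) = ⊥ := by
      rw [h1, dim, topologicalKrullDim, Order.krullDim_eq_bot_iff]
      exact ⟨fun Z => Z.isIrreducible.nonempty.some.2⟩
    rw [h2]
    simp

theorem isCodimOneIn_orbitClosure {τ σ : P.Face} (h : τ ⋖ σ) :
    IsCodimOneIn (orbitClosure K P τ) (orbitClosure K P σ) := by
  refine ⟨orbitClosure_subset_iff.2 h.le, ?_⟩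
  rw [dim_orbitClosure, dim_orbitClosure, rank_covBy h]
  have := one_le_rank τ
  exact_mod_cast (by omega : rank τ - 1 + 1 = rank τ + 1 - 1)

end Tangent

/-! ### Eigenfunctions -/

section Eigenfunctions

variable {K : Type*} [Field K] {n : ℕ} {P : NormalLatticePolytope n}

/-- The monomial function on the cone over the toric variety. -/
def monFun (K : Type*) [Field K] (a : P.Lam →₀ ℕ) (c : K) : CoordRing (toricVariety K P) :=
  Ideal.Quotient.mk _ (MvPolynomial.monomial a c)

theorem evalAt_mk {ι : Type*} {X : Set (ℙ K (ι → K))} (x : affineCone X) (F : MvPolynomial ι K) :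
    evalAt x (Ideal.Quotient.mk _ F) = MvPolynomial.eval (x : ι → K) F := rfl

theorem torusActVec_toricPoint (S : Set P.Lam) (s t : TorusHat K n) :
    torusActVec P t (toricPoint S s) = toricPoint S (t * s) := by
  ext χ
  by_cases h : χ ∈ S
  · simp only [torusActVec, toricPoint_of_mem h, characterHat_mul, characterHat_hat, Units.val_mul]
  · simp [torusActVec, toricPoint_of_notMem h]

theorem mon_mk_rep_eq_zero_iff {v : P.Lam → K} {hv : v ≠ 0} {a : P.Lam →₀ ℕ} :
    mon (Projectivization.mk K v hv).rep a = 0 ↔ mon v a = 0 := by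
  have := eval_rep_eq_zero_iff (MvPolynomial.isHomogeneous_monomial (1 : K) (rfl : a.degree = _))
    v hv
  rwa [eval_monomial_eq, eval_monomial_eq, one_mul, one_mul] at this

theorem mem_vanishingSet_monFun_iff {a : P.Lam →₀ ℕ} {c : K} (hc : c ≠ 0)
    {p : ℙ K (P.Lam → K)} :
    p ∈ vanishingSet (monFun K a c) ↔ p ∈ toricVariety K P ∧ mon p.rep a = 0 := by
  constructor
  · rintro ⟨x, hx, rfl, h⟩
    rw [monFun, evalAt_mk, eval_monomial_eq] at h
    exact ⟨x.2 hx, mon_mk_rep_eq_zero_iff.2 ((mul_eq_zero.1 h).resolve_left hc)⟩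
  · rintro ⟨hp, h⟩
    refine ⟨⟨p.rep, fun _ => by rwa [Projectivization.mk_rep]⟩, p.rep_nonzero, p.mk_rep, ?_⟩
    rw [monFun, evalAt_mk, eval_monomial_eq, h, mul_zero]

theorem IsHatEigenfunction.isEigenfunction {f : CoordRing (toricVariety K P)}
    {μ : ℤ × (Fin n → ℤ)} (h : IsHatEigenfunction f μ) : IsEigenfunction f := by
  refine ⟨h.1, μ.2, fun t => ?_⟩
  rw [h.2, characterHat, one_zpow, one_mul]

variable [CharZero K]

theorem toricPoint_mem_affineCone (t : TorusHat K n) :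
    toricPoint (latticePoints P.topFace) t ∈ affineCone (toricVariety K P) := by
  rw [← orbitClosure_topFace, mem_affineCone_orbitClosure_iff]
  exact isToric_toricPoint _ t

theorem mk_eq_mk_iff {F G : MvPolynomial P.Lam K} :
    (Ideal.Quotient.mk _ F : CoordRing (toricVariety K P)) = Ideal.Quotient.mk _ G ↔
      toricMap K (latticePoints P.topFace) F = toricMap K (latticePoints P.topFace) G := by
  rw [Ideal.Quotient.mk_eq_mk_iff_sub_mem, ← orbitClosure_topFace,
    mem_vanishingIdeal_orbitClosure_iff, map_sub, sub_eq_zero]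

/-- Along the torus orbit of the base point, `f` is its value there times a character. The inverse
in the action on functions turns the weight `μ` into the exponent `-μ`. -/
theorem IsHatEigenfunction.toricMap_eq {F : MvPolynomial P.Lam K} {μ : ℤ × (Fin n → ℤ)}
    (h : IsHatEigenfunction (Ideal.Quotient.mk _ F : CoordRing (toricVariety K P)) μ) :
    toricMap K (latticePoints P.topFace) F = AddMonoidAlgebra.single (-μ)
      (MvPolynomial.eval (toricPoint (latticePoints P.topFace) 1) F) := by
  rw [← sub_eq_zero]
  refine eq_zero_of_forall_evalHat fun t => ?_
  rw [map_sub, evalHat_toricMap, evalHat_single, sub_eq_zero]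
  have h1 := congrArg (evalAt ⟨_, toricPoint_mem_affineCone 1⟩) (h.2 t⁻¹)
  change MvPolynomial.eval _ (torusActPoly P t⁻¹ F) = _ at h1
  rw [eval_torusActPoly, inv_inv, torusActVec_toricPoint, mul_one, map_smul, evalAt_mk,
    smul_eq_mul, characterHat_inv] at h1
  rw [h1, characterHat_neg, mul_comm]

theorem exists_mem_support_wt_eq {S : Set P.Lam} {F : MvPolynomial P.Lam K}
    {w : ℤ × (Fin n → ℤ)} {c : K} (hc : c ≠ 0)
    (h : toricMap K S F = AddMonoidAlgebra.single w c) :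
    ∃ a ∈ F.support, P.wt a = w := by
  by_contra! hcon
  have h1 : (toricMap K S F).coeff w = 0 := by
    rw [MvPolynomial.as_sum F, map_sum, AddMonoidAlgebra.coeff_sum, Finsupp.finsetSum_apply]
    refine Finset.sum_eq_zero fun a ha => ?_
    by_cases hS : SupportedOn S a
    · rw [toricMap_monomial hS, AddMonoidAlgebra.coeff_single,
        Finsupp.single_eq_of_ne (hcon a ha).symm]
    · rw [toricMap_monomial_of_not hS]
      rfl
  rw [h, AddMonoidAlgebra.coeff_single, Finsupp.single_eq_same] at h1
  exact hc h1

/-- Homogeneous eigenfunctions on the cone are monomials. -/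
theorem IsHatEigenfunction.exists_eq_monFun {f : CoordRing (toricVariety K P)}
    {μ : ℤ × (Fin n → ℤ)} {m : ℕ} (h : IsHatEigenfunction f μ) (hm : IsHomogeneousOfDegree f m) :
    ∃ (a : P.Lam →₀ ℕ) (c : K), c ≠ 0 ∧ a.degree = m ∧ μ = -P.wt a ∧ f = monFun K a c := by
  obtain ⟨F, hF, rfl⟩ := hm
  have h1 := h.toricMap_eq
  set c := MvPolynomial.eval (toricPoint (latticePoints P.topFace) 1) F
  have hc : c ≠ 0 := by
    intro h0
    rw [h0, AddMonoidAlgebra.single_zero, ← map_zero (toricMap K (latticePoints P.topFace)),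
      ← mk_eq_mk_iff, map_zero] at h1
    exact h.1 h1
  obtain ⟨a, ha, hw⟩ := exists_mem_support_wt_eq hc h1
  refine ⟨a, c, hc, ?_, by rw [hw, neg_neg], ?_⟩
  · have := hF (MvPolynomial.mem_support_iff.1 ha)
    rwa [Finsupp.degree_eq_weight_one]
  · rw [monFun, mk_eq_mk_iff, toricMap_monomial fun χ hχ => ?_, hw, h1]
    rw [latticePoints_topFace] at hχ
    exact absurd (Set.mem_univ χ) hχ

theorem IsHatEigenfunction.weight_unique {f : CoordRing (toricVariety K P)}
    {μ μ' : ℤ × (Fin n → ℤ)} (h : IsHatEigenfunction f μ) (h' : IsHatEigenfunction f μ') :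
    μ = μ' := by
  refine characterHom_injective (K := K) (MonoidHom.ext fun t => ?_)
  exact smul_left_injective K h.1 ((h.2 t).symm.trans (h'.2 t))

theorem mk_toricPoint_mem_orbitClosure_iff {τ σ : P.Face} (t : TorusHat K n)
    (h : toricPoint (latticePoints τ) t ≠ 0) :
    Projectivization.mk K _ h ∈ orbitClosure K P σ ↔ τ ≤ σ := by
  rw [mem_orbitClosure_iff, isToric_rep_mk, le_iff_latticePoints_subset]
  constructor
  · intro hτ χ hχ
    by_contra hcon
    exact toricPoint_ne_zero_iff.2 hχ (hτ.1 χ hcon)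
  · intro hτ
    exact ⟨fun χ hχ => toricPoint_of_notMem (fun h => hχ (hτ h)) t, (isToric_toricPoint τ t).2⟩

/-- The nonzero coordinates on the orbit of `τ` are exactly those in `τ`, so whether a monomial
vanishes does not depend on the point of the orbit. -/
theorem mk_toricPoint_mem_vanishingSet_iff {τ : P.Face} (t : TorusHat K n)
    (h : toricPoint (latticePoints τ) t ≠ 0) {a : P.Lam →₀ ℕ} {c : K} (hc : c ≠ 0) :
    Projectivization.mk K _ h ∈ vanishingSet (monFun K a c) ↔
      ¬ SupportedOn (latticePoints τ) a := by
  rw [mem_vanishingSet_monFun_iff hc, mon_mk_rep_eq_zero_iff, ← orbitClosure_topFace,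
    mk_toricPoint_mem_orbitClosure_iff, ← not_iff_not, not_and, not_not, ← ne_eq, mon_ne_zero_iff]
  simp only [toricPoint_ne_zero_iff, Set.ofPred_mem_eq, le_topFace, true_imp_iff]

theorem exists_eq_mk_toricPoint [IsAlgClosed K] {σ : P.Face} {p : ℙ K (P.Lam → K)}
    (hp : p ∈ orbitClosure K P σ) : ∃ τ : P.Face, τ ≤ σ ∧ ∃ (t : TorusHat K n)
      (h : toricPoint (latticePoints τ) t ≠ 0), p = Projectivization.mk K _ h := by
  obtain ⟨τ, hτ, t, ht⟩ := (mem_orbitClosure_iff.1 hp).exists_eq_toricPoint p.rep_nonzero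
  refine ⟨τ, hτ, t, ht ▸ p.rep_nonzero, ?_⟩
  conv_lhs => rw [← p.mk_rep]
  congr 1

end Eigenfunctions

/-! ### Normalized weights -/

section NormalizedWeights

variable {n : ℕ} {P : NormalLatticePolytope n}

/-- The weighted mean of the lattice points of `P` with weights `a`. -/
def center (a : P.Lam →₀ ℕ) : Fin n → ℝ := (a.degree : ℝ)⁻¹ • toReal (P.wt a).2

theorem smul_toRealHat_wt {a : P.Lam →₀ ℕ} (ha : 1 ≤ a.degree) :
    (a.degree : ℝ)⁻¹ • toRealHat (P.wt a) = (1, center a) := by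
  have h : (a.degree : ℝ) ≠ 0 := by positivity
  refine Prod.ext ?_ rfl
  change (a.degree : ℝ)⁻¹ * ((P.wt a).1 : ℝ) = 1
  rw [wt_fst, Int.cast_natCast, inv_mul_cancel₀ h]

theorem normalizedWeight_neg_wt {a : P.Lam →₀ ℕ} (ha : 1 ≤ a.degree) :
    normalizedWeight (-P.wt a) a.degree = (1, center a) := by
  rw [← smul_toRealHat_wt ha, normalizedWeight]
  change _ • toRealHat (-P.wt a) = _
  rw [map_neg, smul_neg, neg_smul, neg_neg, one_div]

theorem center_mem_iff {a : P.Lam →₀ ℕ} (ha : 1 ≤ a.degree) {τ : P.Face} :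
    center a ∈ τ.1 ↔ SupportedOn (latticePoints τ) a := by
  have h : (a.degree : ℝ) ≠ 0 := by positivity
  rw [mem_face_iff, supportedOn_iff_inCone, ← smul_toRealHat_wt ha]
  refine ⟨fun hx => ?_, fun hx => hx.smul (by positivity)⟩
  have := hx.smul (c := (a.degree : ℝ)) (by positivity)
  rwa [smul_inv_smul₀ h] at this

end NormalizedWeights

/-! ### Seshadri stratifications by orbit closures -/

section Stratifications

variable {K : Type*} [Field K] [CharZero K] {n : ℕ} {P : NormalLatticePolytope n}

/-- (S3) is tested at one point of the orbit of each `τ ≤ σ`: the monomial vanishes there precisely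
when `τ` lies in some facet of `σ`, i.e. when `τ ≠ σ`. -/
theorem inInterior_of_boundary {σ : P.Face} {a : P.Lam →₀ ℕ} (ha : 1 ≤ a.degree) {c : K}
    (hc : c ≠ 0) (h : vanishingSet (monFun K a c) ∩ orbitClosure K P σ =
      ⋃ τ, ⋃ (_ : τ ⋖ σ), orbitClosure K P τ) : InInterior σ (1, center a) := by
  have key : ∀ τ ≤ σ, center a ∈ τ.1 ↔ τ = σ := by
    intro τ hτ
    have h0 := toricPoint_ne_zero (latticePoints_nonempty τ) (1 : TorusHat K n)
    have h1 := Set.ext_iff.1 h (Projectivization.mk K _ h0)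
    simp only [Set.mem_inter_iff, Set.mem_iUnion, exists_prop,
      mk_toricPoint_mem_orbitClosure_iff, mk_toricPoint_mem_vanishingSet_iff _ _ hc, hτ,
      and_true, ← center_mem_iff ha] at h1
    rw [← not_iff_not, h1]
    constructor
    · rintro ⟨ρ, hρ, hτρ⟩ rfl
      exact hρ.lt.not_ge hτρ
    · intro hne
      obtain ⟨ρ, h2, h3⟩ := exists_covBy_of_lt (lt_of_le_of_ne hτ hne)
      exact ⟨ρ, h3, h2⟩
  exact inInterior_of_forall_face ((key σ le_rfl).2 rfl) fun τ hτ hx => (key τ hτ).1 hx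

variable [IsAlgClosed K]

/-- (S2) and (S3) are checked orbit by orbit. If the function of `ρ` is nonzero on the orbit of `τ`,
its center lies in `τ`; being interior to `ρ`, it forces `ρ ≤ τ`. -/
theorem isSeshadriStratification_of_inInterior {a : P.Face → P.Lam →₀ ℕ}
    (ha : ∀ σ, 1 ≤ (a σ).degree) {c : P.Face → K} (hc : ∀ σ, c σ ≠ 0)
    (h : ∀ σ, InInterior σ (1, center (a σ))) :
    IsSeshadriStratification (toricVariety K P) (orbitClosure K P)
      fun σ => monFun K (a σ) (c σ) where
  finite := inferInstance
  variety := isProjectiveVariety_orbitClosure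
  subset σ := by
    rw [← orbitClosure_topFace]
    exact orbitClosure_subset_iff.2 (le_topFace σ)
  homogeneous σ := ⟨(a σ).degree, ha σ, _, MvPolynomial.isHomogeneous_monomial _ rfl, rfl⟩
  le_iff _ _ := orbitClosure_subset_iff.symm
  exists_top := ⟨P.topFace, le_topFace, orbitClosure_topFace⟩
  smooth := isSmoothInCodimOne_orbitClosure
  codim_one _ _ := isCodimOneIn_orbitClosure
  vanish σ ρ hρ p hp := by
    obtain ⟨τ, hτ, t, h0, rfl⟩ := exists_eq_mk_toricPoint hp
    rw [mk_toricPoint_mem_vanishingSet_iff t h0 (hc ρ), ← center_mem_iff (ha ρ)]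
    exact fun hx => hρ (((h ρ).le_of_mem hx).trans hτ)
  boundary σ := by
    have key : ∀ τ ≤ σ, ¬ SupportedOn (latticePoints τ) (a σ) ↔ ∃ ρ, ρ ⋖ σ ∧ τ ≤ ρ := by
      intro τ hτ
      rw [← center_mem_iff (ha σ)]
      constructor
      · intro hx
        obtain ⟨ρ, h1, h2⟩ := exists_covBy_of_lt (lt_of_le_of_ne hτ fun h' =>
          by
          subst h'
          exact hx ((mem_face_iff _ _).2 (h τ).1))
        exact ⟨ρ, h2, h1⟩
      · rintro ⟨ρ, hρ, hτρ⟩ hx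
        exact hρ.lt.not_ge (((h σ).le_of_mem hx).trans hτρ)
    have hiff : ∀ p ∈ orbitClosure K P σ, p ∈ vanishingSet (monFun K (a σ) (c σ)) ↔
        p ∈ ⋃ τ, ⋃ (_ : τ ⋖ σ), orbitClosure K P τ := by
      intro p hp
      obtain ⟨τ, hτ, t, h0, rfl⟩ := exists_eq_mk_toricPoint hp
      rw [mk_toricPoint_mem_vanishingSet_iff t h0 (hc σ), key τ hτ]
      simp only [Set.mem_iUnion, exists_prop, mk_toricPoint_mem_orbitClosure_iff]
    have hsub : ⋃ τ, ⋃ (_ : τ ⋖ σ), orbitClosure K P τ ⊆ orbitClosure K P σ :=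
      Set.iUnion₂_subset fun τ hτ => orbitClosure_subset_iff.2 hτ.le
    ext p
    exact ⟨fun hp => (hiff p hp.2).1 hp.1, fun hp => ⟨(hiff p (hsub hp)).2 hp, hsub hp⟩⟩

end Stratifications

end ToricSeshadri

end

theorem mainTheorem7 {K : Type*} [Field K] [IsAlgClosed K] [CharZero K] {n : ℕ}
    (P : ToricSeshadri.NormalLatticePolytope n)
    (f : P.Face → ToricSeshadri.CoordRing (ToricSeshadri.toricVariety K P))
    (μ : P.Face → ℤ × (Fin n → ℤ)) (m : P.Face → ℕ)
    (hμ : ∀ σ, ToricSeshadri.IsHatEigenfunction (f σ) (μ σ))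
    (hdeg : ∀ σ, ToricSeshadri.IsHomogeneousOfDegree (f σ) (m σ))
    (hm : ∀ σ, 1 ≤ m σ) :
    [ToricSeshadri.IsEquivariantSeshadriStratification (ToricSeshadri.orbitClosure K P) f,
      ToricSeshadri.IsCombinatorialSeshadriStratification (ToricSeshadri.orbitClosure K P) f,
      ∀ σ : P.Face, ToricSeshadri.normalizedWeight (μ σ) (m σ) ∈
        intrinsicInterior ℝ (ToricSeshadri.liftFace σ.1)].TFAE := by
  choose a c hc hdega hwt hf using fun σ => (hμ σ).exists_eq_monFun (hdeg σ)
  have ha : ∀ σ, 1 ≤ (a σ).degree := fun σ => (hdega σ).symm ▸ hm σ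
  have hnw : ∀ σ, ToricSeshadri.normalizedWeight (μ σ) (m σ) =
      (1, ToricSeshadri.center (a σ)) := fun σ => by
    rw [hwt σ, ← hdega σ, ToricSeshadri.normalizedWeight_neg_wt (ha σ)]
  -- Of the stratification axioms only (S3) is needed here.
  tfae_have 1 → 3 := by
    intro h σ
    rw [hnw, ToricSeshadri.NormalLatticePolytope.mem_intrinsicInterior_liftFace_iff]
    refine ToricSeshadri.inInterior_of_boundary (ha σ) (hc σ) ?_
    rw [← hf σ]
    exact h.seshadri.boundary σ
  tfae_have 3 → 2 := fun h => ⟨fun _ => rfl, fun σ => ⟨μ σ, m σ, hμ σ, hm σ, hdeg σ, h σ⟩⟩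
  tfae_have 2 → 1 := by
    intro h
    refine ⟨?_, fun _ => rfl, fun σ => (hμ σ).isEigenfunction⟩
    rw [funext hf]
    refine ToricSeshadri.isSeshadriStratification_of_inInterior ha hc fun σ => ?_
    -- The weight and degree supplied by the combinatorial condition must be the given ones: a
    -- nonzero eigenfunction has a unique weight, and the weight determines the degree.
    obtain ⟨μ', m', hμ', hm', hdeg', hint⟩ := h.weight σ
    obtain ⟨b, d, -, hdegb, hwtb, -⟩ := hμ'.exists_eq_monFun hdeg'
    have hab : P.wt (a σ) = P.wt b := by
      rw [← neg_inj, ← hwt, ← hwtb, (hμ σ).weight_unique hμ']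
    have hm'm : m' = m σ := by rw [← hdegb, ← hdega, ToricSeshadri.degree_eq_of_wt_eq hab]
    rw [hm'm, ← (hμ σ).weight_unique hμ', hnw,
      ToricSeshadri.NormalLatticePolytope.mem_intrinsicInterior_liftFace_iff] at hint
    exact hint
  tfae_finish
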